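/- **Graphs.** Let $G$ be a finite connected graph (multiple edges allowed), viewed as a topological space made of its vertices and closed edges, with an involution $\iota$ acting on $\mathrm{Vert}(G)$ and $\mathrm{Ed}(G)$. $G$ is *hyperelliptic* if (1) every edge is a closed interval with two distinct terminal points, (2) $\iota(e)\neq e$ for every edge $e$, (3) at least three edges start from every vertex $v$ with $\iota(v)\ne v$, and (4) $G/\langle\iota\rangle$ is a tree. A vertex is *non-fixed* if $\iota(v)\neq v$. An edge $e$ is *disjoint*, *one-jointed* or *two-jointed* if $e\cap\iota(e)$ consists of $0$, $1$ or $2$ points. For a non-fixed vertex $v$ let $\nu_G(v)$ be the number of disjoint and one-jointed edges starting from $v$. Let $\mathrm{Ed}(G)^\sim=\mathrm{Ed}(G)/\langle\iota\rangle$, and write $\bar e$ for the class of $e$. An irreducible component of $G$ is a maximal connected subgraph, not a point, that is not a union of two connected subgraphs, neither a point, meeting in exactly one vertex. The *size* of an irreducible component is $1$ if it consists of two two-jointed edges; otherwise it is the number of classes in $\mathrm{Ed}(G)^\sim$ of its one-jointed edges, minus $1$. **Admissible constant.** Give each edge $e$ a length $l_{\bar e}>0$ depending only on $\bar e$. For a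 real divisor $D=\sum_v D_v v$ supported in $\mathrm{Vert}(G)$, with $\deg D\neq-2$, there are a unique (signed) measure $\mu$ on $G$ and a unique symmetric continuous function $g$ on $G\times G$ such that $\int_G\mu=1$, $\Delta_y g(x,y)=\delta_x-\mu$ and $\int_G g(x,y)\,\mu(y)=0$ for all $x\in G$, and $g(D,y)+g(y,y)$ is a constant $c$ on $G$. Here $\Delta f=-f''dx-\sum_v(\text{sum of the outgoing slopes of } f \text{ at } v)\,\delta_v$, in the sense of distributions. Put $\epsilon(G,D)=2\deg(D)\,c-g(D,D)$. **Statement.** Let $G$ be a hyperelliptic graph with lengths $l_{\bar e}$ as above, and let $$D=\sum_{v\ \text{non-fixed}}(\nu_G(v)-2)\,v+\sum_{v'\ \text{fixed}}a_{v'}\,v',\qquad a_{v'}\in\mathbb R,$$ with $\deg D<-2$ or $\deg D\ge 0$. For $\bar e\in\mathrm{Ed}(G)^\sim$, contracting all edges outside $\bar e$ gives a graph with two vertices $P,Q$, on which $D$ induces a divisor $aP+bQ$ (coefficients of identified vertices are added); put $w(\bar e)=\min\{a,b\}$. Then: 1. $$\epsilon(G,D)\le\sum_{w(\bar e)\ne0}\left(\frac43\,\frac{\deg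 D}{\deg D+2}+\frac{w(\bar e)(\deg D-w(\bar e))}{\deg D+2}\right)l_{\bar e}+\sum_{w(\bar e)=0}\frac56\,\frac{\deg D}{\deg D+2}\,l_{\bar e}.$$ 2. If every irreducible component of $G$ has size less than $5$, then $$\epsilon(G,D)\le\sum_{w(\bar e)\ne0}\left(\frac{\deg D}{\deg D+2}+\frac{w(\bar e)(\deg D-w(\bar e))}{\deg D+2}\right)l_{\bar e}+\sum_{w(\bar e)=0}\frac56\,\frac{\deg D}{\deg D+2}\,l_{\bar e}.$$ The sums run over $\bar e\in\mathrm{Ed}(G)^\sim$. -/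

import Mathlib

open MeasureTheory

/-- A graph (multigraph) with vertices `V` and edges `E`.  Every edge is a segment running from
`src e` to `tgt e`; the orientation is only a choice of parametrization. -/
structure MultiGraph (V E : Type*) where
  /-- the starting vertex of an edge -/
  src : E → V
  /-- the final vertex of an edge -/
  tgt : E → V

namespace MultiGraph

variable {V E : Type*}

/-- The set of terminal points of an edge. -/
def ends (G : MultiGraph V E) (e : E) : Set V := {G.src e, G.tgt e}

/-- The equivalence relation on vertices generated by joining the ends of the edges in `S`. -/
def joinSetoid (G : MultiGraph V E) (S : Set E) : Setoid V :=
  Relation.EqvGen.setoid (fun u v => ∃ e ∈ S, G.src e = u ∧ G.tgt e = v)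

/-- The graph is connected (in particular it has a vertex). -/
def Connected (G : MultiGraph V E) : Prop :=
  Nonempty V ∧ ∀ u v, G.joinSetoid Set.univ u v

/-! ### Metrized graphs -/

/-- The points of the metrized graph in which the edge `e` has length `L e`:
the vertices, and on each edge the points at distance `t` from its start, `0 < t < L e`. -/
inductive Point (G : MultiGraph V E) (L : E → ℝ) : Type _
  | vertex (v : V) : Point G L
  | interior (e : E) (t : ℝ) (h₀ : 0 < t) (h₁ : t < L e) : Point G L

open Classical in
/-- The arc-length parametrization `[0, L e] → G` of the edge `e`, extended to all of `ℝ` so that it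
is constant to the left of `0` and to the right of `L e`. -/
noncomputable def pt (G : MultiGraph V E) (L : E → ℝ) (e : E) (t : ℝ) : G.Point L :=
  if h₀ : 0 < t then
    if h₁ : t < L e then Point.interior e t h₀ h₁ else Point.vertex (G.tgt e)
  else Point.vertex (G.src e)

/-- The topology of the metrized graph, i.e. the quotient topology of the disjoint union of its
closed edges (clamping `ℝ → [0, L e]` being a retraction, it makes no difference that the
parametrizations are defined on `ℝ`). -/
noncomputable instance (G : MultiGraph V E) (L : E → ℝ) : TopologicalSpace (G.Point L) :=
  ⨆ e, TopologicalSpace.coinduced (G.pt L e) inferInstance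

noncomputable instance (G : MultiGraph V E) (L : E → ℝ) : MeasurableSpace (G.Point L) := borel _

instance (G : MultiGraph V E) (L : E → ℝ) : BorelSpace (G.Point L) := ⟨rfl⟩

/-- `φ` is a (continuous) function on the metrized graph which is twice continuously differentiable
along every closed edge; `ψ e` is a `C²` function on `ℝ` which is equal to `φ` along `e`. -/
def IsTestFunction (G : MultiGraph V E) (L : E → ℝ) (φ : G.Point L → ℝ) (ψ : E → ℝ → ℝ) : Prop :=
  ∀ e, ContDiff ℝ 2 (ψ e) ∧ ∀ t ∈ Set.Icc 0 (L e), φ (G.pt L e t) = ψ e t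

/-- The integral of `f` against the measure
`Δ φ = - φ'' dx - ∑ᵥ (sum of the outgoing slopes of φ at v) δᵥ`, where `φ` is the function given
along the edges by `ψ`.  At the start of `e` the outgoing slope is `ψ e ' 0`, at its end it is
`- ψ e ' (L e)`. -/
noncomputable def laplacePairing [Fintype E] (G : MultiGraph V E) (L : E → ℝ)
    (f : G.Point L → ℝ) (ψ : E → ℝ → ℝ) : ℝ :=
  ∑ e, (-(∫ t in (0 : ℝ)..(L e), f (G.pt L e t) * deriv (deriv (ψ e)) t)
    - f (Point.vertex (G.src e)) * deriv (ψ e) 0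
    + f (Point.vertex (G.tgt e)) * deriv (ψ e) (L e))

/-- The degree of a divisor supported in the vertices. -/
def divDeg [Fintype V] (D : V → ℝ) : ℝ := ∑ v, D v

/-- `μ` and `g` are the admissible measure and the Green function of the metrized graph `(G; L)`
with respect to the divisor `D`, and `c` is the constant value of `g(D,y) + g(y,y)`.
The Laplacian of the continuous function `g(x, ·)` is taken in the sense of distributions. -/
structure IsAdmissible [Fintype V] [Fintype E] (G : MultiGraph V E) (L : E → ℝ) (D : V → ℝ)
    (μ : SignedMeasure (G.Point L)) (g : G.Point L → G.Point L → ℝ) (c : ℝ) : Prop where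
  total : μ Set.univ = 1
  symm : ∀ x y, g x y = g y x
  continuous : Continuous (fun p : G.Point L × G.Point L => g p.1 p.2)
  laplacian : ∀ x φ ψ, G.IsTestFunction L φ ψ →
    G.laplacePairing L (g x) ψ = φ x - ∫ᵛ y, φ y ∂<•μ
  normalized : ∀ x, ∫ᵛ y, g x y ∂<•μ = 0
  const : ∀ y, ∑ v, D v * g (Point.vertex v) y + g y y = c

/-- The admissible constant `ε(G; L, D) = 2 deg(D) c(G; L, D) - g(D, D)`.  For a connected `G`,
positive `L` and `deg D ≠ -2`, the pair `(μ, g)` exists and is unique. -/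
noncomputable def admissibleConstant [Fintype V] [Fintype E] (G : MultiGraph V E) (L : E → ℝ)
    (D : V → ℝ) : ℝ :=
  Classical.epsilon fun ε : ℝ => ∃ μ g c, G.IsAdmissible L D μ g c ∧
    ε = 2 * divDeg D * c - ∑ u, ∑ v, D u * D v * g (Point.vertex u) (Point.vertex v)

/-! ### Irreducible components -/

/-- The vertices of the subgraph with edge set `S`. -/
def verts (G : MultiGraph V E) (S : Set E) : Set V := ⋃ e ∈ S, G.ends e

/-- The subgraph with edge set `S` is connected. -/
def EdgeConnected (G : MultiGraph V E) (S : Set E) : Prop :=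
  ∀ u ∈ G.verts S, ∀ v ∈ G.verts S, G.joinSetoid S u v

/-- The subgraph with edge set `S` is the one-point-sum of the subgraphs, not reduced to one point,
with edge sets `A` and `B`. -/
def IsOnePointSum (G : MultiGraph V E) (S A B : Set E) : Prop :=
  A.Nonempty ∧ B.Nonempty ∧ G.EdgeConnected A ∧ G.EdgeConnected B ∧
    A ∪ B = S ∧ A ∩ B = ∅ ∧ ∃ v, G.verts A ∩ G.verts B = {v}

/-- The subgraph with edge set `S` is connected, not one point, and not a one-point-sum. -/
def IsIrreducible (G : MultiGraph V E) (S : Set E) : Prop :=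
  S.Nonempty ∧ G.EdgeConnected S ∧ ¬ ∃ A B, G.IsOnePointSum S A B

/-- Irreducible components, i.e. the maximal irreducible subgraphs. -/
def IsIrredComponent (G : MultiGraph V E) (S : Set E) : Prop :=
  Maximal G.IsIrreducible S

/-! ### Hyperelliptic graphs -/

/-- An involution of a graph: its actions on the vertices and on the edges. -/
structure Involution (G : MultiGraph V E) where
  /-- the action on the vertices -/
  vert : V → V
  /-- the action on the edges -/
  edge : E → E
  vert_vert : ∀ v, vert (vert v) = v
  edge_edge : ∀ e, edge (edge e) = e
  ends_edge : ∀ e, s(G.src (edge e), G.tgt (edge e)) = s(vert (G.src e), vert (G.tgt e))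

namespace Involution

variable {G : MultiGraph V E} (ι : G.Involution)

/-- Orbits of the involution on the vertices. -/
def vertSetoid : Setoid V where
  r u v := v = u ∨ v = ι.vert u
  iseqv := by
    refine ⟨fun _ => Or.inl rfl, ?_, ?_⟩
    · rintro u v (rfl | rfl)
      · exact Or.inl rfl
      · exact Or.inr (ι.vert_vert u).symm
    · rintro u v w (rfl | rfl) (rfl | rfl)
      · exact Or.inl rfl
      · exact Or.inr rfl
      · exact Or.inr rfl
      · exact Or.inl (ι.vert_vert u)

/-- Orbits of the involution on the edges. -/
def edgeSetoid : Setoid E where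
  r e f := f = e ∨ f = ι.edge e
  iseqv := by
    refine ⟨fun _ => Or.inl rfl, ?_, ?_⟩
    · rintro u v (rfl | rfl)
      · exact Or.inl rfl
      · exact Or.inr (ι.edge_edge u).symm
    · rintro u v w (rfl | rfl) (rfl | rfl)
      · exact Or.inl rfl
      · exact Or.inr rfl
      · exact Or.inr rfl
      · exact Or.inl (ι.edge_edge u)

/-- The vertices of the quotient graph. -/
def VertClass : Type _ := Quotient ι.vertSetoid

/-- The edges `ē` of the quotient graph. -/
def EdgeClass : Type _ := Quotient ι.edgeSetoid

/-- The class of a vertex. -/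
def vertClass (v : V) : ι.VertClass := Quotient.mk ι.vertSetoid v

/-- The class `ē` of an edge `e`. -/
def edgeClass (e : E) : ι.EdgeClass := Quotient.mk ι.edgeSetoid e

noncomputable instance [Fintype E] : Fintype ι.EdgeClass :=
  @Fintype.ofFinite _ (Quotient.finite ι.edgeSetoid)

/-- The ends of an edge of the quotient graph. -/
def quotEnds : ι.EdgeClass → Sym2 ι.VertClass :=
  Quotient.lift (fun e => s(ι.vertClass (G.src e), ι.vertClass (G.tgt e))) (by
    have key : ∀ v, ι.vertClass (ι.vert v) = ι.vertClass v := fun v =>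
      Quotient.sound (s := ι.vertSetoid) (Or.inr (ι.vert_vert v).symm)
    rintro e f (rfl | rfl)
    · rfl
    · have h := congrArg (Sym2.map ι.vertClass) (ι.ends_edge e)
      simp only [Sym2.map_mk, key] at h
      exact h.symm)

/-- The quotient graph has no cycle: no edge of it is a loop, no two edges of it are parallel, and
the underlying simple graph is acyclic. -/
def QuotAcyclic : Prop :=
  (∀ ē, ¬ (ι.quotEnds ē).IsDiag) ∧ Function.Injective ι.quotEnds ∧
    (SimpleGraph.fromEdgeSet (Set.range ι.quotEnds)).IsAcyclic

/-- Hyperelliptic graphs. -/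
structure IsHyperelliptic : Prop where
  connected : G.Connected
  src_ne_tgt : ∀ e, G.src e ≠ G.tgt e
  edge_ne : ∀ e, ι.edge e ≠ e
  three_le : ∀ v, ι.vert v ≠ v → 3 ≤ {e | v ∈ G.ends e}.ncard
  quotAcyclic : ι.QuotAcyclic

/-- The number of points of `e ∩ ι(e)` (for `ι(e) ≠ e`): the edge `e` is disjoint, one-jointed or
two-jointed when this is `0`, `1` or `2`. -/
noncomputable def joint (e : E) : ℕ := (G.ends e ∩ G.ends (ι.edge e)).ncard

/-- The number of disjoint edges and one-jointed edges which start from `v`. -/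
noncomputable def nu (v : V) : ℕ :=
  {e | v ∈ G.ends e ∧ ι.joint e = 0}.ncard + {e | v ∈ G.ends e ∧ ι.joint e = 1}.ncard

open Classical in
/-- The size of an irreducible component with edge set `S`: it is `1` if the component is simple,
i.e. consists of two two-jointed edges, and otherwise it is the number of classes of one-jointed
edges minus `1`. -/
noncomputable def size (S : Set E) : ℤ :=
  if S.ncard = 2 ∧ ∀ e ∈ S, ι.joint e = 2 then 1
  else ((ι.edgeClass '' {e | e ∈ S ∧ ι.joint e = 1}).ncard : ℤ) - 1

/-- The vertices of the graph `G^ē` obtained by contracting all edges of `G` that are not in the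
class `ē`. -/
def ContractedVert (ē : ι.EdgeClass) : Type _ :=
  Quotient (G.joinSetoid {e | ι.edgeClass e ≠ ē})

/-- The coefficient at `P` of the divisor `D^ē` induced by `D` on `G^ē`. -/
noncomputable def contractedCoeff [Fintype V] (D : V → ℝ) (ē : ι.EdgeClass)
    (P : ι.ContractedVert ē) : ℝ :=
  ∑ v, Set.indicator {v | (Quotient.mk _ v : ι.ContractedVert ē) = P} D v

/-- `w(ē)`: the minimum of the coefficients of `D^ē` at the (two) vertices of `G^ē`. -/
noncomputable def w [Fintype V] (D : V → ℝ) (ē : ι.EdgeClass) : ℝ :=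
  ⨅ P : ι.ContractedVert ē, ι.contractedCoeff D ē P

end Involution

end MultiGraph

/-! Write d = deg D. The theorem is reduced to an inequality edge by edge on a rooted tree.

Admissible constant. Let j be the discrete Green function grounded at a vertex o. Interpolating j
along the edges and adding the Dirichlet kernel of each edge gives a Green function of the metrized
graph. Subtracting a multiple of (diagonal + potential of D) in each variable, and adding a
constant, makes it admissible. Weyl's lemma shows that no other choice is possible. Hence (d+2)ε =
2d Σ D_v j(v,v) - 2 Σ D_u D_v j(u,v) + d·(energy of the diagonal of j); see
`IsGreen.admissibleConstant_eq`.

Symmetry. Take o fixed by ι and orient the edges away from o. The ι-symmetric part of j measures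
common paths in the quotient tree, so it contributes only through the mass M_e of D beyond e. The
antisymmetric part `skew` is the Green function of the network whose fixed vertices are grounded.
Put r(v) = skew(v,v), and let a, b ≥ 0 be the currents through e when a unit current enters at its
upper, respectively lower, end. Then a + b < 1, and (1-a-b) r(up) = a(1-a)L, (1-a-b) r(low) =
b(1-b)L. Two evaluations of Σ D_v r(v), both using Kirchhoff's law and D_v = valence - 2 at
non-fixed v, are averaged to give `Rooting.IsMetrized.admissibleConstant_eq`: (d+2)ε = Σ_e L_e
[M(d-M)/2 + d(1/2 - (1-a-b)²/6 - (a-b)²/2)]. Since w(d-w) = M(d-M), for d > 0 the bound with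
coefficient d/(d+2) says exactly that Σ_e L_e [(1-a-b)²/3 + (a-b)² - z_e] ≥ 0, where z_e = 1/6 if w
= 0 and z_e = 0 otherwise.

Telescoping. A single summand can be negative, so each is bounded below by c_e r(up e) - C_e r(low
e). Here c_e depends on the position of M_e relative to 0 and d, and C_e is at most the sum of c_f
over the edges f leaving low e downwards (`sum_upWeight_ge`). Summed over e, the lower bounds are
nonnegative because every non-fixed vertex is the lower end of exactly one edge. Each local bound is
a cubic inequality on the simplex a + b + t = 1 (`localForm`). -/

namespace MultiGraph

variable {V E : Type*} {G : MultiGraph V E} {L : E → ℝ}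

/-! ### The points of a metrized graph -/

section Points

theorem pt_of_nonpos (e : E) {t : ℝ} (h : t ≤ 0) : G.pt L e t = Point.vertex (G.src e) := by
  simp [pt, not_lt.2 h]

theorem pt_of_ge (hL : ∀ e, 0 < L e) (e : E) {t : ℝ} (h : L e ≤ t) :
    G.pt L e t = Point.vertex (G.tgt e) := by
  simp [pt, not_lt.2 h, (hL e).trans_le h]

theorem pt_zero (e : E) : G.pt L e 0 = Point.vertex (G.src e) := pt_of_nonpos e le_rfl

theorem pt_length (hL : ∀ e, 0 < L e) (e : E) : G.pt L e (L e) = Point.vertex (G.tgt e) :=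
  pt_of_ge hL e le_rfl

theorem pt_interior (e : E) {t : ℝ} (h₀ : 0 < t) (h₁ : t < L e) :
    G.pt L e t = Point.interior e t h₀ h₁ := by
  simp [pt, h₀, h₁]

theorem continuous_pt (e : E) : Continuous (G.pt L e) :=
  continuous_iff_coinduced_le.2 (le_iSup (fun e => TopologicalSpace.coinduced (G.pt L e) _) e)

theorem continuous_iff_pt {X : Type*} [TopologicalSpace X] {f : G.Point L → X} :
    Continuous f ↔ ∀ e, Continuous fun t => f (G.pt L e t) := by
  refine ⟨fun h e => h.comp (continuous_pt e), fun h => ?_⟩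
  exact continuous_iSup_dom.2 fun e => continuous_coinduced_dom.2 (h e)

/-- The retraction of the real line onto `[0, L]`. -/
noncomputable def clamp (l t : ℝ) : ℝ := max 0 (min t l)

theorem continuous_clamp (l : ℝ) : Continuous (clamp l) := by unfold clamp; fun_prop

theorem clamp_mem {l : ℝ} (hl : 0 < l) (t : ℝ) : clamp l t ∈ Set.Icc 0 l := by
  simp [clamp, hl.le]

theorem pt_clamp (hL : ∀ e, 0 < L e) (e : E) (t : ℝ) :
    G.pt L e (clamp (L e) t) = G.pt L e t := by
  rcases le_total t 0 with h | h
  · rw [pt_of_nonpos e h, clamp, max_eq_left (min_le_of_left_le h), pt_zero]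
  · rcases le_total t (L e) with h' | h'
    · rw [clamp, min_eq_left h', max_eq_right h]
    · rw [clamp, min_eq_right h', max_eq_right (hL e).le, pt_length hL, pt_of_ge hL e h']

theorem IsTestFunction.continuous (hL : ∀ e, 0 < L e) {φ : G.Point L → ℝ} {ψ : E → ℝ → ℝ}
    (h : G.IsTestFunction L φ ψ) : Continuous φ := by
  refine continuous_iff_pt.2 fun e => ?_
  have : (fun t => φ (G.pt L e t)) = fun t => ψ e (clamp (L e) t) := by
    funext t
    rw [← (h e).2 _ (clamp_mem (hL e) t), pt_clamp hL]
  rw [this]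
  exact (h e).1.continuous.comp (continuous_clamp _)

theorem IsTestFunction.src {φ : G.Point L → ℝ} {ψ : E → ℝ → ℝ}
    (hL : ∀ e, 0 < L e) (h : G.IsTestFunction L φ ψ) (e : E) :
    ψ e 0 = φ (Point.vertex (G.src e)) := by
  rw [← (h e).2 0 ⟨le_rfl, (hL e).le⟩, pt_zero]

theorem IsTestFunction.tgt {φ : G.Point L → ℝ} {ψ : E → ℝ → ℝ}
    (hL : ∀ e, 0 < L e) (h : G.IsTestFunction L φ ψ) (e : E) :
    ψ e (L e) = φ (Point.vertex (G.tgt e)) := by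
  rw [← (h e).2 (L e) ⟨(hL e).le, le_rfl⟩, pt_length hL]

theorem point_cases {p : G.Point L → Prop} (hv : ∀ v, p (Point.vertex v))
    (he : ∀ e t, 0 < t → t < L e → p (G.pt L e t)) (x : G.Point L) : p x := by
  cases x with
  | vertex v => exact hv v
  | interior e t h₀ h₁ => rw [← pt_interior e h₀ h₁]; exact he e t h₀ h₁

theorem isCompact_univ_point [Finite V] [Finite E] :
    IsCompact (Set.univ : Set (G.Point L)) := by
  have : (Set.univ : Set (G.Point L)) =
      Set.range (Point.vertex (G := G) (L := L)) ∪ ⋃ e, G.pt L e '' Set.Icc 0 (L e) := by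
    refine (Set.eq_univ_of_forall fun x => ?_).symm
    refine point_cases (fun v => Or.inl ⟨v, rfl⟩) (fun e t h₀ h₁ => Or.inr ?_) x
    exact Set.mem_iUnion.2 ⟨e, t, ⟨h₀.le, h₁.le⟩, rfl⟩
  rw [this]
  exact (Set.finite_range _).isCompact.union
    (isCompact_iUnion fun e => isCompact_Icc.image (continuous_pt e))

instance [Finite V] [Finite E] : CompactSpace (G.Point L) := ⟨isCompact_univ_point⟩

end Points

/-! ### Linear interpolation -/

section Lin

/-- The function on the metrized graph which is affine along the edges and has the given values at
the vertices. -/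
noncomputable def lin (G : MultiGraph V E) (L : E → ℝ) (a : V → ℝ) : G.Point L → ℝ
  | .vertex v => a v
  | .interior e t _ _ => a (G.src e) + t / L e * (a (G.tgt e) - a (G.src e))

@[simp] theorem lin_vertex (a : V → ℝ) (v : V) : G.lin L a (Point.vertex v) = a v := rfl

theorem lin_pt (hL : ∀ e, 0 < L e) (a : V → ℝ) (e : E) {t : ℝ} (ht : t ∈ Set.Icc 0 (L e)) :
    G.lin L a (G.pt L e t) = a (G.src e) + t / L e * (a (G.tgt e) - a (G.src e)) := by
  rcases ht.1.eq_or_lt with rfl | h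
  · simp [pt_zero]
  rcases ht.2.eq_or_lt with rfl | h'
  · rw [pt_length hL, div_self h.ne']; simp
  · rw [pt_interior e h h']; rfl

theorem lin_isTest (hL : ∀ e, 0 < L e) (a : V → ℝ) : G.IsTestFunction L (G.lin L a)
    (fun e t => a (G.src e) + t / L e * (a (G.tgt e) - a (G.src e))) :=
  fun e => ⟨by fun_prop, fun _ ht => lin_pt hL a e ht⟩

theorem lin_sub (a b : V → ℝ) (x : G.Point L) :
    G.lin L (fun v => a v - b v) x = G.lin L a x - G.lin L b x := by
  cases x <;> simp only [lin]; ring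

theorem lin_const (c : ℝ) (x : G.Point L) : G.lin L (fun _ => c) x = c := by
  cases x <;> simp [lin]

theorem lin_mul_const (a : V → ℝ) (c : ℝ) (x : G.Point L) :
    G.lin L (fun v => a v * c) x = G.lin L a x * c := by
  cases x <;> simp only [lin]; ring

theorem lin_sum {ι : Type*} (s : Finset ι) (a : ι → V → ℝ) (x : G.Point L) :
    G.lin L (fun v => ∑ i ∈ s, a i v) x = ∑ i ∈ s, G.lin L (a i) x := by
  cases x with
  | vertex v => rfl
  | interior e t h₀ h₁ =>
    simp only [lin, ← Finset.sum_sub_distrib, Finset.mul_sum, ← Finset.sum_add_distrib]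

theorem lin_comm (j : V → V → ℝ) (x y : G.Point L) :
    G.lin L (fun v => G.lin L (fun u => j u v) x) y =
      G.lin L (fun u => G.lin L (fun v => j u v) y) x := by
  cases x <;> cases y <;> simp only [lin]; ring

end Lin

/-! ### The Green kernel of the edges -/

section Kernel

/-- The effective resistance from the origin in a circle of length `l`. -/
noncomputable def circleRes (l : ℝ) (z : AddCircle l) : ℝ := ‖z‖ * (l - ‖z‖) / l

theorem continuous_circleRes (l : ℝ) : Continuous (circleRes l) := by
  unfold circleRes; fun_prop

/-- The norm on the circle is the smaller of |t| and l - |t|, and the expression is symmetric in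
these two. -/
theorem circleRes_coe {l : ℝ} (hl : 0 < l) {t : ℝ} (ht : |t| ≤ l) :
    circleRes l (t : AddCircle l) = |t| * (l - |t|) / l := by
  rcases le_total |t| (l / 2) with h | h
  · have := (AddCircle.norm_coe_eq_abs_iff (p := l) (x := t) hl.ne').2 (by rwa [abs_of_pos hl])
    simp [circleRes, this]
  · have key : ‖(t : AddCircle l)‖ = l - |t| := by
      rcases le_total 0 t with h0 | h0
      · rw [abs_of_nonneg h0] at h ht ⊢
        have e1 : (t : AddCircle l) = ((t - l : ℝ) : AddCircle l) := by
          rw [AddCircle.coe_sub, AddCircle.coe_period, sub_zero]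
        have e2 : |t - l| = l - t := by rw [abs_sub_comm, abs_of_nonneg (by linarith)]
        rw [e1, (AddCircle.norm_coe_eq_abs_iff (p := l) hl.ne').2, e2]
        rw [e2, abs_of_pos hl]; linarith
      · rw [abs_of_nonpos h0] at h ht ⊢
        have e1 : (t : AddCircle l) = ((t + l : ℝ) : AddCircle l) := by
          rw [AddCircle.coe_add, AddCircle.coe_period, add_zero]
        have e2 : |t + l| = t + l := abs_of_nonneg (by linarith)
        rw [e1, (AddCircle.norm_coe_eq_abs_iff (p := l) hl.ne').2, e2]
        · ring
        · rw [e2, abs_of_pos hl]; linarith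
    rw [circleRes, key]; ring

open Classical in
/-- The map to a circle which contracts everything outside the edge `e`. -/
noncomputable def toCircle (G : MultiGraph V E) (L : E → ℝ) (e : E) : G.Point L → AddCircle (L e)
  | .vertex _ => 0
  | .interior f t _ _ => if f = e then (t : AddCircle (L e)) else 0

theorem toCircle_pt_self (hL : ∀ e, 0 < L e) (e : E) {t : ℝ} (ht : t ∈ Set.Icc 0 (L e)) :
    G.toCircle L e (G.pt L e t) = (t : AddCircle (L e)) := by
  rcases ht.1.eq_or_lt with rfl | h
  · simp [pt_zero, toCircle]
  rcases ht.2.eq_or_lt with rfl | h'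
  · rw [pt_length hL, AddCircle.coe_period]; rfl
  · rw [pt_interior e h h']; simp [toCircle]

theorem toCircle_pt_of_ne {e f : E} (hne : f ≠ e) (t : ℝ) :
    G.toCircle L e (G.pt L f t) = 0 := by
  unfold pt
  split_ifs <;> simp [toCircle, hne]

theorem continuous_toCircle (hL : ∀ e, 0 < L e) (e : E) : Continuous (G.toCircle L e) := by
  refine continuous_iff_pt.2 fun f => ?_
  by_cases hne : f = e
  · subst hne
    have : (fun t => G.toCircle L f (G.pt L f t)) =
        fun t => ((clamp (L f) t : ℝ) : AddCircle (L f)) := by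
      funext t
      rw [← toCircle_pt_self (G := G) hL f (clamp_mem (hL f) t), pt_clamp hL]
    rw [this]
    exact (AddCircle.continuous_mk' _).comp (continuous_clamp _)
  · simp only [toCircle_pt_of_ne hne]
    exact continuous_const

/-- The Green kernel of the edge `e` with its ends grounded. -/
noncomputable def edgeKernel (G : MultiGraph V E) (L : E → ℝ) (e : E) (x y : G.Point L) : ℝ :=
  (circleRes (L e) (G.toCircle L e x) + circleRes (L e) (G.toCircle L e y) -
    circleRes (L e) (G.toCircle L e x - G.toCircle L e y)) / 2

/-- Writing the Dirichlet kernel as a polarization of the circle resistance makes its joint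
continuity immediate, with no case distinction on the order of the two points. -/
theorem continuous_edgeKernel {X : Type*} [TopologicalSpace X] (hL : ∀ e, 0 < L e) (e : E)
    {f g : X → G.Point L} (hf : Continuous f) (hg : Continuous g) :
    Continuous fun x => G.edgeKernel L e (f x) (g x) := by
  have h1 := (continuous_toCircle (G := G) hL e).comp hf
  have h2 := (continuous_toCircle (G := G) hL e).comp hg
  have h' := continuous_circleRes (L e)
  exact (((h'.comp h1).add (h'.comp h2)).sub (h'.comp (h1.sub h2))).div_const 2

theorem circleRes_zero (l : ℝ) : circleRes l 0 = 0 := by simp [circleRes]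

theorem circleRes_neg (l : ℝ) (z : AddCircle l) : circleRes l (-z) = circleRes l z := by
  simp [circleRes]

theorem edgeKernel_symm (e : E) (x y : G.Point L) :
    G.edgeKernel L e x y = G.edgeKernel L e y x := by
  rw [edgeKernel, edgeKernel, ← neg_sub (G.toCircle L e y), circleRes_neg]; ring

theorem edgeKernel_of_toCircle (e : E) {x : G.Point L} (hx : G.toCircle L e x = 0)
    (y : G.Point L) : G.edgeKernel L e x y = 0 := by
  simp [edgeKernel, hx, circleRes_zero, circleRes_neg]

theorem edgeKernel_pt (hL : ∀ e, 0 < L e) (e : E) {s t : ℝ} (hs : s ∈ Set.Icc 0 (L e))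
    (ht : t ∈ Set.Icc 0 (L e)) (hst : s ≤ t) :
    G.edgeKernel L e (G.pt L e t) (G.pt L e s) = s * (L e - t) / L e := by
  have hl := hL e
  obtain ⟨hs0, hs1⟩ := hs
  obtain ⟨ht0, ht1⟩ := ht
  rw [edgeKernel, toCircle_pt_self hL e ⟨hs0, hs1⟩, toCircle_pt_self hL e ⟨ht0, ht1⟩,
    ← AddCircle.coe_sub, circleRes_coe hl (by rwa [abs_of_nonneg ht0]),
    circleRes_coe hl (by rwa [abs_of_nonneg hs0]),
    circleRes_coe hl (by rw [abs_of_nonneg (by linarith)]; linarith),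
    abs_of_nonneg ht0, abs_of_nonneg hs0, abs_of_nonneg (by linarith : 0 ≤ t - s)]
  field_simp
  ring

end Kernel

end MultiGraph

namespace MultiGraph

variable {V E : Type*} {G : MultiGraph V E} {L : E → ℝ}

/-! ### The weak Laplacian -/

section Laplacian

theorem _root_.ContDiff.continuous_deriv_deriv {ψ : ℝ → ℝ} (h : ContDiff ℝ 2 ψ) :
    Continuous (deriv (deriv ψ)) := by
  have h1 : ContDiff ℝ 1 (deriv ψ) := (contDiff_succ_iff_deriv.1 (by rw [one_add_one_eq_two]; exact h)).2.2
  exact h1.continuous_deriv le_rfl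

theorem _root_.ContDiff.hasDerivAt_two {ψ : ℝ → ℝ} (h : ContDiff ℝ 2 ψ) (t : ℝ) :
    HasDerivAt ψ (deriv ψ t) t ∧ HasDerivAt (deriv ψ) (deriv (deriv ψ) t) t := by
  have h1 : ContDiff ℝ 1 (deriv ψ) := (contDiff_succ_iff_deriv.1 (by rw [one_add_one_eq_two]; exact h)).2.2
  exact ⟨(h.differentiable (by norm_num)).differentiableAt.hasDerivAt,
    (h1.differentiable (by norm_num)).differentiableAt.hasDerivAt⟩

theorem integral_affine_mul_deriv_deriv {ψ : ℝ → ℝ} (h : ContDiff ℝ 2 ψ) (a b u v : ℝ) :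
    ∫ t in u..v, (a + b * t) * deriv (deriv ψ) t =
      ((a + b * v) * deriv ψ v - b * ψ v) - ((a + b * u) * deriv ψ u - b * ψ u) := by
  have hc := h.continuous_deriv_deriv
  refine intervalIntegral.integral_eq_sub_of_hasDerivAt
    (f := fun t => (a + b * t) * deriv ψ t - b * ψ t) (fun t _ => ?_)
    (Continuous.intervalIntegrable (by fun_prop) _ _)
  obtain ⟨h1, h2⟩ := h.hasDerivAt_two t
  have h3 : HasDerivAt (fun t => a + b * t) b t := by
    simpa using ((hasDerivAt_id t).const_mul b).const_add a
  exact ((h3.mul h2).sub (h1.const_mul b)).congr_deriv (by ring)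

theorem edgeKernel_vertex (e : E) (v : V) (y : G.Point L) :
    G.edgeKernel L e (Point.vertex v) y = 0 := edgeKernel_of_toCircle e rfl y

variable [Fintype E]

theorem laplacePairing_add {f₁ f₂ : G.Point L → ℝ} (h₁ : Continuous f₁) (h₂ : Continuous f₂)
    {ψ : E → ℝ → ℝ} (hψ : ∀ e, ContDiff ℝ 2 (ψ e)) :
    G.laplacePairing L (fun x => f₁ x + f₂ x) ψ =
      G.laplacePairing L f₁ ψ + G.laplacePairing L f₂ ψ := by
  simp only [laplacePairing, ← Finset.sum_add_distrib]
  refine Finset.sum_congr rfl fun e _ => ?_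
  have hc := (hψ e).continuous_deriv_deriv
  have e1 : Continuous fun t => f₁ (G.pt L e t) := continuous_iff_pt.1 h₁ e
  have e2 : Continuous fun t => f₂ (G.pt L e t) := continuous_iff_pt.1 h₂ e
  have : ∫ t in (0 : ℝ)..(L e), (f₁ (G.pt L e t) + f₂ (G.pt L e t)) * deriv (deriv (ψ e)) t =
      (∫ t in (0 : ℝ)..(L e), f₁ (G.pt L e t) * deriv (deriv (ψ e)) t) +
      ∫ t in (0 : ℝ)..(L e), f₂ (G.pt L e t) * deriv (deriv (ψ e)) t := by
    simp only [add_mul]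
    exact intervalIntegral.integral_add ((e1.mul hc).intervalIntegrable _ _)
      ((e2.mul hc).intervalIntegrable _ _)
  rw [this]; ring

theorem laplacePairing_const_mul (f : G.Point L → ℝ) (c : ℝ) (ψ : E → ℝ → ℝ) :
    G.laplacePairing L (fun x => c * f x) ψ = c * G.laplacePairing L f ψ := by
  simp only [laplacePairing, Finset.mul_sum, mul_assoc, intervalIntegral.integral_const_mul]
  exact Finset.sum_congr rfl fun e _ => by ring

theorem laplacePairing_sub {f₁ f₂ : G.Point L → ℝ} (h₁ : Continuous f₁) (h₂ : Continuous f₂)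
    {ψ : E → ℝ → ℝ} (hψ : ∀ e, ContDiff ℝ 2 (ψ e)) :
    G.laplacePairing L (fun x => f₁ x - f₂ x) ψ =
      G.laplacePairing L f₁ ψ - G.laplacePairing L f₂ ψ := by
  have := laplacePairing_add h₁ (h₂.const_mul (-1)) hψ
  rw [laplacePairing_const_mul] at this
  simp only [neg_mul, one_mul, ← sub_eq_add_neg] at this
  exact this

theorem laplacePairing_sum {ι : Type*} (s : Finset ι) {f : ι → G.Point L → ℝ}
    (h : ∀ i, Continuous (f i)) {ψ : E → ℝ → ℝ} (hψ : ∀ e, ContDiff ℝ 2 (ψ e)) :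
    G.laplacePairing L (fun x => ∑ i ∈ s, f i x) ψ = ∑ i ∈ s, G.laplacePairing L (f i) ψ := by
  classical
  induction s using Finset.induction_on with
  | empty => simpa using laplacePairing_const_mul (fun _ => (0 : ℝ)) 0 ψ
  | insert a s ha ih =>
    simp only [Finset.sum_insert ha]
    rw [laplacePairing_add (h a) (continuous_finsetSum _ fun i _ => h i) hψ, ih]

/-- Integration by parts on each edge cancels the slope terms and leaves the discrete energy form.
This is how `IsGreen` enters the metrized picture. -/
theorem laplacePairing_lin (hL : ∀ e, 0 < L e) (a : V → ℝ) {φ : G.Point L → ℝ} {ψ : E → ℝ → ℝ}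
    (h : G.IsTestFunction L φ ψ) :
    G.laplacePairing L (G.lin L a) ψ = ∑ e, (a (G.tgt e) - a (G.src e)) *
      (φ (Point.vertex (G.tgt e)) - φ (Point.vertex (G.src e))) / L e := by
  refine Finset.sum_congr rfl fun e _ => ?_
  have hl := hL e
  have : ∫ t in (0 : ℝ)..(L e), G.lin L a (G.pt L e t) * deriv (deriv (ψ e)) t =
      ∫ t in (0 : ℝ)..(L e), (a (G.src e) + ((a (G.tgt e) - a (G.src e)) / L e) * t) *
        deriv (deriv (ψ e)) t := by
    refine intervalIntegral.integral_congr fun t ht => ?_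
    rw [Set.uIcc_of_le hl.le] at ht
    simp only [lin_pt hL a e ht]
    ring
  rw [this, integral_affine_mul_deriv_deriv (h e).1, lin_vertex, lin_vertex, h.src hL, h.tgt hL]
  field_simp
  ring

theorem laplacePairing_const (c : ℝ) (hL : ∀ e, 0 < L e) {φ : G.Point L → ℝ} {ψ : E → ℝ → ℝ}
    (h : G.IsTestFunction L φ ψ) : G.laplacePairing L (fun _ => c) ψ = 0 := by
  have := laplacePairing_lin hL (fun _ => c) h
  rw [funext (lin_const c)] at this
  simpa using this

theorem laplacePairing_edgeKernel_self (hL : ∀ e, 0 < L e) {φ : G.Point L → ℝ} {ψ : E → ℝ → ℝ}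
    (h : G.IsTestFunction L φ ψ) (e : E) {t : ℝ} (ht : t ∈ Set.Icc 0 (L e)) :
    G.laplacePairing L (G.edgeKernel L e (G.pt L e t)) ψ =
      φ (G.pt L e t) - G.lin L (fun v => φ (Point.vertex v)) (G.pt L e t) := by
  have hl := hL e
  rw [laplacePairing, Finset.sum_eq_single e]
  · rw [edgeKernel_symm, edgeKernel_vertex, edgeKernel_symm, edgeKernel_vertex]
    have hc := (h e).1.continuous_deriv_deriv
    have hk : Continuous fun s => G.edgeKernel L e (G.pt L e t) (G.pt L e s) :=
      continuous_edgeKernel hL e continuous_const (continuous_pt e)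
    have hi : ∀ a b, IntervalIntegrable (fun s => G.edgeKernel L e (G.pt L e t) (G.pt L e s) *
        deriv (deriv (ψ e)) s) MeasureTheory.volume a b :=
      fun a b => (hk.mul hc).intervalIntegrable a b
    -- The kernel is affine on either side of its kink at `t`. The kink produces the value of φ at
    -- the point, the two ends produce the interpolated value.
    rw [← intervalIntegral.integral_add_adjacent_intervals (hi 0 t) (hi t (L e))]
    have i1 : ∫ s in (0 : ℝ)..t, G.edgeKernel L e (G.pt L e t) (G.pt L e s) *
        deriv (deriv (ψ e)) s =
        ∫ s in (0 : ℝ)..t, (0 + ((L e - t) / L e) * s) * deriv (deriv (ψ e)) s := by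
      refine intervalIntegral.integral_congr fun s hs => ?_
      rw [Set.uIcc_of_le ht.1] at hs
      simp only [edgeKernel_pt hL e ⟨hs.1, hs.2.trans ht.2⟩ ht hs.2]
      ring
    have i2 : ∫ s in t..(L e), G.edgeKernel L e (G.pt L e t) (G.pt L e s) *
        deriv (deriv (ψ e)) s =
        ∫ s in t..(L e), (t + (-t / L e) * s) * deriv (deriv (ψ e)) s := by
      refine intervalIntegral.integral_congr fun s hs => ?_
      rw [Set.uIcc_of_le ht.2] at hs
      simp only [edgeKernel_symm e (G.pt L e t),
        edgeKernel_pt hL e ht ⟨ht.1.trans hs.1, hs.2⟩ hs.1]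
      field_simp
      ring
    rw [i1, i2, integral_affine_mul_deriv_deriv (h e).1, integral_affine_mul_deriv_deriv (h e).1,
      lin_pt hL _ e ht, (h e).2 t ht, h.src hL, h.tgt hL]
    field_simp
    ring
  · intro f _ hne
    have hz : ∀ s, G.edgeKernel L e (G.pt L e t) (G.pt L f s) = 0 := fun s => by
      rw [edgeKernel_symm, edgeKernel_of_toCircle e (toCircle_pt_of_ne hne s)]
    rw [edgeKernel_symm, edgeKernel_vertex, edgeKernel_symm, edgeKernel_vertex]
    simp [hz]
  · simp

/-- The Green kernel of the metrized graph with all its vertices grounded. -/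
noncomputable def groundedKernel (G : MultiGraph V E) (L : E → ℝ) (x y : G.Point L) : ℝ :=
  ∑ e, G.edgeKernel L e x y

theorem continuous_groundedKernel {X : Type*} [TopologicalSpace X] (hL : ∀ e, 0 < L e)
    {f g : X → G.Point L} (hf : Continuous f) (hg : Continuous g) :
    Continuous fun x => G.groundedKernel L (f x) (g x) :=
  continuous_finsetSum _ fun e _ => continuous_edgeKernel hL e hf hg

theorem groundedKernel_vertex (v : V) (y : G.Point L) :
    G.groundedKernel L (Point.vertex v) y = 0 :=
  Finset.sum_eq_zero fun e _ => edgeKernel_vertex e v y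

theorem groundedKernel_symm (x y : G.Point L) :
    G.groundedKernel L x y = G.groundedKernel L y x :=
  Finset.sum_congr rfl fun e _ => edgeKernel_symm e x y

theorem groundedKernel_pt (e : E) (t : ℝ) (y : G.Point L) :
    G.groundedKernel L (G.pt L e t) y = G.edgeKernel L e (G.pt L e t) y :=
  Finset.sum_eq_single e
    (fun f _ hne => edgeKernel_of_toCircle f (toCircle_pt_of_ne (Ne.symm hne) t) y) (by simp)

theorem laplacePairing_groundedKernel (hL : ∀ e, 0 < L e) {φ : G.Point L → ℝ} {ψ : E → ℝ → ℝ}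
    (h : G.IsTestFunction L φ ψ) (x : G.Point L) :
    G.laplacePairing L (G.groundedKernel L x) ψ =
      φ x - G.lin L (fun v => φ (Point.vertex v)) x := by
  induction x using point_cases with
  | hv v => rw [funext (groundedKernel_vertex v), laplacePairing_const 0 hL h, lin_vertex, sub_self]
  | he e t h₀ h₁ =>
    rw [funext (groundedKernel_pt e t), laplacePairing_edgeKernel_self hL h e ⟨h₀.le, h₁.le⟩]

end Laplacian

/-! ### Green functions -/

/-- `j` is the discrete Green function of the weighted graph `(G; L)` which is grounded at `o`. -/
structure IsGreen [Fintype E] (G : MultiGraph V E) (L : E → ℝ) (o : V) (j : V → V → ℝ) :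
    Prop where
  symm : ∀ u v, j u v = j v u
  base : ∀ v, j o v = 0
  green : ∀ u (h : V → ℝ), ∑ e, (j u (G.tgt e) - j u (G.src e)) *
    (h (G.tgt e) - h (G.src e)) / L e = h u - h o

section Green

theorem continuous_lin_lin {X : Type*} [TopologicalSpace X] (hL : ∀ e, 0 < L e) [Fintype V]
    (j : V → V → ℝ) {f g : X → G.Point L} (hf : Continuous f) (hg : Continuous g) :
    Continuous fun x => G.lin L (fun v => G.lin L (fun u => j u v) (f x)) (g x) := by
  classical
  -- Expanding in the nodal basis turns the bilinear interpolation into a finite sum of products of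
  -- continuous functions of one variable.
  have : ∀ x, G.lin L (fun v => G.lin L (fun u => j u v) (f x)) (g x) =
      ∑ w, G.lin L (fun v => if v = w then 1 else 0) (g x) * G.lin L (fun u => j u w) (f x) := by
    intro p
    simp only [← lin_mul_const, ← lin_sum]
    congr 1
    funext v
    simp
  simp only [this]
  refine continuous_finsetSum _ fun w _ => ?_
  exact (((lin_isTest hL _).continuous hL).comp hg).mul
    (((lin_isTest hL _).continuous hL).comp hf)

variable [Fintype E]

/-- The Green function of the metrized graph which extends the discrete Green function `j`. -/
noncomputable def greenExt (G : MultiGraph V E) (L : E → ℝ) (j : V → V → ℝ)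
    (x y : G.Point L) : ℝ :=
  G.lin L (fun v => G.lin L (fun u => j u v) x) y + G.groundedKernel L x y

theorem greenExt_vertex (j : V → V → ℝ) (u v : V) :
    G.greenExt L j (Point.vertex u) (Point.vertex v) = j u v := by
  simp [greenExt, groundedKernel_vertex]

theorem greenExt_vertex_left (j : V → V → ℝ) (u : V) (y : G.Point L) :
    G.greenExt L j (Point.vertex u) y = G.lin L (j u) y := by
  simp [greenExt, groundedKernel_vertex]

variable {o : V} {j : V → V → ℝ}

theorem IsGreen.base' (hj : G.IsGreen L o j) (v : V) : j v o = 0 := by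
  rw [hj.symm, hj.base]

theorem IsGreen.ext_symm (hj : G.IsGreen L o j) (x y : G.Point L) :
    G.greenExt L j x y = G.greenExt L j y x := by
  rw [greenExt, greenExt, lin_comm, groundedKernel_symm]
  simp only [hj.symm]

theorem IsGreen.ext_base (hj : G.IsGreen L o j) (y : G.Point L) :
    G.greenExt L j (Point.vertex o) y = 0 := by
  rw [greenExt_vertex_left, funext hj.base, lin_const]

theorem continuous_greenExt {X : Type*} [TopologicalSpace X] (hL : ∀ e, 0 < L e) [Fintype V]
    (j : V → V → ℝ) {f g : X → G.Point L} (hf : Continuous f) (hg : Continuous g) :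
    Continuous fun x => G.greenExt L j (f x) (g x) :=
  (continuous_lin_lin hL j hf hg).add (continuous_groundedKernel hL hf hg)

/-- The grounded kernel contributes φ(x) minus the interpolation of φ at x. The interpolation of `j`
contributes that interpolation minus φ(o). -/
theorem IsGreen.laplacePairing_ext [Fintype V] (hj : G.IsGreen L o j) (hL : ∀ e, 0 < L e)
    {φ : G.Point L → ℝ} {ψ : E → ℝ → ℝ} (h : G.IsTestFunction L φ ψ) (x : G.Point L) :
    G.laplacePairing L (G.greenExt L j x) ψ = φ x - φ (Point.vertex o) := by
  have h1 : Continuous (G.groundedKernel L x) :=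
    continuous_groundedKernel hL continuous_const continuous_id
  have h0 : Continuous (G.lin L (fun v => G.lin L (fun u => j u v) x)) :=
    (lin_isTest hL _).continuous hL
  have := laplacePairing_add h0 h1 (fun e => (h e).1)
  rw [laplacePairing_groundedKernel hL h, laplacePairing_lin hL _ h] at this
  refine this.trans ?_
  have h2 : ∑ e, (G.lin L (fun u => j u (G.tgt e)) x - G.lin L (fun u => j u (G.src e)) x) *
      (φ (Point.vertex (G.tgt e)) - φ (Point.vertex (G.src e))) / L e =
      G.lin L (fun v => φ (Point.vertex v)) x - φ (Point.vertex o) := by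
    simp only [div_eq_mul_inv, ← lin_sub, ← lin_mul_const, ← lin_sum]
    have h3 := fun u => hj.green u (fun v => φ (Point.vertex v))
    simp only [div_eq_mul_inv] at h3
    rw [funext h3, lin_sub, lin_const]
  rw [h2]; ring

end Green

end MultiGraph

namespace MultiGraph

variable {V E : Type*} {G : MultiGraph V E} {L : E → ℝ}

/-! ### Integrals against signed measures on a metrized graph -/

section SignedMeasures

theorem isFiniteMeasure_variation {X : Type*} [MeasurableSpace X] (μ : SignedMeasure X) :
    IsFiniteMeasure μ.variation := by
  rw [← SignedMeasure.totalVariation_eq_variation]; infer_instance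

/-- The image of the Lebesgue measure of the edge `e`. -/
noncomputable def edgeMeasure (G : MultiGraph V E) (L : E → ℝ) (e : E) : Measure (G.Point L) :=
  (volume.restrict (Set.Ioc 0 (L e))).map (G.pt L e)

instance (e : E) : IsFiniteMeasure (G.edgeMeasure L e) := by
  unfold edgeMeasure; infer_instance

theorem integral_edgeMeasure (hL : ∀ e, 0 < L e) (e : E) {f : G.Point L → ℝ} (hf : Continuous f) :
    ∫ x, f x ∂(G.edgeMeasure L e) = ∫ t in (0 : ℝ)..(L e), f (G.pt L e t) := by
  rw [edgeMeasure, integral_map (continuous_pt e).measurable.aemeasurable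
    hf.aestronglyMeasurable, intervalIntegral.integral_of_le (hL e).le]

theorem integral_dirac_point {f : G.Point L → ℝ} (hf : Continuous f) (x : G.Point L) (c : ℝ) :
    ∫ᵛ y, f y ∂<•(VectorMeasure.dirac x c : SignedMeasure (G.Point L)) = f x * c := by
  rw [VectorMeasure.integral_dirac' hf.stronglyMeasurable]
  simp [mul_comm]

theorem integral_signed_univ (μ : SignedMeasure (G.Point L)) (c : ℝ) :
    ∫ᵛ _, c ∂<•μ = c * μ Set.univ := by
  have := isFiniteMeasure_variation μ
  rw [VectorMeasure.integral_const]
  simp [mul_comm]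

variable [Fintype V] [Fintype E]

theorem integrable_of_continuous (μ : SignedMeasure (G.Point L)) {f : G.Point L → ℝ}
    (hf : Continuous f) : VectorMeasure.Integrable μ f := by
  have := isFiniteMeasure_variation μ
  exact hf.integrable_of_hasCompactSupport (HasCompactSupport.of_compactSpace f)

/-- The signed measure `Δ φ`, where `φ` is given along the edges by the functions `ψ e`, whose
second derivative is supposed to have the constant value `k e`. -/
noncomputable def laplaceMeasure (G : MultiGraph V E) (L : E → ℝ) (ψ : E → ℝ → ℝ) (k : E → ℝ) :
    SignedMeasure (G.Point L) :=
  ∑ e, (-k e • (G.edgeMeasure L e).toSignedMeasure +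
    (VectorMeasure.dirac (Point.vertex (G.src e)) (-deriv (ψ e) 0) +
      VectorMeasure.dirac (Point.vertex (G.tgt e)) (deriv (ψ e) (L e))))

theorem integral_signed_add (μ ν : SignedMeasure (G.Point L)) {f : G.Point L → ℝ}
    (hf : Continuous f) : ∫ᵛ y, f y ∂<•(μ + ν) = ∫ᵛ y, f y ∂<•μ + ∫ᵛ y, f y ∂<•ν :=
  VectorMeasure.integral_add_vectorMeasure (integrable_of_continuous μ hf)
    (integrable_of_continuous ν hf)

theorem integral_laplaceMeasure (hL : ∀ e, 0 < L e) {f : G.Point L → ℝ} (hf : Continuous f)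
    {ψ : E → ℝ → ℝ} {k : E → ℝ} (hk : ∀ e t, deriv (deriv (ψ e)) t = k e) :
    ∫ᵛ y, f y ∂<•(G.laplaceMeasure L ψ k) = G.laplacePairing L f ψ := by
  rw [laplaceMeasure, VectorMeasure.integral_finsetSum_vectorMeasure
    (fun e _ => integrable_of_continuous _ hf), laplacePairing]
  refine Finset.sum_congr rfl fun e _ => ?_
  rw [integral_signed_add _ _ hf, integral_signed_add _ _ hf, integral_dirac_point hf,
    integral_dirac_point hf, VectorMeasure.integral_smul_vectorMeasure,
    VectorMeasure.integral_toSignedMeasure, integral_edgeMeasure hL e hf]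
  simp only [hk, intervalIntegral.integral_mul_const, smul_eq_mul]
  ring

end SignedMeasures

/-! ### The diagonal of the Green function -/

section Diagonal

/-- The resistance between the ends of `e` minus the length of `e`. -/
noncomputable def defect (G : MultiGraph V E) (L : E → ℝ) (j : V → V → ℝ) (e : E) : ℝ :=
  j (G.tgt e) (G.tgt e) - 2 * j (G.src e) (G.tgt e) + j (G.src e) (G.src e) - L e

/-- The restriction to the edge `e` of the diagonal of the Green function. -/
noncomputable def diagAlong (G : MultiGraph V E) (L : E → ℝ) (j : V → V → ℝ) (e : E) (t : ℝ) : ℝ :=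
  j (G.src e) (G.src e) + (j (G.tgt e) (G.tgt e) - j (G.src e) (G.src e) - G.defect L j e) / L e * t
    + G.defect L j e / L e ^ 2 * t ^ 2

theorem deriv_diagAlong (j : V → V → ℝ) (e : E) : deriv (G.diagAlong L j e) = fun t =>
    (j (G.tgt e) (G.tgt e) - j (G.src e) (G.src e) - G.defect L j e) / L e
      + G.defect L j e / L e ^ 2 * (2 * t) := by
  funext t
  have h1 : HasDerivAt (fun t : ℝ => t ^ 2) (2 * t) t := by simpa using hasDerivAt_pow 2 t
  have := (((hasDerivAt_id t).const_mul ((j (G.tgt e) (G.tgt e) - j (G.src e) (G.src e) -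
    G.defect L j e) / L e)).const_add (j (G.src e) (G.src e))).add
    (h1.const_mul (G.defect L j e / L e ^ 2))
  rw [mul_one] at this
  exact this.deriv

theorem deriv_deriv_diagAlong (j : V → V → ℝ) (e : E) (t : ℝ) :
    deriv (deriv (G.diagAlong L j e)) t = G.defect L j e / L e ^ 2 * 2 := by
  rw [deriv_diagAlong]
  have := (((hasDerivAt_id t).const_mul (2 : ℝ)).const_mul (G.defect L j e / L e ^ 2)).const_add
    ((j (G.tgt e) (G.tgt e) - j (G.src e) (G.src e) - G.defect L j e) / L e)
  rw [mul_one] at this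
  exact this.deriv

variable [Fintype E]

/-- On the diagonal of an edge both the bilinear part and t(L - t)/L are quadratic in t, so the
diagonal may itself serve as a test function. -/
theorem IsGreen.diag_isTest {o : V} {j : V → V → ℝ} (hj : G.IsGreen L o j) (hL : ∀ e, 0 < L e) :
    G.IsTestFunction L (fun x => G.greenExt L j x x) (G.diagAlong L j) := by
  refine fun e => ⟨by unfold diagAlong; fun_prop, fun t ht => ?_⟩
  have hl := hL e
  beta_reduce
  rw [greenExt, groundedKernel_pt, edgeKernel_pt hL e ht ht le_rfl, lin_pt hL _ e ht,
    lin_pt hL _ e ht, lin_pt hL _ e ht, hj.symm (G.tgt e) (G.src e), diagAlong, defect]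
  field_simp
  ring

/-- The Dirichlet energy of the diagonal of the Green function. -/
noncomputable def diagEnergy (G : MultiGraph V E) (L : E → ℝ) (j : V → V → ℝ) : ℝ :=
  ∑ e, ((j (G.tgt e) (G.tgt e) - j (G.src e) (G.src e)) ^ 2 + G.defect L j e ^ 2 / 3) / L e

theorem IsGreen.laplacePairing_diag {o : V} {j : V → V → ℝ} (hj : G.IsGreen L o j)
    (hL : ∀ e, 0 < L e) :
    G.laplacePairing L (fun x => G.greenExt L j x x) (G.diagAlong L j) = G.diagEnergy L j := by
  refine Finset.sum_congr rfl fun e _ => ?_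
  have hl := hL e
  have : ∫ t in (0 : ℝ)..(L e), G.greenExt L j (G.pt L e t) (G.pt L e t) *
      deriv (deriv (G.diagAlong L j e)) t =
      (j (G.src e) (G.src e) * L e + (j (G.tgt e) (G.tgt e) - j (G.src e) (G.src e) -
        G.defect L j e) / L e * (L e ^ 2 / 2) + G.defect L j e / L e ^ 2 * (L e ^ 3 / 3)) *
        (G.defect L j e / L e ^ 2 * 2) := by
    have : ∫ t in (0 : ℝ)..(L e), G.greenExt L j (G.pt L e t) (G.pt L e t) *
        deriv (deriv (G.diagAlong L j e)) t = ∫ t in (0 : ℝ)..(L e), G.diagAlong L j e t *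
        (G.defect L j e / L e ^ 2 * 2) := by
      refine intervalIntegral.integral_congr fun t ht => ?_
      rw [Set.uIcc_of_le hl.le] at ht
      simp only [deriv_deriv_diagAlong]
      exact congrArg (· * _) ((hj.diag_isTest hL e).2 t ht)
    rw [this, intervalIntegral.integral_mul_const]
    congr 1
    unfold diagAlong
    rw [intervalIntegral.integral_add (Continuous.intervalIntegrable (by fun_prop) _ _)
      (Continuous.intervalIntegrable (by fun_prop) _ _),
      intervalIntegral.integral_add (Continuous.intervalIntegrable (by fun_prop) _ _)
      (Continuous.intervalIntegrable (by fun_prop) _ _), intervalIntegral.integral_const,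
      intervalIntegral.integral_const_mul, intervalIntegral.integral_const_mul, integral_id,
      integral_pow]
    simp
    norm_num
    ring
  beta_reduce
  rw [this, deriv_diagAlong, greenExt_vertex, greenExt_vertex]
  field_simp
  ring

end Diagonal

end MultiGraph

namespace MultiGraph

variable {V E : Type*} {G : MultiGraph V E} {L : E → ℝ}

/-! ### Existence of the admissible pair -/

theorem integral_deriv_deriv_comm {ψ₁ ψ₂ : ℝ → ℝ} (h₁ : ContDiff ℝ 2 ψ₁) (h₂ : ContDiff ℝ 2 ψ₂)
    (l : ℝ) : (∫ t in (0 : ℝ)..l, ψ₁ t * deriv (deriv ψ₂) t) -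
      ∫ t in (0 : ℝ)..l, ψ₂ t * deriv (deriv ψ₁) t =
      (ψ₁ l * deriv ψ₂ l - ψ₂ l * deriv ψ₁ l) - (ψ₁ 0 * deriv ψ₂ 0 - ψ₂ 0 * deriv ψ₁ 0) := by
  have c1 := h₁.continuous_deriv_deriv
  have c2 := h₂.continuous_deriv_deriv
  refine (intervalIntegral.integral_sub ((h₁.continuous.mul c2).intervalIntegrable _ _)
    ((h₂.continuous.mul c1).intervalIntegrable _ _)).symm.trans ?_
  refine intervalIntegral.integral_eq_sub_of_hasDerivAt
    (f := fun t => ψ₁ t * deriv ψ₂ t - ψ₂ t * deriv ψ₁ t) (fun t _ => ?_)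
    (((h₁.continuous.mul c2).sub (h₂.continuous.mul c1)).intervalIntegrable _ _)
  obtain ⟨a1, b1⟩ := h₁.hasDerivAt_two t
  obtain ⟨a2, b2⟩ := h₂.hasDerivAt_two t
  exact ((a1.mul b2).sub (a2.mul b1)).congr_deriv (by simp only [Pi.mul_apply]; ring)

theorem IsTestFunction.integral_eq (hL : ∀ e, 0 < L e) {φ : G.Point L → ℝ} {ψ : E → ℝ → ℝ}
    (h : G.IsTestFunction L φ ψ) (e : E) (f : ℝ → ℝ) :
    ∫ t in (0 : ℝ)..(L e), φ (G.pt L e t) * f t = ∫ t in (0 : ℝ)..(L e), ψ e t * f t := by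
  refine intervalIntegral.integral_congr fun t ht => ?_
  rw [Set.uIcc_of_le (hL e).le] at ht
  exact congrArg (· * f t) ((h e).2 t ht)

/-- Green's identity: the boundary terms of the double integration by parts are exactly the outgoing
slopes. -/
theorem laplacePairing_comm [Fintype E] (hL : ∀ e, 0 < L e) {φ₁ φ₂ : G.Point L → ℝ}
    {ψ₁ ψ₂ : E → ℝ → ℝ} (h₁ : G.IsTestFunction L φ₁ ψ₁) (h₂ : G.IsTestFunction L φ₂ ψ₂) :
    G.laplacePairing L φ₁ ψ₂ = G.laplacePairing L φ₂ ψ₁ := by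
  refine Finset.sum_congr rfl fun e _ => ?_
  rw [h₁.integral_eq hL, h₂.integral_eq hL, ← h₁.src hL, ← h₁.tgt hL, ← h₂.src hL, ← h₂.tgt hL]
  have := integral_deriv_deriv_comm (h₁ e).1 (h₂ e).1 (L e)
  linarith

section Existence

variable [Fintype V]

/-- The potential of the divisor `D`. -/
noncomputable def divPotential (G : MultiGraph V E) (L : E → ℝ) (j : V → V → ℝ) (D : V → ℝ)
    (y : G.Point L) : ℝ :=
  ∑ v, D v * G.lin L (j v) y

theorem continuous_divPotential {j : V → V → ℝ} (hL : ∀ e, 0 < L e) (D : V → ℝ) :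
    Continuous (G.divPotential L j D) :=
  continuous_finsetSum _ fun v _ => ((lin_isTest hL (j v)).continuous hL).const_mul (D v)

variable [Fintype E] {o : V} {j : V → V → ℝ}

/-- The function which corrects the Green function grounded at a vertex to the admissible one. -/
noncomputable def correction (G : MultiGraph V E) (L : E → ℝ) (j : V → V → ℝ) (D : V → ℝ)
    (y : G.Point L) : ℝ :=
  (divDeg D + 2)⁻¹ * (G.greenExt L j y y + G.divPotential L j D y)

/-- The admissible measure. -/
noncomputable def admMeasure (G : MultiGraph V E) (L : E → ℝ) (o : V) (j : V → V → ℝ)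
    (D : V → ℝ) : SignedMeasure (G.Point L) :=
  VectorMeasure.dirac (Point.vertex o) 1 + (divDeg D + 2)⁻¹ •
    (∑ v, VectorMeasure.dirac (Point.vertex v) (D v) +
      (VectorMeasure.dirac (Point.vertex o) (-divDeg D) +
        G.laplaceMeasure L (G.diagAlong L j) fun e => G.defect L j e / L e ^ 2 * 2))

theorem integral_admMeasure (hL : ∀ e, 0 < L e) (D : V → ℝ) {f : G.Point L → ℝ}
    (hf : Continuous f) : ∫ᵛ y, f y ∂<•(G.admMeasure L o j D) =
      f (Point.vertex o) + (divDeg D + 2)⁻¹ * (∑ v, D v * f (Point.vertex v) -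
        divDeg D * f (Point.vertex o) + G.laplacePairing L f (G.diagAlong L j)) := by
  rw [admMeasure, integral_signed_add _ _ hf, VectorMeasure.integral_smul_vectorMeasure,
    integral_signed_add _ _ hf, integral_signed_add _ _ hf,
    VectorMeasure.integral_finsetSum_vectorMeasure (fun v _ => integrable_of_continuous _ hf),
    integral_laplaceMeasure hL hf (fun e t => deriv_deriv_diagAlong j e t)]
  simp only [integral_dirac_point hf, smul_eq_mul]
  simp only [mul_comm (f _) (D _)]
  ring

theorem continuous_diag (hL : ∀ e, 0 < L e) :
    Continuous fun x : G.Point L => G.greenExt L j x x :=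
  continuous_greenExt hL j continuous_id continuous_id

theorem continuous_correction (hL : ∀ e, 0 < L e) (D : V → ℝ) :
    Continuous (G.correction L j D) :=
  ((continuous_diag hL).add (continuous_divPotential hL D)).const_mul _

/-- Comparison with `integral_admMeasure` shows that the Laplacian of the correction is the
admissible measure minus δ_o; this dictates the definition of `admMeasure`. -/
theorem IsGreen.laplacePairing_correction (hj : G.IsGreen L o j) (hL : ∀ e, 0 < L e) (D : V → ℝ)
    {φ : G.Point L → ℝ} {ψ : E → ℝ → ℝ} (h : G.IsTestFunction L φ ψ) :
    G.laplacePairing L (G.correction L j D) ψ =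
      (divDeg D + 2)⁻¹ * (∑ v, D v * φ (Point.vertex v) -
        divDeg D * φ (Point.vertex o) + G.laplacePairing L φ (G.diagAlong L j)) := by
  have e1 : G.laplacePairing L (G.divPotential L j D) ψ =
      ∑ v, D v * (φ (Point.vertex v) - φ (Point.vertex o)) := by
    refine (laplacePairing_sum _ (fun v => ((lin_isTest hL (j v)).continuous hL).const_mul (D v))
      fun e => (h e).1).trans (Finset.sum_congr rfl fun v _ => ?_)
    rw [laplacePairing_const_mul, ← hj.laplacePairing_ext hL h, funext (greenExt_vertex_left j v)]
  have e2 := laplacePairing_add (continuous_diag (G := G) (j := j) hL)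
    (continuous_divPotential (G := G) (j := j) hL D) (fun e => (h e).1)
  refine (laplacePairing_const_mul _ _ ψ).trans ?_
  rw [e2, e1, laplacePairing_comm hL (hj.diag_isTest hL) h]
  simp only [mul_sub, Finset.sum_sub_distrib, ← Finset.sum_mul, divDeg]
  ring

/-- The sum of the diagonal values of the Green function, weighted by `D`. -/
noncomputable def diagSum (j : V → V → ℝ) (D : V → ℝ) : ℝ := ∑ v, D v * j v v

/-- The sum of the values of the Green function, weighted by `D` in both variables. -/
noncomputable def pairSum (j : V → V → ℝ) (D : V → ℝ) : ℝ := ∑ u, ∑ v, D u * D v * j u v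

/-- The additive constant of the admissible Green function. -/
noncomputable def admShift (G : MultiGraph V E) (L : E → ℝ) (j : V → V → ℝ) (D : V → ℝ) : ℝ :=
  (2 * diagSum j D + pairSum j D + G.diagEnergy L j) / (divDeg D + 2) ^ 2

/-- The admissible Green function. -/
noncomputable def admGreen (G : MultiGraph V E) (L : E → ℝ) (j : V → V → ℝ) (D : V → ℝ)
    (x y : G.Point L) : ℝ :=
  G.greenExt L j x y - G.correction L j D x - G.correction L j D y + G.admShift L j D

theorem correction_vertex (D : V → ℝ) (v : V) : G.correction L j D (Point.vertex v) =
    (divDeg D + 2)⁻¹ * (j v v + ∑ u, D u * j u v) := by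
  simp [correction, divPotential, greenExt_vertex]

theorem sum_mul_correction (D : V → ℝ) : ∑ v, D v * G.correction L j D (Point.vertex v) =
    (divDeg D + 2)⁻¹ * (diagSum j D + pairSum j D) := by
  have : pairSum j D = ∑ v, ∑ u, D v * (D u * j u v) := by
    rw [pairSum, Finset.sum_comm]
    exact Finset.sum_congr rfl fun v _ => Finset.sum_congr rfl fun u _ => by ring
  simp only [correction_vertex, this, diagSum, ← Finset.sum_add_distrib, Finset.mul_sum]
  refine Finset.sum_congr rfl fun v _ => ?_
  simp only [mul_add, Finset.mul_sum]
  congr 1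
  · ring
  · exact Finset.sum_congr rfl fun u _ => by ring

theorem continuous_admGreen (hL : ∀ e, 0 < L e) (D : V → ℝ) {X : Type*} [TopologicalSpace X]
    {f g : X → G.Point L} (hf : Continuous f) (hg : Continuous g) :
    Continuous fun x => G.admGreen L j D (f x) (g x) :=
  (((continuous_greenExt hL j hf hg).sub ((continuous_correction hL D).comp hf)).sub
    ((continuous_correction hL D).comp hg)).add continuous_const

theorem IsGreen.laplacePairing_admGreen (hj : G.IsGreen L o j) (hL : ∀ e, 0 < L e) (D : V → ℝ)
    {φ : G.Point L → ℝ} {ψ : E → ℝ → ℝ} (h : G.IsTestFunction L φ ψ) (x : G.Point L) :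
    G.laplacePairing L (G.admGreen L j D x) ψ = φ x - ∫ᵛ y, φ y ∂<•(G.admMeasure L o j D) := by
  have hψ := fun e => (h e).1
  have c1 : Continuous (G.greenExt L j x) := continuous_greenExt hL j continuous_const continuous_id
  have c2 := continuous_correction (G := G) (j := j) hL D
  have e : G.admGreen L j D x = fun y => (G.greenExt L j x y - G.correction L j D y) +
      (G.admShift L j D - G.correction L j D x) := by
    funext y; rw [admGreen]; ring
  have c3 : Continuous fun y => G.greenExt L j x y - G.correction L j D y := c1.sub c2
  rw [e, laplacePairing_add c3 continuous_const hψ, laplacePairing_sub c1 c2 hψ,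
    laplacePairing_const _ hL h, hj.laplacePairing_ext hL h, hj.laplacePairing_correction hL D h,
    integral_admMeasure hL D (h.continuous hL)]
  ring

/-- In g(D,y) + g(y,y) the correction occurs d + 2 times, which is exactly what cancels the diagonal
and the potential of D. The shift is then fixed by the normalization. -/
theorem IsGreen.isAdmissible (hj : G.IsGreen L o j) (hL : ∀ e, 0 < L e) (D : V → ℝ)
    (hD : divDeg D + 2 ≠ 0) : G.IsAdmissible L D (G.admMeasure L o j D) (G.admGreen L j D)
      (-((divDeg D + 2)⁻¹ * (diagSum j D + pairSum j D)) +
        (divDeg D + 1) * G.admShift L j D) where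
  total := by
    have := integral_admMeasure (o := o) (j := j) hL D
      (continuous_const (X := G.Point L) (y := (1 : ℝ)))
    rw [integral_signed_univ, laplacePairing_const 1 hL (hj.diag_isTest hL)] at this
    simpa [divDeg] using this
  symm x y := by rw [admGreen, admGreen, hj.ext_symm]; ring
  continuous := continuous_admGreen hL D continuous_fst continuous_snd
  laplacian x φ ψ h := hj.laplacePairing_admGreen hL D h x
  normalized x := by
    have hq := hj.diag_isTest (L := L) hL
    have hm := sum_mul_correction (G := G) (L := L) (j := j) D
    have hx : ∑ v, D v * G.greenExt L j x (Point.vertex v) = G.divPotential L j D x :=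
      Finset.sum_congr rfl fun v _ => by rw [hj.ext_symm, greenExt_vertex_left]
    have ho : G.correction L j D (Point.vertex o) = 0 := by
      simp [correction_vertex, hj.base']
    have hxo : G.greenExt L j x (Point.vertex o) = 0 := by rw [hj.ext_symm, hj.ext_base]
    have hR : ∑ v, D v * G.greenExt L j (Point.vertex v) (Point.vertex v) = diagSum j D := by
      simp [greenExt_vertex, diagSum]
    have hc : Continuous fun y => G.admGreen L j D x y :=
      continuous_admGreen hL D continuous_const continuous_id
    -- Integrating g(x,·) requires its pairing with the diagonal. The diagonal being a test
    -- function, that pairing is given by the Laplace equation for g(x,·).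
    rw [integral_admMeasure hL D hc, hj.laplacePairing_admGreen hL D hq, integral_admMeasure hL D (hq.continuous hL),
      hj.laplacePairing_diag hL, hR, hj.ext_base]
    have hs : ∑ v, D v * G.admGreen L j D x (Point.vertex v) =
        G.divPotential L j D x - divDeg D * G.correction L j D x -
          (divDeg D + 2)⁻¹ * (diagSum j D + pairSum j D) + divDeg D * G.admShift L j D := by
      rw [← hx, ← hm]
      simp only [admGreen, mul_add, mul_sub, Finset.sum_add_distrib, Finset.sum_sub_distrib,
        ← Finset.sum_mul, divDeg]
    rw [hs, admGreen, hxo, ho, correction, admShift]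
    field_simp
    ring
  const y := by
    have hm := sum_mul_correction (G := G) (L := L) (j := j) D
    have hs : ∑ v, D v * G.admGreen L j D (Point.vertex v) y =
        G.divPotential L j D y - (divDeg D + 2)⁻¹ * (diagSum j D + pairSum j D) -
          divDeg D * G.correction L j D y + divDeg D * G.admShift L j D := by
      rw [← hm]
      simp only [admGreen, mul_add, mul_sub, Finset.sum_add_distrib, Finset.sum_sub_distrib,
        ← Finset.sum_mul, divDeg, divPotential, greenExt_vertex_left]
    rw [hs, admGreen, correction]
    field_simp
    ring

theorem admGreen_value (D : V → ℝ) (hD : divDeg D + 2 ≠ 0) :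
    2 * divDeg D * (-((divDeg D + 2)⁻¹ * (diagSum j D + pairSum j D)) +
        (divDeg D + 1) * G.admShift L j D) -
      ∑ u, ∑ v, D u * D v * G.admGreen L j D (Point.vertex u) (Point.vertex v) =
    (2 * divDeg D * diagSum j D - 2 * pairSum j D + divDeg D * G.diagEnergy L j) /
      (divDeg D + 2) := by
  have hm := sum_mul_correction (G := G) (L := L) (j := j) D
  have hs : ∑ u, ∑ v, D u * D v * G.admGreen L j D (Point.vertex u) (Point.vertex v) =
      pairSum j D - 2 * divDeg D * ((divDeg D + 2)⁻¹ * (diagSum j D + pairSum j D)) +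
        divDeg D ^ 2 * G.admShift L j D := by
    rw [← hm]
    have e1 : ∑ u, ∑ v, D u * D v * G.correction L j D (Point.vertex u) =
        divDeg D * ∑ v, D v * G.correction L j D (Point.vertex v) := by
      rw [Finset.sum_comm, divDeg, Finset.sum_mul]
      simp only [Finset.mul_sum]
      exact Finset.sum_congr rfl fun v _ => Finset.sum_congr rfl fun u _ => by ring
    have e2 : ∑ u, ∑ v, D u * D v * G.correction L j D (Point.vertex v) =
        divDeg D * ∑ v, D v * G.correction L j D (Point.vertex v) := by
      rw [divDeg, Finset.sum_mul]
      simp only [Finset.mul_sum]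
      exact Finset.sum_congr rfl fun v _ => Finset.sum_congr rfl fun u _ => by ring
    have e3 : ∑ u, ∑ v, D u * D v * G.admShift L j D = divDeg D ^ 2 * G.admShift L j D := by
      simp only [← Finset.sum_mul, ← Finset.mul_sum, divDeg]
      ring
    simp only [admGreen, mul_add, mul_sub, Finset.sum_add_distrib, Finset.sum_sub_distrib,
      greenExt_vertex, e1, e2, e3, pairSum]
    ring
  rw [hs, admShift]
  field_simp
  ring

end Existence

end MultiGraph

namespace MultiGraph

variable {V E : Type*} {G : MultiGraph V E} {L : E → ℝ}

/-! ### Uniqueness of the admissible pair -/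

section Uniqueness

/-- The function on the metrized graph which is given along the edges by `ψ` and at the vertices by
`u`. -/
noncomputable def glue (G : MultiGraph V E) (L : E → ℝ) (u : V → ℝ) (ψ : E → ℝ → ℝ) :
    G.Point L → ℝ
  | .vertex v => u v
  | .interior e t _ _ => ψ e t

theorem glue_isTest (hL : ∀ e, 0 < L e) {u : V → ℝ} {ψ : E → ℝ → ℝ}
    (hψ : ∀ e, ContDiff ℝ 2 (ψ e)) (h0 : ∀ e, ψ e 0 = u (G.src e))
    (h1 : ∀ e, ψ e (L e) = u (G.tgt e)) : G.IsTestFunction L (G.glue L u ψ) ψ := by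
  refine fun e => ⟨hψ e, fun t ht => ?_⟩
  rcases ht.1.eq_or_lt with rfl | h
  · rw [pt_zero, h0]; rfl
  rcases ht.2.eq_or_lt with rfl | h'
  · rw [pt_length hL, h1]; rfl
  · rw [pt_interior e h h']; rfl

theorem exists_second_primitive {ρ : ℝ → ℝ} (hρ : Continuous ρ) :
    ∃ θ : ℝ → ℝ, ContDiff ℝ 2 θ ∧ θ 0 = 0 ∧ deriv θ 0 = 0 ∧ deriv (deriv θ) = ρ := by
  have hd : ∀ {f : ℝ → ℝ}, Continuous f → ∀ t, HasDerivAt (fun s => ∫ x in (0 : ℝ)..s, f x) (f t) t :=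
    fun hf t => intervalIntegral.integral_hasDerivAt_right (hf.intervalIntegrable _ _)
      hf.stronglyMeasurable.stronglyMeasurableAtFilter hf.continuousAt
  set η : ℝ → ℝ := fun s => ∫ x in (0 : ℝ)..s, ρ x with hη
  have h1 : deriv η = ρ := funext fun t => (hd hρ t).deriv
  have hηc : ContDiff ℝ 1 η :=
    contDiff_one_iff_deriv.2 ⟨fun t => (hd hρ t).differentiableAt, by rwa [h1]⟩
  set θ : ℝ → ℝ := fun s => ∫ x in (0 : ℝ)..s, η x with hθ
  have h2 : deriv θ = η := funext fun t => (hd hηc.continuous t).deriv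
  refine ⟨θ, ?_, by simp [hθ], by simp [h2, hη], by rw [h2, h1]⟩
  rw [← one_add_one_eq_two]
  exact contDiff_succ_iff_deriv.2
    ⟨fun t => (hd hηc.continuous t).differentiableAt, by simp, by rwa [h2]⟩

variable [Fintype E] {o : V} {j : V → V → ℝ}

/-- The energy identity behind Weyl's lemma: a continuous function which vanishes at `o` and is
weakly harmonic has vanishing `L²` norm. -/
theorem IsGreen.integral_sq_eq_zero (hj : G.IsGreen L o j) (hL : ∀ e, 0 < L e)
    {f : G.Point L → ℝ} (hf : Continuous f) (ho : f (Point.vertex o) = 0)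
    (h : ∀ φ ψ, G.IsTestFunction L φ ψ → G.laplacePairing L f ψ = 0) :
    ∑ e, ∫ t in (0 : ℝ)..(L e), f (G.pt L e t) ^ 2 = 0 := by
  choose θ hθ hθ0 hθ0' hθ2 using fun e => exists_second_primitive (continuous_iff_pt.1 hf e)
  -- The test function is to have second derivative `f` on every edge, so that the pairing yields
  -- minus the square norm of `f`. The vertex values `u` superpose Green functions whose charges
  -- cancel all remaining terms; the poles at `o` do no harm because `f` vanishes there.
  set u : V → ℝ := fun v => -∑ e, ((deriv (θ e) (L e) - θ e (L e) / L e) * j (G.tgt e) v +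
    θ e (L e) / L e * j (G.src e) v) with hu
  set ψ : E → ℝ → ℝ := fun e t => θ e t + u (G.src e) +
    (u (G.tgt e) - u (G.src e) - θ e (L e)) / L e * t with hψ
  have hψc : ∀ e, ContDiff ℝ 2 (ψ e) := fun e => by
    have := hθ e
    simp only [hψ]
    fun_prop
  have hd1 : ∀ e t, deriv (ψ e) t =
      deriv (θ e) t + (u (G.tgt e) - u (G.src e) - θ e (L e)) / L e := fun e t => by
    have := (((hθ e).hasDerivAt_two t).1.add_const (u (G.src e))).add
      ((hasDerivAt_id t).const_mul ((u (G.tgt e) - u (G.src e) - θ e (L e)) / L e))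
    rw [mul_one] at this
    exact this.deriv
  have hd2 : ∀ e t, deriv (deriv (ψ e)) t = f (G.pt L e t) := fun e t => by
    rw [funext (hd1 e)]
    have := ((hθ e).hasDerivAt_two t).2.add_const
      ((u (G.tgt e) - u (G.src e) - θ e (L e)) / L e)
    rw [this.deriv, hθ2]
  have htest : G.IsTestFunction L (G.glue L u ψ) ψ := by
    refine glue_isTest hL hψc (fun e => by simp [hψ, hθ0]) fun e => ?_
    have := (hL e).ne'
    simp only [hψ]
    field_simp
    ring
  have key := h _ _ htest
  set F : V → ℝ := fun v => f (Point.vertex v) with hF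
  have hgreen : ∑ e, (u (G.tgt e) - u (G.src e)) * (F (G.tgt e) - F (G.src e)) / L e =
      -∑ e, ((deriv (θ e) (L e) - θ e (L e) / L e) * F (G.tgt e) +
        θ e (L e) / L e * F (G.src e)) := by
    have e1 : ∀ e, (u (G.tgt e) - u (G.src e)) * (F (G.tgt e) - F (G.src e)) / L e =
        -∑ e', ((deriv (θ e') (L e') - θ e' (L e') / L e') *
            ((j (G.tgt e') (G.tgt e) - j (G.tgt e') (G.src e)) * (F (G.tgt e) - F (G.src e)) / L e)
          + θ e' (L e') / L e' *
            ((j (G.src e') (G.tgt e) - j (G.src e') (G.src e)) * (F (G.tgt e) - F (G.src e)) / L e))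
        := by
      intro e
      simp only [hu]
      rw [neg_sub_neg, ← Finset.sum_sub_distrib, mul_div_assoc, Finset.sum_mul,
        ← Finset.sum_neg_distrib]
      exact Finset.sum_congr rfl fun e' _ => by ring
    simp only [e1]
    rw [Finset.sum_neg_distrib, Finset.sum_comm]
    congr 1
    refine Finset.sum_congr rfl fun e' _ => ?_
    rw [Finset.sum_add_distrib, ← Finset.mul_sum, ← Finset.mul_sum, hj.green, hj.green]
    simp [hF, ho]
  refine neg_eq_zero.1 (Eq.trans ?_ key)
  rw [laplacePairing, ← Finset.sum_neg_distrib, ← sub_eq_zero, ← Finset.sum_sub_distrib]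
  have e2 : ∀ e, -(∫ t in (0 : ℝ)..(L e), f (G.pt L e t) ^ 2) -
      (-(∫ t in (0 : ℝ)..(L e), f (G.pt L e t) * deriv (deriv (ψ e)) t) -
        f (Point.vertex (G.src e)) * deriv (ψ e) 0 +
        f (Point.vertex (G.tgt e)) * deriv (ψ e) (L e)) =
      -((u (G.tgt e) - u (G.src e)) * (F (G.tgt e) - F (G.src e)) / L e +
      ((deriv (θ e) (L e) - θ e (L e) / L e) * F (G.tgt e) + θ e (L e) / L e * F (G.src e))) := by
    intro e
    simp only [hd2, hd1, hθ0', ← pow_two, hF]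
    ring
  rw [Finset.sum_congr rfl fun e _ => e2 e, Finset.sum_neg_distrib, Finset.sum_add_distrib, hgreen]
  ring

/-- Weyl's lemma: weakly harmonic functions are constant. -/
theorem IsGreen.eq_of_harmonic (hj : G.IsGreen L o j) (hL : ∀ e, 0 < L e)
    {f : G.Point L → ℝ} (hf : Continuous f)
    (h : ∀ φ ψ, G.IsTestFunction L φ ψ → G.laplacePairing L f ψ = 0) (x : G.Point L) :
    f x = f (Point.vertex o) := by
  set F : G.Point L → ℝ := fun x => f x - f (Point.vertex o) with hF
  have hFc : Continuous F := hf.sub continuous_const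
  have hz := hj.integral_sq_eq_zero hL hFc (by simp [hF]) fun φ ψ ht => by
    rw [laplacePairing_sub hf continuous_const fun e => (ht e).1, h φ ψ ht,
      laplacePairing_const _ hL ht, sub_zero]
  have hnn : ∀ e ∈ Finset.univ, 0 ≤ ∫ t in (0 : ℝ)..(L e), F (G.pt L e t) ^ 2 := fun e _ =>
    intervalIntegral.integral_nonneg (hL e).le fun t _ => sq_nonneg _
  have hedge : ∀ e, ∀ t ∈ Set.Icc 0 (L e), F (G.pt L e t) = 0 := by
    intro e t ht
    have h0 := (Finset.sum_eq_zero_iff_of_nonneg hnn).1 hz e (Finset.mem_univ e)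
    by_contra hne
    have hc : ContinuousOn (fun t => F (G.pt L e t) ^ 2) (Set.Icc 0 (L e)) :=
      ((continuous_iff_pt.1 hFc e).pow 2).continuousOn
    exact (intervalIntegral.integral_pos (hL e) hc (fun t _ => sq_nonneg _)
      ⟨t, ht, by positivity⟩).ne' h0
  rw [← sub_eq_zero]
  change F x = 0
  induction x using point_cases with
  | he e t h₀ h₁ => exact hedge e t ⟨h₀.le, h₁.le⟩
  | hv v =>
    have h1 := hj.green v fun v => F (Point.vertex v)
    have hs : ∀ e, F (Point.vertex (G.src e)) = 0 := fun e => by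
      rw [← pt_zero]; exact hedge e 0 ⟨le_rfl, (hL e).le⟩
    have ht : ∀ e, F (Point.vertex (G.tgt e)) = 0 := fun e => by
      rw [← pt_length hL]; exact hedge e _ ⟨(hL e).le, le_rfl⟩
    have ho : F (Point.vertex o) = 0 := by simp [hF]
    simp only [hs, ht, ho, sub_self, mul_zero, zero_div, Finset.sum_const_zero, sub_zero] at h1
    exact h1.symm

variable [Fintype V]

theorem IsGreen.admGreen_isTest (hj : G.IsGreen L o j) (hL : ∀ e, 0 < L e) (D : V → ℝ) :
    G.IsTestFunction L (G.admGreen L j D (Point.vertex o)) (fun e t => G.admShift L j D -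
      (divDeg D + 2)⁻¹ * (G.diagAlong L j e t + ∑ v, D v * (j v (G.src e) + t / L e *
        (j v (G.tgt e) - j v (G.src e))))) := by
  refine fun e => ⟨?_, fun t ht => ?_⟩
  · have := (hj.diag_isTest hL e).1
    fun_prop
  · have ho : G.correction L j D (Point.vertex o) = 0 := by simp [correction_vertex, hj.base']
    rw [admGreen, hj.ext_base, ho, correction, divPotential,
      show G.greenExt L j (G.pt L e t) (G.pt L e t) = _ from (hj.diag_isTest hL e).2 t ht]
    simp only [lin_pt hL _ e ht]
    ring

/-- The unknown measure drops out of differences of rows, so by Weyl's lemma g - g₀ has the form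
h(x) + h(y) + constant. The diagonal condition gives (d+2)h constant, and the normalization removes
the remaining constant. -/
theorem IsGreen.isAdmissible_unique (hj : G.IsGreen L o j) (hL : ∀ e, 0 < L e) {D : V → ℝ}
    (hD : divDeg D + 2 ≠ 0) {μ : SignedMeasure (G.Point L)} {g : G.Point L → G.Point L → ℝ}
    {c : ℝ} (h : G.IsAdmissible L D μ g c) :
    g = G.admGreen L j D ∧ c = -((divDeg D + 2)⁻¹ * (diagSum j D + pairSum j D)) +
        (divDeg D + 1) * G.admShift L j D := by
  have h₀ := hj.isAdmissible hL D hD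
  set g₀ := G.admGreen L j D with hg₀
  set p : G.Point L := Point.vertex o with hp
  have hgc : ∀ x, Continuous (g x) := fun x =>
    h.continuous.comp (continuous_const.prodMk continuous_id : Continuous fun y => (x, y))
  have hgc₀ : ∀ x, Continuous (g₀ x) := fun x =>
    continuous_admGreen hL D continuous_const continuous_id
  have h1 : ∀ x y, (g x y - g₀ x y) - (g p y - g₀ p y) =
      (g x p - g₀ x p) - (g p p - g₀ p p) := by
    intro x
    refine hj.eq_of_harmonic hL (((hgc x).sub (hgc₀ x)).sub ((hgc p).sub (hgc₀ p)))
      fun φ ψ ht => ?_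
    have hψ := fun e => (ht e).1
    rw [laplacePairing_sub (f₁ := fun y => g x y - g₀ x y)
      (f₂ := fun y => g p y - g₀ p y) ((hgc x).sub (hgc₀ x))
      ((hgc p).sub (hgc₀ p)) hψ, laplacePairing_sub (hgc x) (hgc₀ x) hψ,
      laplacePairing_sub (hgc p) (hgc₀ p) hψ, h.laplacian _ φ ψ ht, h.laplacian _ φ ψ ht,
      h₀.laplacian _ φ ψ ht, h₀.laplacian _ φ ψ ht]
    ring
  have h2 : ∀ x y, g x y - g₀ x y =
      (g p x - g₀ p x) + (g p y - g₀ p y) - (g p p - g₀ p p) := fun x y => by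
    have := h1 x y
    rw [h.symm x p, h₀.symm x p] at this
    linarith
  have h3 : ∀ y, g p y - g₀ p y = g p p - g₀ p p := by
    have hs : ∀ y, ∑ v, D v * (g (Point.vertex v) y - g₀ (Point.vertex v) y) =
        ∑ v, D v * (g p (Point.vertex v) - g₀ p (Point.vertex v)) +
          divDeg D * (g p y - g₀ p y) - divDeg D * (g p p - g₀ p p) := fun y => by
      simp only [divDeg, Finset.sum_mul, ← Finset.sum_add_distrib, ← Finset.sum_sub_distrib]
      exact Finset.sum_congr rfl fun v _ => by rw [h2 (Point.vertex v) y]; ring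
    intro y
    have e1 := h.const y
    have e2 := h₀.const y
    have e3 := h.const p
    have e4 := h₀.const p
    have e5 := hs y
    have e6 := hs p
    have e7 := h2 y y
    simp only [mul_sub, Finset.sum_sub_distrib] at e5 e6
    have : (divDeg D + 2) * (g p y - g₀ p y) = (divDeg D + 2) * (g p p - g₀ p p) := by
      linear_combination e1 - e2 - e3 + e4 - e5 + e6 - e7
    exact mul_left_cancel₀ hD this
  have h4 : ∀ x y, g x y = g₀ x y + (g p p - g₀ p p) := fun x y => by
    have := h2 x y; rw [h3 x, h3 y] at this; linarith
  -- The function g₀(p,·) is itself a test function. Since g(p,·) and g₀(p,·) differ by a constant,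
  -- the two Laplace equations give it the same integral against both measures.
  have h5 : ∫ᵛ y, g₀ p y ∂<•μ = 0 := by
    obtain ⟨ψ, ht⟩ : ∃ ψ, G.IsTestFunction L (g₀ p) ψ := ⟨_, hj.admGreen_isTest hL D⟩
    have a1 := h.laplacian p _ _ ht
    have a2 := h₀.laplacian p _ _ ht
    have a3 : G.laplacePairing L (g p) ψ = G.laplacePairing L (g₀ p) ψ := by
      rw [funext (h4 p), laplacePairing_add (hgc₀ p) continuous_const fun e => (ht e).1,
        laplacePairing_const _ hL ht, add_zero]
    rw [a1, a2, h₀.normalized p] at a3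
    linarith
  have h6 : g p p - g₀ p p = 0 := by
    have a1 := h.normalized p
    have := isFiniteMeasure_variation μ
    have a2 : ∫ᵛ y, (g₀ p y + (g p p - g₀ p p)) ∂<•μ =
        ∫ᵛ y, g₀ p y ∂<•μ + ∫ᵛ _, (g p p - g₀ p p) ∂<•μ :=
      VectorMeasure.integral_fun_add (integrable_of_continuous μ (hgc₀ p))
        (integrable_of_continuous μ continuous_const)
    rw [funext (h4 p), a2, h5, integral_signed_univ, h.total] at a1
    linarith
  have h7 : g = g₀ := funext fun x => funext fun y => by rw [h4, h6, add_zero]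
  refine ⟨h7, ?_⟩
  rw [← h.const p, h7, h₀.const p]

/-- The admissible constant in terms of the discrete Green function. -/
theorem IsGreen.admissibleConstant_eq (hj : G.IsGreen L o j) (hL : ∀ e, 0 < L e) (D : V → ℝ)
    (hD : divDeg D + 2 ≠ 0) : G.admissibleConstant L D =
      (2 * divDeg D * diagSum j D - 2 * pairSum j D + divDeg D * G.diagEnergy L j) /
        (divDeg D + 2) := by
  have hex : ∃ ε : ℝ, ∃ μ g c, G.IsAdmissible L D μ g c ∧
      ε = 2 * divDeg D * c - ∑ u, ∑ v, D u * D v * g (Point.vertex u) (Point.vertex v) :=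
    ⟨_, _, _, _, hj.isAdmissible hL D hD, rfl⟩
  obtain ⟨μ, g, c, hadm, hε⟩ := Classical.epsilon_spec hex
  obtain ⟨rfl, rfl⟩ := hj.isAdmissible_unique hL hD hadm
  rw [← admGreen_value D hD]
  exact hε

end Uniqueness

end MultiGraph

namespace MultiGraph

variable {V E : Type*} {G : MultiGraph V E} {L : E → ℝ}

/-! ### Connectedness -/

theorem mem_iff_of_joinSetoid {S : Set E} {X : Set V}
    (hX : ∀ e ∈ S, G.src e ∈ X ↔ G.tgt e ∈ X) {u v : V} (h : G.joinSetoid S u v) :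
    u ∈ X ↔ v ∈ X := by
  have h' : Relation.EqvGen (fun u v => ∃ e ∈ S, G.src e = u ∧ G.tgt e = v) u v := h
  induction h' with
  | rel x y hxy => obtain ⟨e, he, rfl, rfl⟩ := hxy; exact hX e he
  | refl x => rfl
  | symm x y _ ih => exact (ih (by assumption)).symm
  | trans x y z h1 h2 ih1 ih2 => exact (ih1 h1).trans (ih2 h2)

theorem joinSetoid_edge {S : Set E} {e : E} (he : e ∈ S) : G.joinSetoid S (G.src e) (G.tgt e) :=
  Relation.EqvGen.rel _ _ ⟨e, he, rfl, rfl⟩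

theorem joinSetoid_mono {S T : Set E} (h : S ⊆ T) {u v : V} (huv : G.joinSetoid S u v) :
    G.joinSetoid T u v :=
  Relation.EqvGen.mono (r := fun u v => ∃ e ∈ S, G.src e = u ∧ G.tgt e = v)
    (p := fun u v => ∃ e ∈ T, G.src e = u ∧ G.tgt e = v)
    (fun _ _ ⟨e, he, h'⟩ => ⟨e, h he, h'⟩) _ _ huv

theorem Connected.mem (hG : G.Connected) {X : Set V} (hX : ∀ e, G.src e ∈ X ↔ G.tgt e ∈ X)
    {u : V} (hu : u ∈ X) (v : V) : v ∈ X :=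
  (mem_iff_of_joinSetoid (fun e _ => hX e) (hG.2 u v)).1 hu

/-! ### The energy form and the discrete Green function -/

section Energy

variable [Fintype E]

/-- The energy form of the weighted graph. -/
noncomputable def energy (G : MultiGraph V E) (L : E → ℝ) (f h : V → ℝ) : ℝ :=
  ∑ e, (f (G.tgt e) - f (G.src e)) * (h (G.tgt e) - h (G.src e)) / L e

theorem energy_comm (f h : V → ℝ) : G.energy L f h = G.energy L h f :=
  Finset.sum_congr rfl fun e _ => by ring

theorem energy_add_left (f g h : V → ℝ) :
    G.energy L (fun v => f v + g v) h = G.energy L f h + G.energy L g h := by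
  simp only [energy, ← Finset.sum_add_distrib]
  exact Finset.sum_congr rfl fun e _ => by ring

theorem energy_sub_left (f g h : V → ℝ) :
    G.energy L (fun v => f v - g v) h = G.energy L f h - G.energy L g h := by
  simp only [energy, ← Finset.sum_sub_distrib]
  exact Finset.sum_congr rfl fun e _ => by ring

theorem IsGreen.energy_eq {o : V} {j : V → V → ℝ} (hj : G.IsGreen L o j) (u : V) (h : V → ℝ) :
    G.energy L (j u) h = h u - h o := hj.green u h

theorem Connected.eq_of_energy_eq_zero (hG : G.Connected) (hL : ∀ e, 0 < L e) {f : V → ℝ}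
    (h : G.energy L f f = 0) (u v : V) : f u = f v := by
  have h0 : ∀ e, f (G.src e) = f (G.tgt e) := fun e => by
    have hnn : ∀ e ∈ Finset.univ, 0 ≤ (f (G.tgt e) - f (G.src e)) *
        (f (G.tgt e) - f (G.src e)) / L e := fun e _ =>
      div_nonneg (mul_self_nonneg _) (hL e).le
    have := (Finset.sum_eq_zero_iff_of_nonneg hnn).1 h e (Finset.mem_univ e)
    rw [div_eq_zero_iff, mul_self_eq_zero, sub_eq_zero] at this
    exact (this.resolve_right (hL e).ne').symm
  have := hG.mem (X := {w | f w = f v}) (fun e => by simp [h0 e]) (u := v) rfl u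
  exact this

/-- The Laplacian plus the rank-one form a(o)h(o) is positive definite on a connected graph, hence
invertible. Solving for δ_u - δ_o and testing with the constant 1 gives a solution vanishing at `o`.
-/
theorem Connected.exists_isGreen [Fintype V] (hG : G.Connected) (hL : ∀ e, 0 < L e) (o : V) :
    ∃ j, G.IsGreen L o j := by
  classical
  let T : (V → ℝ) →ₗ[ℝ] (V → ℝ) :=
    { toFun := fun a v => G.energy L a (Pi.single v 1) + a o * Pi.single (M := fun _ => ℝ) v 1 o
      map_add' := fun a b => by
        funext v
        have := energy_add_left (G := G) (L := L) a b (Pi.single v 1)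
        simp only [Pi.add_apply]
        rw [show G.energy L (a + b) (Pi.single v 1) = _ from this]
        ring
      map_smul' := fun c a => by
        funext v
        simp only [energy, Pi.smul_apply, smul_eq_mul, RingHom.id_apply, mul_add, Finset.mul_sum]
        congr 1
        · exact Finset.sum_congr rfl fun e _ => by ring
        · ring }
  have hsum : ∀ a h : V → ℝ, ∑ v, h v * T a v = G.energy L a h + a o * h o := fun a h => by
    have hx : ∀ w, ∑ v, h v * Pi.single (M := fun _ => ℝ) v 1 w = h w := fun w => by
      simp [Pi.single_apply]
    simp only [T, LinearMap.coe_mk, AddHom.coe_mk, mul_add, Finset.sum_add_distrib]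
    congr 1
    · simp only [energy, Finset.mul_sum]
      rw [Finset.sum_comm]
      refine Finset.sum_congr rfl fun e _ => ?_
      rw [← hx (G.tgt e), ← hx (G.src e), ← Finset.sum_sub_distrib, Finset.mul_sum,
        Finset.sum_div]
      exact Finset.sum_congr rfl fun v _ => by ring
    · rw [← hx o, Finset.mul_sum]
      exact Finset.sum_congr rfl fun v _ => by ring
  have hinj : Function.Injective T := by
    refine (injective_iff_map_eq_zero T).2 fun a ha => ?_
    have h1 := hsum a a
    simp only [ha, Pi.zero_apply, mul_zero, Finset.sum_const_zero] at h1
    have h2 : 0 ≤ G.energy L a a := Finset.sum_nonneg fun e _ =>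
      div_nonneg (mul_self_nonneg _) (hL e).le
    have h3 := mul_self_nonneg (a o)
    have h4 : a o = 0 := mul_self_eq_zero.1 (by linarith)
    funext v
    rw [hG.eq_of_energy_eq_zero hL (f := a) (by linarith) v o, h4]; rfl
  have hsurj := LinearMap.injective_iff_surjective.1 hinj
  choose j hj using fun u => hsurj (fun v => Pi.single (M := fun _ => ℝ) v 1 u -
    Pi.single (M := fun _ => ℝ) v 1 o)
  have hg : ∀ u (h : V → ℝ), G.energy L (j u) h + j u o * h o = h u - h o := fun u h => by
    rw [← hsum, hj]
    simp [mul_sub, Pi.single_apply]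
  have ho : ∀ u, j u o = 0 := fun u => by
    have := hg u (fun _ => 1)
    simpa [energy] using this
  have hg' : ∀ u (h : V → ℝ), G.energy L (j u) h = h u - h o := fun u h => by
    rw [← hg, ho]; ring
  have hs : ∀ u v, j u v = j v u := fun u v => by
    have h1 := hg' v (j u)
    have h2 := hg' u (j v)
    rw [ho, sub_zero] at h1 h2
    rw [← h1, ← h2, energy_comm]
  exact ⟨j, hs, fun v => by rw [hs, ho], hg'⟩

end Energy

/-! ### Equivariance -/

namespace Involution

variable (ι : G.Involution)

theorem edge_ends (e : E) :
    (G.src (ι.edge e) = ι.vert (G.src e) ∧ G.tgt (ι.edge e) = ι.vert (G.tgt e)) ∨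
      (G.src (ι.edge e) = ι.vert (G.tgt e) ∧ G.tgt (ι.edge e) = ι.vert (G.src e)) := by
  have := ι.ends_edge e
  rwa [Sym2.eq_iff] at this

/-- The involution of the edges as a permutation. -/
def edgeEquiv : E ≃ E := ⟨ι.edge, ι.edge, ι.edge_edge, ι.edge_edge⟩

/-- The involution of the vertices as a permutation. -/
def vertEquiv : V ≃ V := ⟨ι.vert, ι.vert, ι.vert_vert, ι.vert_vert⟩

theorem vert_injective : Function.Injective ι.vert := ι.vertEquiv.injective

variable [Fintype E]

theorem energy_comp (hL : ∀ e, L (ι.edge e) = L e) (f h : V → ℝ) :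
    G.energy L (fun v => f (ι.vert v)) (fun v => h (ι.vert v)) = G.energy L f h := by
  refine Fintype.sum_equiv ι.edgeEquiv _ _ fun e => ?_
  change _ = _ / L (ι.edge e)
  rw [hL]
  congr 1
  rcases ι.edge_ends e with ⟨h1, h2⟩ | ⟨h1, h2⟩ <;>
    simp only [edgeEquiv, Equiv.coe_fn_mk, h1, h2]
  ring

/-- The transported Green function minus the original one is orthogonal to every function for the
energy form and vanishes at `o`; testing `j v` against it shows that it is zero. -/
theorem green_comp {o : V} {j : V → V → ℝ} (hj : G.IsGreen L o j)
    (hL : ∀ e, L (ι.edge e) = L e) (ho : ι.vert o = o) (u v : V) :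
    j (ι.vert u) (ι.vert v) = j u v := by
  set w : V → ℝ := fun v => j (ι.vert u) (ι.vert v) - j u v with hw
  have h1 : ∀ h, G.energy L w h = 0 := fun h => by
    rw [energy_sub_left, hj.energy_eq]
    have := ι.energy_comp hL (j (ι.vert u)) (fun v => h (ι.vert v))
    simp only [ι.vert_vert] at this
    rw [this, hj.energy_eq, ι.vert_vert, ho, sub_self]
  have h2 := hj.energy_eq v w
  rw [energy_comm, h1] at h2
  have h3 : w o = 0 := by simp [hw, ho, hj.base']
  rw [h3] at h2
  simp only [hw] at h2
  linarith

end Involution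

end MultiGraph

/-! ### Rooting a hyperelliptic graph through its quotient tree. -/

namespace MultiGraph

variable {V E : Type*} {G : MultiGraph V E} {L : E → ℝ}

namespace Involution

variable (ι : G.Involution)

theorem edgeClass_eq_iff {e f : E} : ι.edgeClass f = ι.edgeClass e ↔ f = e ∨ f = ι.edge e := by
  refine ⟨fun h => ?_, fun h => ?_⟩
  · exact Quotient.exact (s := ι.edgeSetoid) h.symm
  · exact (Quotient.sound (s := ι.edgeSetoid) h).symm

theorem vertClass_eq_iff {u v : V} : ι.vertClass v = ι.vertClass u ↔ v = u ∨ v = ι.vert u := by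
  refine ⟨fun h => ?_, fun h => ?_⟩
  · exact Quotient.exact (s := ι.vertSetoid) h.symm
  · exact (Quotient.sound (s := ι.vertSetoid) h).symm

theorem vertClass_vert (v : V) : ι.vertClass (ι.vert v) = ι.vertClass v :=
  ι.vertClass_eq_iff.2 (Or.inr rfl)

/-- An orientation of the edges of a hyperelliptic graph away from the vertex `o`, together with
the set of vertices which are separated from `o` by the class of an edge. -/
structure Rooting (o : V) where
  /-- the end of an edge on the side of the root -/
  up : E → V
  /-- the other end of an edge -/
  low : E → V
  /-- the vertices which are separated from the root by an edge -/
  below : E → Set V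
  ends : ∀ e, (G.src e = up e ∧ G.tgt e = low e) ∨ (G.src e = low e ∧ G.tgt e = up e)
  low_mem : ∀ e, low e ∈ below e
  up_notMem : ∀ e, up e ∉ below e
  root_notMem : ∀ e, o ∉ below e
  vert_mem : ∀ e v, ι.vert v ∈ below e ↔ v ∈ below e
  closed : ∀ e f, f ≠ e → f ≠ ι.edge e → (up f ∈ below e ↔ low f ∈ below e)

/-- Every edge of an acyclic graph is a bridge: the set wanted is the preimage of one component of
the quotient after the class of `e` is deleted. -/
theorem exists_separation (h : ι.QuotAcyclic) (e : E) :
    ∃ S : Set V, G.tgt e ∈ S ∧ G.src e ∉ S ∧ (∀ v, ι.vert v ∈ S ↔ v ∈ S) ∧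
      ∀ f, f ≠ e → f ≠ ι.edge e → (G.src f ∈ S ↔ G.tgt f ∈ S) := by
  obtain ⟨hdiag, hinj, hac⟩ := h
  set T := SimpleGraph.fromEdgeSet (Set.range ι.quotEnds) with hT
  have hadj : ∀ f, T.Adj (ι.vertClass (G.src f)) (ι.vertClass (G.tgt f)) := fun f => by
    rw [hT, SimpleGraph.fromEdgeSet_adj]
    exact ⟨⟨ι.edgeClass f, rfl⟩, hdiag (ι.edgeClass f)⟩
  have hbr := SimpleGraph.isAcyclic_iff_forall_adj_isBridge.1 hac (hadj e)
  rw [SimpleGraph.isBridge_iff] at hbr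
  set T' := T \ SimpleGraph.fromEdgeSet {s(ι.vertClass (G.src e), ι.vertClass (G.tgt e))} with hT'
  refine ⟨{v | T'.Reachable (ι.vertClass (G.tgt e)) (ι.vertClass v)}, SimpleGraph.Reachable.refl _,
    fun hr => hbr hr.symm, fun v => by simp [vertClass_vert], fun f h1 h2 => ?_⟩
  have hadj' : T'.Adj (ι.vertClass (G.src f)) (ι.vertClass (G.tgt f)) := by
    rw [hT', SimpleGraph.sdiff_adj]
    refine ⟨hadj f, fun hc => ?_⟩
    rw [SimpleGraph.fromEdgeSet_adj] at hc
    have : ι.edgeClass f = ι.edgeClass e := hinj hc.1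
    rcases ι.edgeClass_eq_iff.1 this with h | h
    · exact h1 h
    · exact h2 h
  exact ⟨fun hr => hr.trans hadj'.reachable, fun hr => hr.trans hadj'.reachable.symm⟩

theorem exists_rooting (h : ι.QuotAcyclic) (o : V) : Nonempty (ι.Rooting o) := by
  have key : ∀ e, ∃ (u l : V) (B : Set V),
      ((G.src e = u ∧ G.tgt e = l) ∨ (G.src e = l ∧ G.tgt e = u)) ∧ l ∈ B ∧ u ∉ B ∧ o ∉ B ∧
      (∀ v, ι.vert v ∈ B ↔ v ∈ B) ∧
      ∀ f, f ≠ e → f ≠ ι.edge e → (G.src f ∈ B ↔ G.tgt f ∈ B) := fun e => by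
    obtain ⟨S, h1, h2, h3, h4⟩ := ι.exists_separation h e
    -- Of the two sides of the bridge, the one missing the root becomes `below`.
    by_cases ho : o ∈ S
    · exact ⟨_, _, Sᶜ, Or.inr ⟨rfl, rfl⟩, h2, fun hc => hc h1, fun hc => hc ho,
        fun v => not_congr (h3 v), fun f a b => not_congr (h4 f a b)⟩
    · exact ⟨_, _, S, Or.inl ⟨rfl, rfl⟩, h1, h2, ho, h3, h4⟩
  choose u l B h1 h2 h3 h4 h5 h6 using key
  refine ⟨⟨u, l, B, h1, h2, h3, h4, h5, fun e f a b => ?_⟩⟩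
  have := h6 e f a b
  rcases h1 f with ⟨x, y⟩ | ⟨x, y⟩
  · rwa [x, y] at this
  · rw [x, y] at this; exact this.symm

namespace Rooting

variable {ι} {o : V} (R : ι.Rooting o)

theorem mem_ends_iff (e : E) (v : V) : v ∈ G.ends e ↔ v = R.up e ∨ v = R.low e := by
  rcases R.ends e with ⟨h1, h2⟩ | ⟨h1, h2⟩ <;> simp [MultiGraph.ends, h1, h2, or_comm]

theorem closed_iff {X : Set V} (e : E) :
    (G.src e ∈ X ↔ G.tgt e ∈ X) ↔ (R.up e ∈ X ↔ R.low e ∈ X) := by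
  rcases R.ends e with ⟨h1, h2⟩ | ⟨h1, h2⟩ <;> rw [h1, h2]
  exact ⟨Iff.symm, Iff.symm⟩

theorem mem_of_closed (hG : G.Connected) {X : Set V} (hX : ∀ e, R.up e ∈ X ↔ R.low e ∈ X)
    {u : V} (hu : u ∈ X) (v : V) : v ∈ X :=
  hG.mem (fun e => (R.closed_iff e).2 (hX e)) hu v

theorem up_ne_low (e : E) : R.up e ≠ R.low e := fun h => R.up_notMem e (h ▸ R.low_mem e)

theorem vert_up_ne_low (e : E) : ι.vert (R.up e) ≠ R.low e := fun h =>
  R.up_notMem e ((R.vert_mem e _).1 (h ▸ R.low_mem e))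

theorem edge_ends (e : E) :
    (R.up (ι.edge e) = ι.vert (R.up e) ∧ R.low (ι.edge e) = ι.vert (R.low e)) ∨
      (R.up (ι.edge e) = ι.vert (R.low e) ∧ R.low (ι.edge e) = ι.vert (R.up e)) := by
  rcases R.ends e with ⟨h1, h2⟩ | ⟨h1, h2⟩ <;> rcases R.ends (ι.edge e) with ⟨h3, h4⟩ | ⟨h3, h4⟩ <;>
    rcases ι.edge_ends e with ⟨h5, h6⟩ | ⟨h5, h6⟩ <;>
    simp_all

theorem crossing_edge (e : E) : ¬ (R.up (ι.edge e) ∈ R.below e ↔ R.low (ι.edge e) ∈ R.below e) := by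
  have h1 := R.up_notMem e
  have h2 := R.low_mem e
  rcases R.edge_ends e with ⟨h3, h4⟩ | ⟨h3, h4⟩ <;> rw [h3, h4, R.vert_mem, R.vert_mem] <;> tauto

/-- Crossing `e` or its conjugate changes membership in both sets at once, and no other edge changes
either. The two sets therefore agree everywhere, as they do at the root. -/
theorem below_edge (hG : G.Connected) (e : E) : R.below (ι.edge e) = R.below e := by
  set X : Set V := {v | v ∈ R.below (ι.edge e) ↔ v ∈ R.below e} with hX
  have hc : ∀ f, R.up f ∈ X ↔ R.low f ∈ X := fun f => by
    simp only [hX, Set.mem_ofPred_eq]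
    by_cases h1 : f = e
    · subst h1
      have a := R.crossing_edge (ι.edge f)
      rw [ι.edge_edge] at a
      have b := R.up_notMem f
      have c := R.low_mem f
      tauto
    by_cases h2 : f = ι.edge e
    · subst h2
      have a := R.crossing_edge e
      have b := R.up_notMem (ι.edge e)
      have c := R.low_mem (ι.edge e)
      tauto
    have a := R.closed e f h1 h2
    have b := R.closed (ι.edge e) f h2 (by rwa [ι.edge_edge])
    tauto
  ext v
  exact R.mem_of_closed hG hc (u := o) (by simp [hX, R.root_notMem]) v

theorem edge_up_low (hG : G.Connected) (e : E) :
    R.up (ι.edge e) = ι.vert (R.up e) ∧ R.low (ι.edge e) = ι.vert (R.low e) := by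
  refine (R.edge_ends e).resolve_right fun h => ?_
  have := R.low_mem (ι.edge e)
  rw [h.2, R.below_edge hG, R.vert_mem] at this
  exact R.up_notMem e this

/-- The standard device for what follows: a set of vertices that no edge crosses and that misses the
root is empty. -/
theorem notMem_of_closed (hG : G.Connected) {X : Set V} (hX : ∀ e, R.up e ∈ X ↔ R.low e ∈ X) {u : V}
    (hu : u ∉ X) (v : V) : v ∉ X := fun hv => hu (R.mem_of_closed hG hX hv u)

end Rooting

end Involution

end MultiGraph

/-! ### Combinatorics of the rooted tree: parents, children and masses. -/

namespace MultiGraph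

variable {V E : Type*} {G : MultiGraph V E} {L : E → ℝ}

namespace Involution

variable {ι : G.Involution}

namespace Rooting

variable {o : V} (R : ι.Rooting o)

theorem up_edge (hG : G.Connected) (e : E) : R.up (ι.edge e) = ι.vert (R.up e) :=
  (R.edge_up_low hG e).1

theorem low_edge (hG : G.Connected) (e : E) : R.low (ι.edge e) = ι.vert (R.low e) :=
  (R.edge_up_low hG e).2

/-- To prove that a set invariant under the involution is closed, one edge of each class suffices. -/
theorem closed_edge_iff (hG : G.Connected) {X : Set V} (hX : ∀ v, ι.vert v ∈ X ↔ v ∈ X) (e : E) :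
    (R.up (ι.edge e) ∈ X ↔ R.low (ι.edge e) ∈ X) ↔ (R.up e ∈ X ↔ R.low e ∈ X) := by
  rw [R.up_edge hG, R.low_edge hG, hX, hX]

theorem vert_ne_iff {v : V} : ι.vert (ι.vert v) ≠ ι.vert v ↔ ι.vert v ≠ v :=
  ι.vert_injective.ne_iff

/-- A Boolean combination of the sides of two edges is empty as soon as it does not contain the root
and is not crossed by the two edges. -/
theorem not_combination (hG : G.Connected) (p : Prop → Prop → Prop) (hp : ¬ p False False) {e f : E}
    (he : p (R.up e ∈ R.below e) (R.up e ∈ R.below f) ↔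
      p (R.low e ∈ R.below e) (R.low e ∈ R.below f))
    (hf : p (R.up f ∈ R.below e) (R.up f ∈ R.below f) ↔
      p (R.low f ∈ R.below e) (R.low f ∈ R.below f)) (v : V) :
    ¬ p (v ∈ R.below e) (v ∈ R.below f) := by
  have hXi : ∀ v, ι.vert v ∈ {v | p (v ∈ R.below e) (v ∈ R.below f)} ↔
      v ∈ {v | p (v ∈ R.below e) (v ∈ R.below f)} := fun v => by
    simp only [Set.mem_ofPred_eq, R.vert_mem]
  refine R.notMem_of_closed hG (X := {v | p (v ∈ R.below e) (v ∈ R.below f)}) (fun g => ?_)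
    (u := o) ?_ v
  · by_cases h1 : g = e
    · rw [h1]; exact he
    by_cases h2 : g = f
    · rw [h2]; exact hf
    by_cases h3 : g = ι.edge e
    · rw [h3, R.closed_edge_iff hG hXi]; exact he
    by_cases h4 : g = ι.edge f
    · rw [h4, R.closed_edge_iff hG hXi]; exact hf
    have h5 := propext (R.closed e g h1 h3)
    have h6 := propext (R.closed f g h2 h4)
    simp only [Set.mem_ofPred_eq, h5, h6]
  · simpa [R.root_notMem] using hp

/-- If the edges were distinct, the union of their lower sides would be crossed by no edge while
missing the root. Non-fixedness excludes that the two edges are conjugate. -/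
theorem eq_of_low_eq (hG : G.Connected) {e f : E} (h : R.low e = R.low f)
    (hv : ι.vert (R.low e) ≠ R.low e) : e = f := by
  by_contra hne
  have hne' : e ≠ ι.edge f := fun hc => by
    rw [hc, R.low_edge hG] at h
    rw [hc, R.low_edge hG, vert_ne_iff] at hv
    exact hv h
  have hne'' : f ≠ ι.edge e := fun hc => hne' (by rw [hc, ι.edge_edge])
  have he := (R.closed f e hne hne').2 (h ▸ R.low_mem f)
  have hf := (R.closed e f (Ne.symm hne) hne'').2 (h ▸ R.low_mem e)
  exact R.not_combination hG Or (by simp) (iff_of_true (Or.inr he) (Or.inl (R.low_mem e)))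
    (iff_of_true (Or.inl hf) (Or.inr (R.low_mem f))) (R.low e) (Or.inl (R.low_mem e))

theorem ne_of_up_eq_low (hG : G.Connected) {e f : E} (h : R.up f = R.low e) :
    f ≠ e ∧ f ≠ ι.edge e := by
  refine ⟨fun hc => R.up_ne_low e (hc ▸ h), fun hc => ?_⟩
  rw [hc, R.up_edge hG] at h
  exact R.vert_up_ne_low e h

theorem low_mem_below (hG : G.Connected) {e f : E} (h : R.up f = R.low e) :
    R.low f ∈ R.below e := by
  obtain ⟨hne, hne'⟩ := R.ne_of_up_eq_low hG h
  exact (R.closed e f hne hne').1 (h ▸ R.low_mem e)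

theorem up_notMem_below (hG : G.Connected) {e f : E} (h : R.up f = R.low e) :
    R.up e ∉ R.below f := by
  obtain ⟨hne, hne'⟩ := R.ne_of_up_eq_low hG h
  have hne'' : e ≠ ι.edge f := fun hc => hne' (by rw [hc, ι.edge_edge])
  rw [R.closed f e (Ne.symm hne) hne'', ← h]
  exact R.up_notMem f

theorem below_subset (hG : G.Connected) {e f : E} (h : R.up f = R.low e) :
    R.below f ⊆ R.below e := by
  intro v hv
  by_contra hv'
  exact R.not_combination hG (fun a b => b ∧ ¬ a) (by simp) (e := e) (f := f)
    (iff_of_false (fun hc => R.up_notMem_below hG h hc.1) fun hc => hc.2 (R.low_mem e))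
    (iff_of_false (fun hc => R.up_notMem f hc.1) fun hc => hc.2 (R.low_mem_below hG h)) v ⟨hv, hv'⟩

theorem eq_of_up_eq (hG : G.Connected) {e f : E} (h : R.up e = R.up f)
    (hv : ι.vert (R.up e) ≠ R.up e) {v : V} (hve : v ∈ R.below e) (hvf : v ∈ R.below f) :
    e = f := by
  by_contra hne
  have hne' : e ≠ ι.edge f := fun hc => by
    rw [hc, R.up_edge hG] at h
    rw [hc, R.up_edge hG, vert_ne_iff] at hv
    exact hv h
  have hne'' : f ≠ ι.edge e := fun hc => hne' (by rw [hc, ι.edge_edge])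
  have he := fun hc => R.up_notMem f (h ▸ (R.closed f e hne hne').2 hc)
  have hf := fun hc => R.up_notMem e (h ▸ (R.closed e f (Ne.symm hne) hne'').2 hc)
  exact R.not_combination hG And (by simp) (e := e) (f := f)
    (iff_of_false (fun hc => R.up_notMem e hc.1) fun hc => he hc.2)
    (iff_of_false (fun hc => R.up_notMem f hc.2) fun hc => hf hc.1) v ⟨hve, hvf⟩

/-- The vertices lying on the orbit of `v` or separated from the root by an edge leaving `v`
downwards. -/
def cone (v : V) : Set V := {u | u = v ∨ u = ι.vert v ∨ ∃ f, R.up f = v ∧ u ∈ R.below f}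

theorem vert_mem_cone (v u : V) : ι.vert u ∈ R.cone v ↔ u ∈ R.cone v := by
  have h1 : ι.vert u = v ↔ u = ι.vert v :=
    ⟨fun h => by rw [← h, ι.vert_vert], fun h => by rw [h, ι.vert_vert]⟩
  have h2 : ι.vert u = ι.vert v ↔ u = v := ι.vert_injective.eq_iff
  simp only [cone, Set.mem_ofPred_eq, R.vert_mem, h1, h2]
  tauto

theorem cone_closed (hG : G.Connected) {v : V} {g : E} (h1 : R.low g ≠ v)
    (h2 : R.low g ≠ ι.vert v) : R.up g ∈ R.cone v ↔ R.low g ∈ R.cone v := by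
  by_cases h3 : R.up g = v
  · exact iff_of_true (Or.inl h3) (Or.inr (Or.inr ⟨g, h3, R.low_mem g⟩))
  by_cases h4 : R.up g = ι.vert v
  · refine iff_of_true (Or.inr (Or.inl h4)) (Or.inr (Or.inr ⟨ι.edge g, ?_, ?_⟩))
    · rw [R.up_edge hG, h4, ι.vert_vert]
    · rw [R.below_edge hG]; exact R.low_mem g
  simp only [cone, Set.mem_ofPred_eq, h1, h2, h3, h4, false_or]
  refine exists_congr fun f => and_congr_right fun hf => R.closed f g ?_ ?_
  · rintro rfl; exact h3 hf
  · rintro rfl; rw [R.up_edge hG, hf] at h4; exact h4 rfl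

/-- A vertex with no edge arriving from above would make its cone a set that no edge crosses,
missing the root. -/
theorem exists_low_eq (hG : G.Connected) {v : V} (h1 : v ≠ o) (h2 : ι.vert v ≠ o) :
    ∃ e, R.low e = v := by
  by_contra! hc
  refine R.notMem_of_closed hG (X := R.cone v) (fun g => R.cone_closed hG (hc g) fun hg => ?_)
    (u := o) ?_ v (Or.inl rfl)
  · refine hc (ι.edge g) ?_
    rw [R.low_edge hG, hg, ι.vert_vert]
  · rintro (h | h | ⟨f, _, hf⟩)
    · exact h1 h.symm
    · exact h2 h.symm
    · exact R.root_notMem f hf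

theorem below_subset_cone (hG : G.Connected) {e : E} (hv : ι.vert (R.low e) ≠ R.low e) :
    R.below e ⊆ R.cone (R.low e) := by
  set X := R.below e \ R.cone (R.low e) with hX
  have hXi : ∀ v, ι.vert v ∈ X ↔ v ∈ X := fun v => by simp [hX, R.vert_mem, R.vert_mem_cone]
  have hce : R.up e ∈ X ↔ R.low e ∈ X :=
    iff_of_false (fun h => R.up_notMem e h.1) fun h => h.2 (Or.inl rfl)
  intro v hve
  by_contra hve'
  refine R.notMem_of_closed hG (X := X) (fun g => ?_) (u := o)
    (by simp [hX, R.root_notMem]) v ⟨hve, hve'⟩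
  by_cases h1 : g = e
  · rw [h1]; exact hce
  by_cases h3 : g = ι.edge e
  · rw [h3, R.closed_edge_iff hG hXi]; exact hce
  have h5 := R.closed e g h1 h3
  have h6 := R.cone_closed hG (v := R.low e) (g := g)
    (fun h => h1 (R.eq_of_low_eq hG h.symm hv).symm) (fun h => h3 (by
      rw [R.eq_of_low_eq hG (f := ι.edge g) (e := e) (by rw [R.low_edge hG, h, ι.vert_vert]) hv,
        ι.edge_edge]))
  simp only [hX, Set.mem_sdiff]; tauto

/-- The mass of a divisor on the side of an edge away from the root. -/
noncomputable def mass [Fintype V] (D : V → ℝ) (e : E) : ℝ := ∑ u, (R.below e).indicator D u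

/-- The side below `e` splits into the two points of the orbit of `low e`, whence the factor 2, and
the sides below the edges `f` leaving `low e`. Edges leaving the conjugate vertex have the same
lower sides and are not counted again. -/
theorem mass_eq [Fintype V] [Fintype E] [DecidableEq V] (hG : G.Connected) {D : V → ℝ}
    (hD : ∀ v, D (ι.vert v) = D v) {e : E} (hv : ι.vert (R.low e) ≠ R.low e) :
    R.mass D e = 2 * D (R.low e) + ∑ f with R.up f = R.low e, R.mass D f := by
  classical
  simp only [mass]
  have key : ∀ u, (R.below e).indicator D u = (if u = R.low e then D u else 0) +
      (if u = ι.vert (R.low e) then D u else 0) +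
      ∑ f with R.up f = R.low e, (R.below f).indicator D u := fun u => by
    by_cases hu : u ∈ R.below e
    · rw [Set.indicator_of_mem hu]
      have hn : ∀ f ∈ Finset.univ.filter (fun f => R.up f = R.low e), R.low e ∉ R.below f :=
        fun f hf => by rw [← (Finset.mem_filter.1 hf).2]; exact R.up_notMem f
      rcases R.below_subset_cone hG hv hu with h | h | ⟨f, hf, huf⟩
      · rw [if_pos h, if_neg (by rw [h]; exact hv.symm), Finset.sum_eq_zero, add_zero, add_zero]
        intro f hf
        rw [h, Set.indicator_of_notMem (hn f hf)]
      · rw [if_pos h, if_neg (by rw [h]; exact hv), Finset.sum_eq_zero, add_zero, zero_add]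
        intro f hf
        rw [h, Set.indicator_of_notMem (by rw [R.vert_mem]; exact hn f hf)]
      · rw [if_neg, if_neg, zero_add, zero_add, Finset.sum_eq_single_of_mem f (by simpa using hf),
          Set.indicator_of_mem huf]
        · intro g hg hgf
          refine Set.indicator_of_notMem (fun hug => hgf ?_) _
          have hg' := (Finset.mem_filter.1 hg).2
          exact R.eq_of_up_eq hG (hg'.trans hf.symm) (by rwa [hg']) hug huf
        · rintro rfl; rw [R.vert_mem, ← hf] at huf; exact R.up_notMem f huf
        · rintro rfl; rw [← hf] at huf; exact R.up_notMem f huf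
    · rw [Set.indicator_of_notMem hu, if_neg, if_neg, Finset.sum_eq_zero]
      · simp
      · intro f hf
        exact Set.indicator_of_notMem
          (fun h => hu (R.below_subset hG (Finset.mem_filter.1 hf).2 h)) _
      · rintro rfl; exact hu ((R.vert_mem e _).2 (R.low_mem e))
      · rintro rfl; exact hu (R.low_mem e)
  rw [Finset.sum_congr rfl fun u _ => key u, Finset.sum_add_distrib, Finset.sum_add_distrib,
    Finset.sum_comm]
  simp [hD]
  ring

/-- A non-fixed lower end has valence at least 3 but only one edge from above, so the descent
continues. Since the sides shrink strictly, it ends at a fixed vertex. -/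
theorem exists_fixed_joined [Finite V] (hG : G.Connected)
    (h3 : ∀ v, ι.vert v ≠ v → 3 ≤ {e | v ∈ G.ends e}.ncard) (e : E) :
    ∃ z ∈ R.below e, ι.vert z = z ∧
      G.joinSetoid {g | R.up g ∈ R.below e ∧ R.low g ∈ R.below e} (R.low e) z := by
  induction hn : (R.below e).ncard using Nat.strong_induction_on generalizing e with
  | _ n ih =>
    by_cases hv : ι.vert (R.low e) = R.low e
    · exact ⟨R.low e, R.low_mem e, hv, Setoid.refl' _ _⟩
    obtain ⟨f, hf⟩ : ∃ f, R.up f = R.low e := by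
      by_contra! hc
      have h1 : {g | R.low e ∈ G.ends g} ⊆ {e} := fun g hg => by
        rcases (R.mem_ends_iff g _).1 hg with h | h
        · exact absurd h.symm (hc g)
        · exact (R.eq_of_low_eq hG h hv).symm
      have h2 := Set.ncard_le_ncard h1
      rw [Set.ncard_singleton] at h2
      have := h3 _ hv
      omega
    have hsub := R.below_subset hG hf
    have hss : R.below f ⊂ R.below e := (Set.ssubset_iff_of_subset hsub).2
      ⟨R.low e, R.low_mem e, hf ▸ R.up_notMem f⟩
    obtain ⟨z, hz, hfix, hj⟩ := ih _ (hn ▸ Set.ncard_lt_ncard hss) f rfl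
    refine ⟨z, hsub hz, hfix, ?_⟩
    have h1 : f ∈ {g | R.up g ∈ R.below e ∧ R.low g ∈ R.below e} :=
      ⟨hf ▸ R.low_mem e, hsub (R.low_mem f)⟩
    have h2 := joinSetoid_edge (G := G) h1
    have h4 := joinSetoid_mono (T := {g | R.up g ∈ R.below e ∧ R.low g ∈ R.below e})
      (fun g hg => ⟨hsub hg.1, hsub hg.2⟩) hj
    rw [← hf]
    rcases R.ends f with ⟨a, b⟩ | ⟨a, b⟩ <;> rw [a, b] at h2
    · exact Setoid.trans' _ h2 h4
    · exact Setoid.trans' _ (Setoid.symm' _ h2) h4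

end Rooting

end Involution

end MultiGraph

/-! ### The contracted graphs, w and ν in terms of the rooting. -/

namespace MultiGraph

variable {V E : Type*} {G : MultiGraph V E} {L : E → ℝ}

namespace Involution

variable {ι : G.Involution}

theorem joinSetoid_vert {S : Set E} (hS : ∀ e, ι.edge e ∈ S ↔ e ∈ S) {u v : V}
    (h : G.joinSetoid S u v) : G.joinSetoid S (ι.vert u) (ι.vert v) := by
  have h' : Relation.EqvGen (fun u v => ∃ e ∈ S, G.src e = u ∧ G.tgt e = v) u v := h
  clear h
  induction h' with
  | rel x y hxy =>
    obtain ⟨e, he, rfl, rfl⟩ := hxy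
    have := joinSetoid_edge (G := G) ((hS e).2 he)
    rcases ι.edge_ends e with ⟨h1, h2⟩ | ⟨h1, h2⟩ <;> rw [h1, h2] at this
    · exact this
    · exact Setoid.symm' _ this
  | refl x => exact Setoid.refl' _ _
  | symm x y _ ih => exact Setoid.symm' _ ih
  | trans x y z _ _ ih1 ih2 => exact Setoid.trans' _ ih1 ih2

theorem edgeClass_edge (e : E) : ι.edgeClass (ι.edge e) = ι.edgeClass e :=
  ι.edgeClass_eq_iff.2 (Or.inr rfl)

namespace Rooting

variable {o : V} (R : ι.Rooting o)

theorem joinSetoid_up_low {S : Set E} {e : E} (he : e ∈ S) :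
    G.joinSetoid S (R.up e) (R.low e) := by
  have := joinSetoid_edge (G := G) he
  rcases R.ends e with ⟨h1, h2⟩ | ⟨h1, h2⟩ <;> rw [h1, h2] at this
  · exact this
  · exact Setoid.symm' _ this

theorem mem_class_iff {S : Set E} {e : E} (he : e ∈ S) (z : V) :
    G.joinSetoid S (R.up e) z ↔ G.joinSetoid S (R.low e) z :=
  ⟨fun h => Setoid.trans' _ (Setoid.symm' _ (R.joinSetoid_up_low he)) h,
    fun h => Setoid.trans' _ (R.joinSetoid_up_low he) h⟩

theorem mem_compl_edgeClass {e f : E} (hf : f ≠ e) (hf' : f ≠ ι.edge e) :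
    f ∈ {g | ι.edgeClass g ≠ ι.edgeClass e} := fun hc => by
  rcases ι.edgeClass_eq_iff.1 hc with h | h
  · exact hf h
  · exact hf' h

theorem below_iff_of_joined {e : E} {u v : V}
    (h : G.joinSetoid {g | ι.edgeClass g ≠ ι.edgeClass e} u v) :
    u ∈ R.below e ↔ v ∈ R.below e :=
  mem_iff_of_joinSetoid (fun g hg => (R.closed_iff g).2 (R.closed e g
    (by rintro rfl; exact hg rfl) (by rintro rfl; exact hg (edgeClass_edge e)))) h

theorem inner_subset (e : E) : {g | R.up g ∈ R.below e ∧ R.low g ∈ R.below e} ⊆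
    {g | ι.edgeClass g ≠ ι.edgeClass e} := fun g hg => mem_compl_edgeClass
  (by rintro rfl; exact R.up_notMem g hg.1) (by
    rintro rfl
    exact R.crossing_edge e (iff_of_true hg.1 hg.2))

/-- After deletion of both edges of the class, the side could still fall into two conjugate sheets;
the fixed vertex `z` belongs to both and glues them. -/
theorem joined_of_mem_below (hG : G.Connected) {e : E} {z : V} (hfix : ι.vert z = z)
    (hz : G.joinSetoid {g | ι.edgeClass g ≠ ι.edgeClass e} (R.low e) z) {u : V}
    (hu : u ∈ R.below e) : G.joinSetoid {g | ι.edgeClass g ≠ ι.edgeClass e} u z := by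
  set S := {g | ι.edgeClass g ≠ ι.edgeClass e} with hS
  have hSi : ∀ g, ι.edge g ∈ S ↔ g ∈ S := fun g => by simp [hS, edgeClass_edge]
  by_contra hc
  refine R.notMem_of_closed hG (X := {v | v ∈ R.below e ∧ ¬ G.joinSetoid S v z}) (fun g => ?_)
    (u := o) (fun h => R.root_notMem e h.1) u ⟨hu, hc⟩
  by_cases h1 : g = e
  · subst h1
    exact iff_of_false (fun h => R.up_notMem g h.1) fun h => h.2 hz
  by_cases h2 : g = ι.edge e
  · subst h2
    refine iff_of_false (fun h => R.up_notMem e ?_) fun h => h.2 ?_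
    · have := h.1
      rwa [R.up_edge hG, R.vert_mem] at this
    · have := joinSetoid_vert hSi hz
      rwa [hfix, ← R.low_edge hG] at this
  exact and_congr (R.closed e g h1 h2) (not_congr (R.mem_class_iff (mem_compl_edgeClass h1 h2) z))

theorem joined_root_of_notMem_below (hG : G.Connected) (ho : ι.vert o = o) {e : E} {u : V}
    (hu : u ∉ R.below e) : G.joinSetoid {g | ι.edgeClass g ≠ ι.edgeClass e} u o := by
  set S := {g | ι.edgeClass g ≠ ι.edgeClass e} with hS
  have hSi : ∀ g, ι.edge g ∈ S ↔ g ∈ S := fun g => by simp [hS, edgeClass_edge]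
  have hvi : ∀ {v}, G.joinSetoid S (ι.vert v) o → G.joinSetoid S v o := fun {v} h => by
    have := joinSetoid_vert hSi h
    rwa [ι.vert_vert, ho] at this
  have hup : G.joinSetoid S (R.up e) o := by
    by_contra hc
    refine R.notMem_of_closed hG (X := {v | v ∈ R.below e ∨ ¬ G.joinSetoid S v o}) (fun g => ?_)
      (u := o) ?_ (R.low e) (Or.inl (R.low_mem e))
    · by_cases h1 : g = e
      · subst h1
        exact iff_of_true (Or.inr hc) (Or.inl (R.low_mem g))
      by_cases h2 : g = ι.edge e
      · subst h2
        rw [R.up_edge hG, R.low_edge hG]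
        exact iff_of_true (Or.inr fun h => hc (hvi h)) (Or.inl ((R.vert_mem _ _).2 (R.low_mem e)))
      exact or_congr (R.closed e g h1 h2)
        (not_congr (R.mem_class_iff (mem_compl_edgeClass h1 h2) o))
    · rintro (h | h)
      · exact R.root_notMem e h
      · exact h (Setoid.refl' _ _)
  by_contra hc
  refine R.notMem_of_closed hG (X := {v | v ∉ R.below e ∧ ¬ G.joinSetoid S v o}) (fun g => ?_)
    (u := o) (fun h => h.2 (Setoid.refl' _ _)) u ⟨hu, hc⟩
  by_cases h1 : g = e
  · subst h1
    exact iff_of_false (fun h => h.2 hup) fun h => h.1 (R.low_mem g)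
  by_cases h2 : g = ι.edge e
  · subst h2
    rw [R.up_edge hG, R.low_edge hG]
    refine iff_of_false (fun h => h.2 ?_) fun h => h.1 ((R.vert_mem _ _).2 (R.low_mem e))
    have := joinSetoid_vert hSi hup
    rwa [ho] at this
  exact and_congr (not_congr (R.closed e g h1 h2))
    (not_congr (R.mem_class_iff (mem_compl_edgeClass h1 h2) o))

/-- The coefficients of the contracted divisor are the masses of the two sides of the edge. -/
theorem w_eq [Fintype V] (hG : G.Connected) (ho : ι.vert o = o)
    (h3 : ∀ v, ι.vert v ≠ v → 3 ≤ {e | v ∈ G.ends e}.ncard) (D : V → ℝ) (e : E) :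
    ι.w D (ι.edgeClass e) = min (R.mass D e) (divDeg D - R.mass D e) := by
  obtain ⟨z, hz, hfix, hj⟩ := R.exists_fixed_joined hG h3 e
  have hj' := joinSetoid_mono (R.inner_subset e) hj
  -- The contracted graph has exactly two vertices, the classes of `z` and of `o`: the two sides of
  -- the edge.
  have hin : ∀ v, G.joinSetoid {g | ι.edgeClass g ≠ ι.edgeClass e} v z ↔ v ∈ R.below e := fun v =>
    ⟨fun h => (R.below_iff_of_joined h).2 hz, R.joined_of_mem_below hG hfix hj'⟩
  have hout : ∀ v, G.joinSetoid {g | ι.edgeClass g ≠ ι.edgeClass e} v o ↔ v ∉ R.below e :=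
    fun v => ⟨fun h hv => R.root_notMem e ((R.below_iff_of_joined h).1 hv),
      R.joined_root_of_notMem_below hG ho⟩
  have hcoef : ∀ y, ι.contractedCoeff D (ι.edgeClass e) (Quotient.mk _ y) =
      ∑ v, Set.indicator {v | G.joinSetoid {g | ι.edgeClass g ≠ ι.edgeClass e} v y} D v :=
    fun y => by
      unfold contractedCoeff
      refine Finset.sum_congr rfl fun v _ => ?_
      congr 1
      ext v
      exact Quotient.eq
  have hcz : ι.contractedCoeff D (ι.edgeClass e) (Quotient.mk _ z) = R.mass D e := by
    rw [hcoef, mass]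
    simp only [hin]; rfl
  have hco : ι.contractedCoeff D (ι.edgeClass e) (Quotient.mk _ o) = divDeg D - R.mass D e := by
    rw [hcoef, mass, divDeg, ← Finset.sum_sub_distrib]
    refine Finset.sum_congr rfl fun v _ => ?_
    simp only [hout]
    by_cases hv : v ∈ R.below e <;> simp [Set.indicator, hv]
  have hfin : Finite (ι.ContractedVert (ι.edgeClass e)) :=
    Quotient.finite (G.joinSetoid {g | ι.edgeClass g ≠ ι.edgeClass e})
  have hne : Nonempty (ι.ContractedVert (ι.edgeClass e)) := ⟨Quotient.mk _ o⟩
  have hbdd := Set.Finite.bddBelow (Set.finite_range (ι.contractedCoeff D (ι.edgeClass e)))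
  refine le_antisymm (le_min (hcz ▸ ciInf_le hbdd _) (hco ▸ ciInf_le hbdd _)) (le_ciInf fun P => ?_)
  induction P using Quotient.inductionOn with
  | _ v =>
    by_cases hv : v ∈ R.below e
    · rw [show (Quotient.mk _ v : ι.ContractedVert (ι.edgeClass e)) = Quotient.mk _ z from
        Quotient.sound ((hin v).2 hv), hcz]
      exact min_le_left _ _
    · rw [show (Quotient.mk _ v : ι.ContractedVert (ι.edgeClass e)) = Quotient.mk _ o from
        Quotient.sound ((hout v).2 hv), hco]
      exact min_le_right _ _

/-- Two-jointed edges never meet a non-fixed vertex, so ν there is simply the valence. -/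
theorem joint_le_one (R : ι.Rooting o) (hG : G.Connected) {e : E} {v : V} (hv : ι.vert v ≠ v)
    (he : v ∈ G.ends e) : ι.joint e ≤ 1 := by
  have hsub : ∃ x, G.ends e ∩ G.ends (ι.edge e) ⊆ {x} := by
    have h2 := R.vert_up_ne_low e
    have h2' : ι.vert (R.low e) ≠ R.up e := fun h => h2 (by rw [← h, ι.vert_vert])
    rcases (R.mem_ends_iff e v).1 he with rfl | rfl
    · refine ⟨R.low e, ?_⟩
      rintro x ⟨h3, h4⟩
      rw [R.mem_ends_iff, R.up_edge hG, R.low_edge hG] at h4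
      rcases (R.mem_ends_iff e x).1 h3 with rfl | rfl
      · rcases h4 with h | h
        · exact absurd h.symm hv
        · exact absurd h.symm h2'
      · rfl
    · refine ⟨R.up e, ?_⟩
      rintro x ⟨h3, h4⟩
      rw [R.mem_ends_iff, R.up_edge hG, R.low_edge hG] at h4
      rcases (R.mem_ends_iff e x).1 h3 with rfl | rfl
      · rfl
      · rcases h4 with h | h
        · exact absurd h.symm h2
        · exact absurd h.symm hv
  obtain ⟨x, hx⟩ := hsub
  have := Set.ncard_le_ncard hx
  rwa [Set.ncard_singleton] at this

theorem ncard_ends [Fintype E] [DecidableEq V] (hG : G.Connected) {e : E}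
    (hv : ι.vert (R.low e) ≠ R.low e) : {f | R.low e ∈ G.ends f}.ncard =
      1 + (Finset.univ.filter fun f => R.up f = R.low e).card := by
  classical
  have : {f | R.low e ∈ G.ends f} =
      ((insert e (Finset.univ.filter fun f => R.up f = R.low e) : Finset E) : Set E) := by
    ext f
    simp only [Set.mem_ofPred_eq, R.mem_ends_iff, Finset.coe_insert, Finset.coe_filter,
      Finset.mem_univ, true_and, Set.mem_insert_iff]
    constructor
    · rintro (h | h)
      · exact Or.inr h.symm
      · exact Or.inl (R.eq_of_low_eq hG h hv).symm
    · rintro (rfl | h)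
      · exact Or.inr rfl
      · exact Or.inl h.symm
  rw [this, Set.ncard_coe_finset, Finset.card_insert_of_notMem, add_comm]
  simpa using R.up_ne_low e

theorem nu_low [Fintype E] [DecidableEq V] (hG : G.Connected) {e : E}
    (hv : ι.vert (R.low e) ≠ R.low e) : ι.nu (R.low e) =
      1 + (Finset.univ.filter fun f => R.up f = R.low e).card := by
  rw [← R.ncard_ends hG hv, nu, ← Set.ncard_union_eq]
  · congr 1
    ext f
    simp only [Set.mem_union, Set.mem_ofPred_eq, ← and_or_left, and_iff_left_iff_imp]
    intro hf
    have := R.joint_le_one hG hv hf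
    omega
  · rw [Set.disjoint_left]
    rintro f ⟨_, h1⟩ ⟨_, h2⟩
    omega

theorem card_up_vert [Fintype E] [DecidableEq V] (hG : G.Connected) (v : V) :
    (Finset.univ.filter fun f => R.up f = ι.vert v).card =
      (Finset.univ.filter fun f => R.up f = v).card := by
  refine Finset.card_equiv ι.edgeEquiv fun f => ?_
  simp only [Finset.mem_filter, Finset.mem_univ, true_and]
  change _ ↔ R.up (ι.edge f) = v
  rw [R.up_edge hG]
  constructor
  · intro h; rw [h, ι.vert_vert]
  · intro h; rw [← h, ι.vert_vert]

end Rooting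

theorem exists_fixed [Finite V] (hι : ι.IsHyperelliptic) : ∃ o, ι.vert o = o := by
  obtain ⟨v⟩ := hι.connected.1
  by_cases hE : Nonempty E
  · obtain ⟨e⟩ := hE
    obtain ⟨R⟩ := ι.exists_rooting hι.quotAcyclic v
    obtain ⟨z, _, hz, _⟩ := R.exists_fixed_joined hι.connected hι.three_le e
    exact ⟨z, hz⟩
  · exact ⟨v, hι.connected.mem (X := {v}) (fun e => (hE ⟨e⟩).elim) rfl (ι.vert v)⟩

end Involution

end MultiGraph

/-! ### The antisymmetric Green function and cuts along an edge class. -/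

namespace MultiGraph

variable {V E : Type*} {G : MultiGraph V E} {L : E → ℝ}

namespace Involution

variable {ι : G.Involution}

/-- The antisymmetric part of a Green function. -/
def skew (ι : G.Involution) (j : V → V → ℝ) (u v : V) : ℝ := j u v - j (ι.vert u) v

namespace Rooting

variable [Fintype E] {o : V} {R : ι.Rooting o} {j : V → V → ℝ}

/-- `L` is a system of positive, invariant lengths on a hyperelliptic graph rooted at a fixed vertex,
and `j` is the corresponding Green function with pole at the root. -/
structure IsMetrized (R : ι.Rooting o) (L : E → ℝ) (j : V → V → ℝ) : Prop where
  hyperelliptic : ι.IsHyperelliptic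
  root : ι.vert o = o
  length_pos : ∀ e, 0 < L e
  length_edge : ∀ e, L (ι.edge e) = L e
  green : G.IsGreen L o j

theorem energy_eq_sum (R : ι.Rooting o) (f h : V → ℝ) : G.energy L f h =
    ∑ e, (f (R.low e) - f (R.up e)) * (h (R.low e) - h (R.up e)) / L e := by
  refine Finset.sum_congr rfl fun e _ => ?_
  rcases R.ends e with ⟨h1, h2⟩ | ⟨h1, h2⟩ <;> rw [h1, h2]
  ring

open Classical in
/-- The part of the energy coming from the edges inside `X`. -/
noncomputable def sideEnergy (R : ι.Rooting o) (L : E → ℝ) (X : Set V) (f h : V → ℝ) : ℝ :=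
  ∑ e, if R.up e ∈ X ∧ R.low e ∈ X then
    (f (R.low e) - f (R.up e)) * (h (R.low e) - h (R.up e)) / L e else 0

theorem sideEnergy_comm (R : ι.Rooting o) (X : Set V) (f h : V → ℝ) :
    R.sideEnergy L X f h = R.sideEnergy L X h f :=
  Finset.sum_congr rfl fun e _ => by rw [mul_comm (f _ - f _)]

namespace IsMetrized

variable (H : R.IsMetrized L j)
include H

theorem connected : G.Connected := H.hyperelliptic.connected

theorem green_comp (u v : V) : j (ι.vert u) (ι.vert v) = j u v :=
  ι.green_comp H.green H.length_edge H.root u v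

theorem green_vert (u v : V) : j u (ι.vert v) = j (ι.vert u) v := by
  rw [← H.green_comp, ι.vert_vert]

theorem sum_pair (e : E) {F : E → ℝ} (hF : ∀ g, g ≠ e → g ≠ ι.edge e → F g = 0) :
    ∑ g, F g = F e + F (ι.edge e) :=
  Fintype.sum_eq_add _ _ (H.hyperelliptic.edge_ne e).symm fun g hg => hF g hg.1 hg.2

theorem energy_skew (u : V) (h : V → ℝ) : G.energy L (ι.skew j u) h = h u - h (ι.vert u) := by
  have := energy_sub_left (G := G) (L := L) (j u) (j (ι.vert u)) h
  rw [H.green.energy_eq, H.green.energy_eq] at this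
  rw [show ι.skew j u = fun v => j u v - j (ι.vert u) v from rfl, this]
  ring

theorem skew_comm (u v : V) : ι.skew j u v = ι.skew j v u := by
  simp only [skew]
  rw [H.green.symm u v, H.green.symm (ι.vert u), H.green_vert]

theorem skew_vert_right (u v : V) : ι.skew j u (ι.vert v) = - ι.skew j u v := by
  simp only [skew]
  rw [H.green_comp, H.green_vert]
  ring

theorem skew_eq_zero {z : V} (hz : ι.vert z = z) (u : V) : ι.skew j u z = 0 := by
  have := H.skew_vert_right u z
  rw [hz] at this
  linarith

/-- The energy of `f` against the restriction of `h` to one side `X` of an edge. -/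
theorem energy_indicator (e : E) {X : Set V} (hX : ∀ v, ι.vert v ∈ X ↔ v ∈ X)
    (hc : ∀ g, g ≠ e → g ≠ ι.edge e → (R.up g ∈ X ↔ R.low g ∈ X))
    (he : ¬ (R.up e ∈ X ∧ R.low e ∈ X)) {f h : V → ℝ} (hf : ∀ v, f (ι.vert v) = - f v)
    (hh : ∀ v, h (ι.vert v) = - h v) :
    G.energy L f (X.indicator h) = R.sideEnergy L X f h +
      2 * ((f (R.low e) - f (R.up e)) * (X.indicator h (R.low e) - X.indicator h (R.up e)) / L e) := by
  rw [R.energy_eq_sum, sideEnergy, ← sub_eq_iff_eq_add', ← Finset.sum_sub_distrib, H.sum_pair e]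
  · have hind : ∀ v, X.indicator h (ι.vert v) = - X.indicator h v := fun v => by
      by_cases hv : v ∈ X <;> simp [Set.indicator, hX, hv, hh]
    have h1 : ¬ (R.up (ι.edge e) ∈ X ∧ R.low (ι.edge e) ∈ X) := by
      rwa [R.up_edge H.connected, R.low_edge H.connected, hX, hX]
    rw [if_neg he, if_neg h1, R.up_edge H.connected, R.low_edge H.connected, H.length_edge]
    simp only [hind, hf]
    ring
  · intro g hg hg'
    have := hc g hg hg'
    by_cases hlow : R.low g ∈ X
    · have hup := this.2 hlow
      simp [Set.indicator, hlow, hup]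
    · have hup := mt this.1 hlow
      simp [Set.indicator, hlow, hup]

theorem energy_eq_side_add_side (e : E) {f h : V → ℝ} (hf : ∀ v, f (ι.vert v) = - f v)
    (hh : ∀ v, h (ι.vert v) = - h v) :
    G.energy L f h = R.sideEnergy L (R.below e) f h + R.sideEnergy L (R.below e)ᶜ f h +
      2 * ((f (R.low e) - f (R.up e)) * (h (R.low e) - h (R.up e)) / L e) := by
  rw [R.energy_eq_sum, sideEnergy, sideEnergy, ← sub_eq_iff_eq_add', ← Finset.sum_add_distrib,
    ← Finset.sum_sub_distrib, H.sum_pair e]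
  · have h1 := R.low_mem e
    have h2 := R.up_notMem e
    rw [R.up_edge H.connected, R.low_edge H.connected, H.length_edge]
    simp only [Set.mem_compl_iff, R.vert_mem, h1, h2, hf, hh]
    simp
    ring
  · intro g hg hg'
    have := R.closed e g hg hg'
    by_cases hlow : R.low g ∈ R.below e
    · have hup := this.2 hlow
      simp [hlow, hup]
    · have hup := mt this.1 hlow
      simp [hlow, hup]

theorem sideEnergy_self_nonneg (X : Set V) (f : V → ℝ) : 0 ≤ R.sideEnergy L X f f :=
  Finset.sum_nonneg fun e _ => by
    split_ifs
    · exact div_nonneg (mul_self_nonneg _) (H.length_pos e).le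
    · exact le_rfl

open Classical in
theorem eq_of_sideEnergy_eq_zero {X : Set V} {f : V → ℝ} (h : R.sideEnergy L X f f = 0) {g : E}
    (h1 : R.up g ∈ X) (h2 : R.low g ∈ X) : f (R.up g) = f (R.low g) := by
  have hnn : ∀ e ∈ Finset.univ, 0 ≤ (if R.up e ∈ X ∧ R.low e ∈ X then
      (f (R.low e) - f (R.up e)) * (f (R.low e) - f (R.up e)) / L e else 0) := fun e _ => by
    split_ifs
    · exact div_nonneg (mul_self_nonneg _) (H.length_pos e).le
    · exact le_rfl
  have := (Finset.sum_eq_zero_iff_of_nonneg hnn).1 h g (Finset.mem_univ g)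
  rw [if_pos ⟨h1, h2⟩, div_eq_zero_iff, mul_self_eq_zero, sub_eq_zero] at this
  exact (this.resolve_right (H.length_pos g).ne').symm

/-- Orthogonality of `skew j u` to the functions which vanish on its orbit. -/
theorem side_relation (e : E) {u : V} {X : Set V} (hX : X = R.below e ∨ X = (R.below e)ᶜ)
    (hu : u ∉ X) {h : V → ℝ} (hh : ∀ v, h (ι.vert v) = - h v) :
    R.sideEnergy L X (ι.skew j u) h + 2 * ((ι.skew j u (R.low e) - ι.skew j u (R.up e)) *
      (X.indicator h (R.low e) - X.indicator h (R.up e)) / L e) = 0 := by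
  have h1 := R.low_mem e
  have h2 := R.up_notMem e
  have hXi : ∀ v, ι.vert v ∈ X ↔ v ∈ X := fun v => by
    rcases hX with rfl | rfl
    · exact R.vert_mem e v
    · exact not_congr (R.vert_mem e v)
  rw [← H.energy_indicator e hXi _ _ (H.skew_vert_right u) hh, H.energy_skew,
    Set.indicator_of_notMem hu, Set.indicator_of_notMem (by rwa [hXi]), sub_zero]
  · intro g hg hg'
    rcases hX with rfl | rfl
    · exact R.closed e g hg hg'
    · exact not_congr (R.closed e g hg hg')
  · rcases hX with rfl | rfl
    · exact fun h => h2 h.1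
    · exact fun h => h.2 h1

theorem skew_self_nonneg (u : V) : 0 ≤ ι.skew j u u := by
  have h1 := H.energy_skew u (ι.skew j u)
  rw [H.skew_vert_right] at h1
  have h2 : 0 ≤ G.energy L (ι.skew j u) (ι.skew j u) := Finset.sum_nonneg fun e _ =>
    div_nonneg (mul_self_nonneg _) (H.length_pos e).le
  linarith


/-- The three values of the antisymmetric Green function at the ends of an edge. -/
theorem skew_relations (e : E) :
    L e * ι.skew j (R.up e) (R.low e) = ι.skew j (R.up e) (R.up e) *
        ι.skew j (R.low e) (R.low e) - ι.skew j (R.up e) (R.low e) ^ 2 ∧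
      0 ≤ ι.skew j (R.up e) (R.low e) ∧
      ι.skew j (R.up e) (R.low e) ≤ ι.skew j (R.up e) (R.up e) ∧
      ι.skew j (R.up e) (R.low e) ≤ ι.skew j (R.low e) (R.low e) := by
  have hl := H.length_pos e
  have h1 := R.low_mem e
  have h2 := R.up_notMem e
  have h3 : R.low e ∉ (R.below e)ᶜ := fun h => h h1
  have hK := H.skew_vert_right
  -- The relations r1 to r4 express orthogonality on the side away from the source; r5 splits the
  -- mixed energy along the cut. Eliminating the mixed side energies gives the quadratic relation,
  -- and nonnegativity of the self-energies in r3 and r4 gives the inequalities. In network terms, p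
  -- and q are joined by a resistance L and grounded through resistances X and Y, so that c =
  -- XY/(X+Y+L).
  have r1 := H.side_relation e (Or.inr rfl) h3 (hK (R.up e))
  have r2 := H.side_relation e (Or.inl rfl) h2 (hK (R.low e))
  have r3 := H.side_relation e (Or.inr rfl) h3 (hK (R.low e))
  have r4 := H.side_relation e (Or.inl rfl) h2 (hK (R.up e))
  have r5 := H.energy_eq_side_add_side e (hK (R.up e)) (hK (R.low e))
  rw [H.energy_skew, hK] at r5
  rw [R.sideEnergy_comm, Set.indicator_of_notMem h3, Set.indicator_of_mem h2] at r1
  rw [Set.indicator_of_notMem h3, Set.indicator_of_mem h2] at r3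
  rw [Set.indicator_of_notMem h2, Set.indicator_of_mem h1] at r2 r4
  set p := R.up e
  set q := R.low e
  have n3 := H.sideEnergy_self_nonneg (R.below e)ᶜ (ι.skew j q)
  have n4 := H.sideEnergy_self_nonneg (R.below e) (ι.skew j p)
  have na := H.skew_self_nonneg p
  have nb := H.skew_self_nonneg q
  rw [H.skew_comm q p] at r1 r3 r5
  set a := ι.skew j p p
  set b := ι.skew j q q
  set c := ι.skew j p q
  have t1 : L e * c = a * b - c ^ 2 := by
    field_simp at r1 r2 r5
    linarith
  have t2 : 0 ≤ c * (b - c) := by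
    have : 0 ≤ (c * (b - c)) / L e := by
      have e3 : c * (b - c) / L e = (b - c) * c / L e := by ring
      rw [e3]
      have : (b - c) * (0 - c) / L e = - ((b - c) * c / L e) := by ring
      linarith
    rwa [le_div_iff₀ hl, zero_mul] at this
  have t3 : 0 ≤ c * (a - c) := by
    have : 0 ≤ (c * (a - c)) / L e := by
      have : (c - a) * (c - 0) / L e = - (c * (a - c) / L e) := by ring
      linarith
    rwa [le_div_iff₀ hl, zero_mul] at this
  have t4 : 0 ≤ c := by
    by_contra hc
    push Not at hc
    nlinarith
  refine ⟨t1, t4, ?_, ?_⟩ <;> rcases t4.eq_or_lt with h | h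
  · rw [← h]; exact na
  · nlinarith
  · rw [← h]; exact nb
  · nlinarith

/-- The effective resistance between the ends of an edge is less than its length. -/
theorem skew_lt_length [Finite V] (e : E) : ι.skew j (R.up e) (R.up e) + ι.skew j (R.low e) (R.low e)
    - 2 * ι.skew j (R.up e) (R.low e) < L e := by
  have hG := H.connected
  have hl := H.length_pos e
  set p := R.up e with hp
  set q := R.low e with hq
  set w : V → ℝ := fun v => ι.skew j p v - ι.skew j q v with hw
  have hwi : ∀ v, w (ι.vert v) = - w v := fun v => by
    simp only [hw, H.skew_vert_right]; ring
  have h0 : ∀ v, ι.vert v = v → w v = 0 := fun v hv => by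
    have := hwi v
    rw [hv] at this
    linarith
  have hE : G.energy L w w = 2 * (w p - w q) := by
    rw [show G.energy L w w = _ from energy_sub_left (ι.skew j p) (ι.skew j q) w,
      H.energy_skew, H.energy_skew, hwi, hwi]
    ring
  have hr : ι.skew j p p + ι.skew j q q - 2 * ι.skew j p q = w p - w q := by
    simp only [hw, H.skew_comm q p]; ring
  rw [hr]
  -- The total energy is 2(w p - w q), while the edge class alone carries 2(w p - w q)²/L. If w p -
  -- w q ≥ L, nothing is left for the two sides. Then `w` is constant on each of them, hence zero
  -- because each contains a fixed vertex.
  by_contra! hle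
  have hcut := H.energy_eq_side_add_side e hwi hwi
  have n1 := H.sideEnergy_self_nonneg (R.below e) w
  have n2 := H.sideEnergy_self_nonneg (R.below e)ᶜ w
  have h5 : w p - w q ≤ (w q - w p) * (w q - w p) / L e := by
    rw [le_div_iff₀ hl]; nlinarith
  rw [← hp, ← hq] at hcut
  have z1 : R.sideEnergy L (R.below e) w w = 0 := by linarith
  have z2 : R.sideEnergy L (R.below e)ᶜ w w = 0 := by linarith
  have hflat : ∀ g ∈ {g | ι.edgeClass g ≠ ι.edgeClass e}, w (R.up g) = w (R.low g) := by
    intro g hg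
    have hcl := (R.closed e g (by rintro rfl; exact hg rfl)
      (by rintro rfl; exact hg (edgeClass_edge e)))
    by_cases hb : R.low g ∈ R.below e
    · exact H.eq_of_sideEnergy_eq_zero z1 (hcl.2 hb) hb
    · exact H.eq_of_sideEnergy_eq_zero z2 (mt hcl.1 hb) hb
  have hjoin : ∀ {u v}, G.joinSetoid {g | ι.edgeClass g ≠ ι.edgeClass e} u v → w u = w v :=
    fun {u v} h => (mem_iff_of_joinSetoid (X := {x | w x = w v})
      (fun g hg => (R.closed_iff g).2 (by simp [hflat g hg])) h).2 rfl
  have hwp : w p = 0 := by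
    rw [hjoin (R.joined_root_of_notMem_below hG H.root (R.up_notMem e)), h0 o H.root]
  have hwq : w q = 0 := by
    obtain ⟨z, _, hz, hzj⟩ := R.exists_fixed_joined hG H.hyperelliptic.three_le e
    rw [hjoin (joinSetoid_mono (R.inner_subset e) hzj), h0 z hz]
  linarith

end IsMetrized

end Rooting

end Involution

end MultiGraph

/-! ### Current shares, Kirchhoff's law and the symmetric part of the Green function. -/

namespace MultiGraph

variable {V E : Type*} {G : MultiGraph V E} {L : E → ℝ}

namespace Involution

variable {ι : G.Involution}

namespace Rooting

variable [Fintype E] {o : V} {R : ι.Rooting o} {j : V → V → ℝ}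

/-- The share of an edge in the antisymmetric unit flow from its end `up`. -/
noncomputable def upShare (R : ι.Rooting o) (L : E → ℝ) (j : V → V → ℝ) (e : E) : ℝ :=
  (ι.skew j (R.up e) (R.up e) - ι.skew j (R.up e) (R.low e)) / L e

/-- The share of an edge in the antisymmetric unit flow from its end `low`. -/
noncomputable def lowShare (R : ι.Rooting o) (L : E → ℝ) (j : V → V → ℝ) (e : E) : ℝ :=
  (ι.skew j (R.low e) (R.low e) - ι.skew j (R.up e) (R.low e)) / L e

/-- The resistance of the quotient tree common to the paths from the root to `u` and `v`. -/
noncomputable def common (R : ι.Rooting o) (L : E → ℝ) (u v : V) : ℝ :=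
  (∑ e, L e * ((R.below e).indicator 1 u * (R.below e).indicator 1 v)) / 2

namespace IsMetrized

variable (H : R.IsMetrized L j)
include H

theorem upShare_nonneg (e : E) : 0 ≤ R.upShare L j e :=
  div_nonneg (sub_nonneg.2 (H.skew_relations e).2.2.1) (H.length_pos e).le

theorem lowShare_nonneg (e : E) : 0 ≤ R.lowShare L j e :=
  div_nonneg (sub_nonneg.2 (H.skew_relations e).2.2.2) (H.length_pos e).le

theorem upShare_mul (e : E) : R.upShare L j e * L e =
    ι.skew j (R.up e) (R.up e) - ι.skew j (R.up e) (R.low e) :=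
  div_mul_cancel₀ _ (H.length_pos e).ne'

theorem lowShare_mul (e : E) : R.lowShare L j e * L e =
    ι.skew j (R.low e) (R.low e) - ι.skew j (R.up e) (R.low e) :=
  div_mul_cancel₀ _ (H.length_pos e).ne'

theorem share_add_lt [Finite V] (e : E) : R.upShare L j e + R.lowShare L j e < 1 := by
  have := H.skew_lt_length e
  rw [upShare, lowShare, ← add_div, div_lt_one (H.length_pos e)]
  linarith

/-- In the network with ground resistances X, Y and S = X + Y + L, the shares are X/S and Y/S, and
the resistance from the upper end to the ground is X(L+Y)/S. -/
theorem skew_up (e : E) : (1 - R.upShare L j e - R.lowShare L j e) * ι.skew j (R.up e) (R.up e) =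
    R.upShare L j e * (1 - R.upShare L j e) * L e := by
  have h1 := (H.skew_relations e).1
  have hl := (H.length_pos e).ne'
  rw [upShare, lowShare]
  field_simp
  linear_combination h1

theorem skew_low (e : E) : (1 - R.upShare L j e - R.lowShare L j e) *
    ι.skew j (R.low e) (R.low e) = R.lowShare L j e * (1 - R.lowShare L j e) * L e := by
  have h1 := (H.skew_relations e).1
  have hl := (H.length_pos e).ne'
  rw [upShare, lowShare]
  field_simp
  linear_combination h1

theorem length_mul_share_sub (e : E) : L e * (R.upShare L j e - R.lowShare L j e) =
    ι.skew j (R.up e) (R.up e) - ι.skew j (R.low e) (R.low e) := by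
  have h1 := H.upShare_mul e
  have h2 := H.lowShare_mul e
  linarith

theorem exists_low_eq {v : V} (hv : ι.vert v ≠ v) : ∃ e, R.low e = v := by
  refine R.exists_low_eq H.connected ?_ ?_
  · rintro rfl; exact hv H.root
  · intro h
    refine hv ?_
    rw [h, ← H.root, ← h, ι.vert_vert]

/-- Every non-fixed vertex is the lower end of exactly one edge. -/
theorem sum_eq_sum_low [Fintype V] {F : V → ℝ} (hF : ∀ v, ι.vert v = v → F v = 0) :
    ∑ v, F v = ∑ e, F (R.low e) := by
  classical
  have : ∀ v, F v = ∑ e, if R.low e = v then F v else 0 := fun v => by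
    by_cases hv : ι.vert v = v
    · simp [hF v hv]
    · obtain ⟨e, rfl⟩ := H.exists_low_eq hv
      rw [Finset.sum_eq_single_of_mem e (Finset.mem_univ e), if_pos rfl]
      intro f _ hf
      exact if_neg fun h => hf (R.eq_of_low_eq H.connected h.symm hv).symm
  rw [Finset.sum_congr rfl fun v _ => this v, Finset.sum_comm]
  simp

/-- Regroups by vertices a sum over upper ends. Non-fixed vertices being lower ends of unique edges,
this lets upper and lower contributions be compared edge by edge. -/
theorem sum_up [Fintype V] [DecidableEq V] {F : V → ℝ} (hF : ∀ v, ι.vert v = v → F v = 0)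
    (x : E → ℝ) : ∑ e, x e * F (R.up e) = ∑ e, (∑ f with R.up f = R.low e, x f) * F (R.low e) := by
  rw [← H.sum_eq_sum_low (F := fun v => (∑ f with R.up f = v, x f) * F v)
    (fun v hv => by simp [hF v hv])]
  simp only [Finset.sum_mul, Finset.sum_filter]
  rw [Finset.sum_comm]
  refine Finset.sum_congr rfl fun e _ => ?_
  simp

/-- Kirchhoff's law at a non-fixed vertex: the antisymmetric unit flow from that vertex is tested
against its indicator function. -/
theorem share_sum [DecidableEq V] {e : E} (hv : ι.vert (R.low e) ≠ R.low e) :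
    R.lowShare L j e + ∑ f with R.up f = R.low e, R.upShare L j f = 1 := by
  have h1 := H.energy_skew (R.low e) (Pi.single (R.low e) 1)
  rw [Pi.single_eq_same, Pi.single_eq_of_ne hv, sub_zero, R.energy_eq_sum] at h1
  rw [← h1, Finset.sum_filter]
  have h2 : R.lowShare L j e = ∑ f, if R.low f = R.low e then R.lowShare L j f else 0 := by
    rw [Finset.sum_eq_single_of_mem e (Finset.mem_univ e), if_pos rfl]
    intro f _ hf
    exact if_neg fun h => hf (R.eq_of_low_eq H.connected h.symm hv).symm
  rw [h2, ← Finset.sum_add_distrib]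
  refine Finset.sum_congr rfl fun f _ => ?_
  simp only [Pi.single_apply, upShare, lowShare]
  by_cases ha : R.low f = R.low e
  · have hb : R.up f ≠ R.low e := fun hb => R.up_ne_low f (hb.trans ha.symm)
    rw [if_pos ha, if_neg hb, if_pos ha, if_neg hb, ← ha, H.skew_comm (R.low f) (R.up f)]
    ring
  · rw [if_neg ha, if_neg ha]
    by_cases hb : R.up f = R.low e
    · rw [if_pos hb, if_pos hb, ← hb]
      ring
    · rw [if_neg hb, if_neg hb]
      ring

/-! ### The symmetric part of the Green function -/

/-- Testing `j u` against the indicator of `below e` leaves only `e` and its conjugate in the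
energy. -/
theorem symmetric_low_sub_up (u : V) (e : E) :
    (j u (R.low e) + j (ι.vert u) (R.low e)) - (j u (R.up e) + j (ι.vert u) (R.up e)) =
      L e * (R.below e).indicator 1 u := by
  have h1 := R.low_mem e
  have h2 := R.up_notMem e
  have hl := (H.length_pos e).ne'
  have h := H.green.energy_eq u ((R.below e).indicator 1)
  rw [Set.indicator_of_notMem (R.root_notMem e), sub_zero, R.energy_eq_sum, H.sum_pair e] at h
  · rw [← h, R.up_edge H.connected, R.low_edge H.connected, H.length_edge, H.green_vert,
      H.green_vert]
    simp only [Set.indicator, R.vert_mem, h1, h2, if_true, if_false, Pi.one_apply]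
    field_simp
    ring
  · intro g hg hg'
    have := R.closed e g hg hg'
    by_cases hlow : R.low g ∈ R.below e
    · have hup := this.2 hlow
      simp [Set.indicator, hlow, hup]
    · have hup := mt this.1 hlow
      simp [Set.indicator, hlow, hup]

theorem common_low_sub_up (u : V) (e : E) : R.common L u (R.low e) - R.common L u (R.up e) =
    L e * (R.below e).indicator 1 u := by
  rw [common, common, ← sub_div, ← Finset.sum_sub_distrib, H.sum_pair e]
  · have h1 := R.low_mem e
    have h2 := R.up_notMem e
    rw [R.below_edge H.connected, H.length_edge, Set.indicator_of_mem h1,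
      Set.indicator_of_notMem h2, Pi.one_apply]
    ring
  · intro g hg hg'
    have := R.closed g e hg.symm (fun h => hg' (by rw [h, ι.edge_edge]))
    by_cases hlow : R.low e ∈ R.below g
    · rw [Set.indicator_of_mem hlow, Set.indicator_of_mem (this.2 hlow), sub_eq_zero]
      rfl
    · rw [Set.indicator_of_notMem hlow, Set.indicator_of_notMem (mt this.1 hlow), sub_self]

/-- Both sides vanish at the root and have the same increment along every edge. -/
theorem symmetric_eq_common (u v : V) : j u v + j (ι.vert u) v = R.common L u v := by
  have := R.mem_of_closed H.connected
    (X := {v | j u v + j (ι.vert u) v - R.common L u v = 0}) (fun e => ?_) (u := o) ?_ v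
  · exact sub_eq_zero.1 this
  · have h1 := H.symmetric_low_sub_up u e
    have h2 := H.common_low_sub_up u e
    simp only [Set.mem_ofPred_eq]
    constructor <;> intro h <;> linarith
  · simp [common, Set.indicator_of_notMem, R.root_notMem, H.green.base']

end IsMetrized

end Rooting

end Involution

end MultiGraph

/-! ### The admissible constant in terms of masses and shares. -/

namespace MultiGraph

variable {V E : Type*} {G : MultiGraph V E} {L : E → ℝ}

namespace Involution

variable {ι : G.Involution}

namespace Rooting

variable {o : V} {R : ι.Rooting o} {j : V → V → ℝ}

theorem mass_eq_sum [Fintype V] (R : ι.Rooting o) (D : V → ℝ) (e : E) :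
    R.mass D e = ∑ v, D v * (R.below e).indicator 1 v := by
  refine Finset.sum_congr rfl fun v _ => ?_
  by_cases hv : v ∈ R.below e <;> simp [hv]

variable [Fintype E]

theorem common_comm (R : ι.Rooting o) (u v : V) : R.common L u v = R.common L v u := by
  simp only [common]
  congr 1
  exact Finset.sum_congr rfl fun e _ => by rw [mul_comm ((R.below e).indicator 1 u)]

namespace IsMetrized

variable (H : R.IsMetrized L j)
include H

theorem green_eq (u v : V) : j u v = (R.common L u v + ι.skew j u v) / 2 := by
  rw [← H.symmetric_eq_common, skew]
  ring

theorem defect_eq (e : E) :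
    G.defect L j e = -((1 - R.upShare L j e - R.lowShare L j e) * L e) / 2 := by
  have h0 : G.defect L j e = j (R.low e) (R.low e) - 2 * j (R.up e) (R.low e) +
      j (R.up e) (R.up e) - L e := by
    rcases R.ends e with ⟨h1, h2⟩ | ⟨h1, h2⟩ <;> rw [defect, h1, h2]
    rw [H.green.symm (R.low e) (R.up e)]
    ring
  have h1 := H.common_low_sub_up (R.low e) e
  have h2 := H.common_low_sub_up (R.up e) e
  rw [Set.indicator_of_mem (R.low_mem e), R.common_comm (R.low e) (R.up e)] at h1
  rw [Set.indicator_of_notMem (R.up_notMem e)] at h2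
  have h3 := H.upShare_mul e
  have h4 := H.lowShare_mul e
  rw [h0, H.green_eq, H.green_eq (R.up e) (R.low e), H.green_eq (R.up e) (R.up e)]
  simp only [Pi.one_apply] at h1
  linear_combination h1 / 2 - h2 / 2 - h3 / 2 - h4 / 2

theorem green_low_sub_up (e : E) : j (R.low e) (R.low e) - j (R.up e) (R.up e) =
    (1 - (R.upShare L j e - R.lowShare L j e)) * L e / 2 := by
  have h1 := H.common_low_sub_up (R.low e) e
  have h2 := H.common_low_sub_up (R.up e) e
  rw [Set.indicator_of_mem (R.low_mem e), R.common_comm (R.low e) (R.up e)] at h1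
  rw [Set.indicator_of_notMem (R.up_notMem e)] at h2
  have h3 := H.upShare_mul e
  have h4 := H.lowShare_mul e
  rw [H.green_eq, H.green_eq (R.up e) (R.up e)]
  simp only [Pi.one_apply] at h1
  linear_combination h1 / 2 + h2 / 2 + h3 / 2 - h4 / 2

theorem diagEnergy_eq : G.diagEnergy L j = ∑ e, L e *
    ((1 - (R.upShare L j e - R.lowShare L j e)) ^ 2 / 4 +
      (1 - R.upShare L j e - R.lowShare L j e) ^ 2 / 12) := by
  refine Finset.sum_congr rfl fun e _ => ?_
  have h0 : (j (G.tgt e) (G.tgt e) - j (G.src e) (G.src e)) ^ 2 =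
      (j (R.low e) (R.low e) - j (R.up e) (R.up e)) ^ 2 := by
    rcases R.ends e with ⟨h1, h2⟩ | ⟨h1, h2⟩ <;> rw [h1, h2]
    ring
  have hl := (H.length_pos e).ne'
  rw [h0, H.defect_eq, H.green_low_sub_up]
  field_simp
  ring

variable [Fintype V] {D : V → ℝ}

theorem diagSum_eq : diagSum j D =
    (∑ e, L e * R.mass D e) / 4 + (∑ v, D v * ι.skew j v v) / 2 := by
  have h1 : ∑ v, D v * R.common L v v = (∑ e, L e * R.mass D e) / 2 := by
    simp only [common, R.mass_eq_sum, Finset.mul_sum, Finset.sum_div]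
    rw [Finset.sum_comm]
    refine Finset.sum_congr rfl fun e _ => Finset.sum_congr rfl fun v _ => ?_
    by_cases hv : v ∈ R.below e <;> simp [hv]
    ring
  have h2 : ∀ v, D v * j v v = (D v * R.common L v v + D v * ι.skew j v v) / 2 := fun v => by
    rw [H.green_eq]; ring
  rw [diagSum, Finset.sum_congr rfl fun v _ => h2 v, ← Finset.sum_div, Finset.sum_add_distrib, h1]
  ring

/-- Since D is ι-invariant, the antisymmetric part of `j` cancels on averaging over ι, and the
common paths produce squares of masses. -/
theorem pairSum_eq (hD : ∀ v, D (ι.vert v) = D v) :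
    pairSum j D = (∑ e, L e * R.mass D e ^ 2) / 4 := by
  have h1 : pairSum j D = ∑ u, ∑ v, D u * D v * j (ι.vert u) v :=
    Fintype.sum_equiv ι.vertEquiv _ _ fun u => Finset.sum_congr rfl fun v _ => by
      simp only [vertEquiv, Equiv.coe_fn_mk, hD, ι.vert_vert]
  have h2 : ∑ u, ∑ v, D u * D v * R.common L u v = (∑ e, L e * R.mass D e ^ 2) / 2 := by
    simp only [common, R.mass_eq_sum, Finset.mul_sum, Finset.sum_div, sq, Finset.sum_mul]
    conv_lhs => enter [2, u]; rw [Finset.sum_comm]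
    rw [Finset.sum_comm]
    refine Finset.sum_congr rfl fun e _ => ?_
    rw [Finset.sum_comm]
    refine Finset.sum_congr rfl fun u _ => Finset.sum_congr rfl fun v _ => ?_
    ring
  have h3 : pairSum j D + pairSum j D = ∑ u, ∑ v, D u * D v * R.common L u v := by
    nth_rewrite 2 [h1]
    simp only [pairSum, ← Finset.sum_add_distrib]
    refine Finset.sum_congr rfl fun u _ => Finset.sum_congr rfl fun v _ => ?_
    rw [← H.symmetric_eq_common]
    ring
  linarith

variable [DecidableEq V] (hD : ∀ e, ι.vert (R.low e) ≠ R.low e →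
    D (R.low e) = (Finset.univ.filter fun f => R.up f = R.low e).card - 1)
include hD

theorem sum_mul_skew : ∑ v, D v * ι.skew j v v =
    ∑ e, ((Finset.univ.filter fun f => R.up f = R.low e).card - 1 : ℝ) *
      ι.skew j (R.low e) (R.low e) := by
  rw [H.sum_eq_sum_low fun v hv => by rw [H.skew_eq_zero hv, mul_zero]]
  refine Finset.sum_congr rfl fun e _ => ?_
  by_cases hv : ι.vert (R.low e) = R.low e
  · rw [H.skew_eq_zero hv, mul_zero, mul_zero]
  · rw [hD e hv]

theorem sum_mul_skew_eq_sum_length_mul : ∑ v, D v * ι.skew j v v =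
    ∑ e, L e * (R.upShare L j e - R.lowShare L j e) := by
  have h1 := H.sum_up (F := fun v => ι.skew j v v) (fun v hv => H.skew_eq_zero hv v) (fun _ => 1)
  simp only [one_mul, Finset.sum_const, nsmul_eq_mul, mul_one] at h1
  rw [H.sum_mul_skew hD, Finset.sum_congr rfl fun e _ => H.length_mul_share_sub e,
    Finset.sum_sub_distrib, h1, ← Finset.sum_sub_distrib]
  exact Finset.sum_congr rfl fun e _ => by ring

/-- The upper and lower ends are weighted by 1 - 2a and 1 - 2b. At a non-fixed vertex with n edges
leaving downwards the shares add up to 1, so the weights add up to n + 1 - 2 = n - 1, the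
coefficient of D. -/
theorem sum_mul_skew_eq_sum_length_mul_sq : ∑ v, D v * ι.skew j v v =
    ∑ e, L e * (1 / 2 - 3 / 2 * (R.upShare L j e - R.lowShare L j e) ^ 2 -
      (1 - R.upShare L j e - R.lowShare L j e) ^ 2 / 2) := by
  have h1 := H.sum_up (F := fun v => ι.skew j v v) (fun v hv => H.skew_eq_zero hv v)
    (fun e => 1 - 2 * R.upShare L j e)
  have h2 : ∀ e, L e * (1 / 2 - 3 / 2 * (R.upShare L j e - R.lowShare L j e) ^ 2 -
      (1 - R.upShare L j e - R.lowShare L j e) ^ 2 / 2) =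
      (1 - 2 * R.upShare L j e) * ι.skew j (R.up e) (R.up e) +
        (1 - 2 * R.lowShare L j e) * ι.skew j (R.low e) (R.low e) := fun e => by
    have ha := H.skew_up e
    have hb := H.skew_low e
    have hlam : 1 - R.upShare L j e - R.lowShare L j e ≠ 0 := by
      have := H.share_add_lt e
      intro h
      linarith
    refine mul_left_cancel₀ hlam ?_
    linear_combination (-(1 - 2 * R.upShare L j e)) * ha - (1 - 2 * R.lowShare L j e) * hb
  rw [Finset.sum_congr rfl fun e _ => h2 e, Finset.sum_add_distrib, h1, ← Finset.sum_add_distrib,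
    H.sum_mul_skew hD]
  refine Finset.sum_congr rfl fun e _ => ?_
  by_cases hv : ι.vert (R.low e) = R.low e
  · simp only [H.skew_eq_zero hv]; ring
  · have h3 := H.share_sum hv
    rw [Finset.sum_sub_distrib, ← Finset.mul_sum, Finset.sum_const, nsmul_eq_mul]
    linear_combination (2 * ι.skew j (R.low e) (R.low e)) * h3

/-- The admissible constant of a hyperelliptic graph. -/
theorem admissibleConstant_eq (hDi : ∀ v, D (ι.vert v) = D v) (hd : divDeg D + 2 ≠ 0) :
    G.admissibleConstant L D = (∑ e, L e * (R.mass D e * (divDeg D - R.mass D e) / 2 + divDeg D *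
      (1 / 2 - (1 - R.upShare L j e - R.lowShare L j e) ^ 2 / 6 -
        (R.upShare L j e - R.lowShare L j e) ^ 2 / 2))) / (divDeg D + 2) := by
  rw [H.green.admissibleConstant_eq H.length_pos D hd, H.diagSum_eq, H.pairSum_eq hDi,
    H.diagEnergy_eq]
  congr 1
  have h1 := H.sum_mul_skew_eq_sum_length_mul hD
  have h2 := H.sum_mul_skew_eq_sum_length_mul_sq hD
  -- Averaging the two evaluations makes the term linear in a - b cancel against the one coming from
  -- the energy of the diagonal.
  have h3 : ∑ v, D v * ι.skew j v v = ∑ e, L e * ((R.upShare L j e - R.lowShare L j e) / 2 +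
      (1 / 2 - 3 / 2 * (R.upShare L j e - R.lowShare L j e) ^ 2 -
      (1 - R.upShare L j e - R.lowShare L j e) ^ 2 / 2) / 2) := by
    have : ∑ v, D v * ι.skew j v v = (∑ v, D v * ι.skew j v v) / 2 +
      (∑ v, D v * ι.skew j v v) / 2 := by ring
    rw [this]
    nth_rewrite 1 [h1]
    rw [h2, Finset.sum_div, Finset.sum_div, ← Finset.sum_add_distrib]
    exact Finset.sum_congr rfl fun e _ => by ring
  rw [h3]
  simp only [Finset.mul_sum, Finset.sum_div, mul_add, ← Finset.sum_add_distrib,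
    ← Finset.sum_sub_distrib]
  exact Finset.sum_congr rfl fun e _ => by ring

end IsMetrized

end Rooting

end Involution

end MultiGraph

/-! ### A family of cubic inequalities on the simplex -/

section Cubic

/-- Ingredients for certificates: variables times squares, and monomials, all nonnegative on the
orthant. The five parameters are free, to be adapted to each cubic. -/
theorem cubic_terms_nonneg {a b t : ℝ} (ha : 0 ≤ a) (hb : 0 ≤ b) (ht : 0 ≤ t)
    (u v r s m : ℝ) : 0 ≤ a * (b - u * t) ^ 2 ∧ 0 ≤ b * (a - v * t) ^ 2 ∧
      0 ≤ t * (t - r * a - s * b) ^ 2 ∧ 0 ≤ t * (a - m * b) ^ 2 ∧ 0 ≤ t * b * b ∧ 0 ≤ t * b * a ∧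
      0 ≤ t * a * a ∧ 0 ≤ t * t * b ∧ 0 ≤ t * t * t := by
  refine ⟨?_, ?_, ?_, ?_, ?_, ?_, ?_, ?_, ?_⟩ <;> positivity

/-- The difference between the two sides of the local inequality for an edge with shares `a` and `b`
(and `t = 1 - a - b`), in homogeneous form. -/
noncomputable def localForm (z c C a b t : ℝ) : ℝ :=
  t * (t ^ 2 / 3 + (a - b) ^ 2 - z * (a + b + t) ^ 2) + C * (b * (a + t) * (a + b + t)) -
    c * (a * (b + t) * (a + b + t))

variable {a b t : ℝ}

/-- In each of the five cases, c is the value of `upWeight` in one range of masses, and C is the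
lower bound available there for the total `upWeight` of the edges below. Since the form equals (C -
c)ab(a + b) at t = 0, each case needs c ≤ C; the values leave strict room. -/
theorem localForm_nonneg_of_neg (ha : 0 ≤ a) (hb : 0 ≤ b) (ht : 0 ≤ t) :
    0 ≤ localForm 0 (1 / 2) (3 / 5) a b t := by
  obtain ⟨h1, h2, h3, h4, h5, h6, h7, h8, h9⟩ :=
    cubic_terms_nonneg ha hb ht (1 / 2) 2 (79 / 100) 0 (221 / 100)
  rw [localForm]
  nlinarith

theorem localForm_nonneg_of_zero (ha : 0 ≤ a) (hb : 0 ≤ b) (ht : 0 ≤ t) :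
    0 ≤ localForm (1 / 6) (1 / 5) (3 / 5) a b t := by
  obtain ⟨h1, h2, h3, h4, h5, h6, h7, h8, h9⟩ :=
    cubic_terms_nonneg ha hb ht (1 / 5) (4 / 5) (166 / 100) 0 (203 / 100)
  rw [localForm]
  nlinarith

theorem localForm_nonneg_of_between (ha : 0 ≤ a) (hb : 0 ≤ b) (ht : 0 ≤ t) :
    0 ≤ localForm 0 (1 / 5) (2 / 5) a b t := by
  obtain ⟨h1, h2, h3, h4, h5, h6, h7, h8, h9⟩ :=
    cubic_terms_nonneg ha hb ht (3 / 5) (8 / 5) (41 / 100) (17 / 100) (51 / 100)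
  rw [localForm]
  nlinarith

theorem localForm_nonneg_of_deg (ha : 0 ≤ a) (hb : 0 ≤ b) (ht : 0 ≤ t) :
    0 ≤ localForm (1 / 6) (1 / 10) (2 / 5) a b t := by
  obtain ⟨h1, h2, h3, h4, h5, h6, h7, h8, h9⟩ :=
    cubic_terms_nonneg ha hb ht (3 / 10) (7 / 10) (139 / 100) (1 / 4) (3 / 2)
  rw [localForm]
  nlinarith

theorem localForm_nonneg_of_deg_lt (ha : 0 ≤ a) (hb : 0 ≤ b) (ht : 0 ≤ t) :
    0 ≤ localForm 0 (1 / 10) (1 / 5) a b t := by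
  obtain ⟨h1, h2, h3, h4, h5, h6, h7, h8, h9⟩ :=
    cubic_terms_nonneg ha hb ht (6 / 5) (17 / 10) (37 / 100) (14 / 100) (73 / 100)
  rw [localForm]
  nlinarith

end Cubic

/-! ### Distribution of the weights over the tree and telescoping. -/

namespace MultiGraph

variable {V E : Type*} {G : MultiGraph V E} {L : E → ℝ}

namespace Involution

variable {ι : G.Involution}

namespace Rooting

variable {o : V} {R : ι.Rooting o} {j : V → V → ℝ}

/-- The weight with which an edge of mass `M` draws on its upper end. -/
noncomputable def upWeight (d M : ℝ) : ℝ := if M < 0 then 1 / 2 else if M < d then 1 / 5 else 1 / 10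

theorem upWeight_ge (d M : ℝ) : 1 / 10 ≤ upWeight d M := by
  unfold upWeight
  split_ifs <;> norm_num

namespace IsMetrized

variable [Fintype E] (H : R.IsMetrized L j)
include H

/-- After multiplication by t = 1 - a - b > 0, the resistances become a(1-a)L and b(1-b)L, with 1 -
a = b + t and 1 - b = a + t; what remains is L times `localForm`. -/
theorem local_bound [Finite V] {z c C : ℝ} {e : E} (h : 0 ≤ localForm z c C (R.upShare L j e)
    (R.lowShare L j e) (1 - R.upShare L j e - R.lowShare L j e)) :
    c * ι.skew j (R.up e) (R.up e) - C * ι.skew j (R.low e) (R.low e) ≤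
      L e * ((1 - R.upShare L j e - R.lowShare L j e) ^ 2 / 3 +
        (R.upShare L j e - R.lowShare L j e) ^ 2 - z) := by
  have h1 := H.skew_up e
  have h2 := H.skew_low e
  have h3 := H.share_add_lt e
  have h4 := H.length_pos e
  refine le_of_mul_le_mul_left ?_ (show 0 < 1 - R.upShare L j e - R.lowShare L j e by linarith)
  have h5 := mul_nonneg h4.le h
  rw [localForm] at h5
  have h6 : R.upShare L j e + R.lowShare L j e + (1 - R.upShare L j e - R.lowShare L j e) = 1 := by
    ring
  rw [h6] at h5
  linear_combination h5 + c * h1 - C * h2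

variable [Fintype V] [DecidableEq V] {D : V → ℝ} (hDi : ∀ v, D (ι.vert v) = D v)
  (hD : ∀ e, ι.vert (R.low e) ≠ R.low e →
    D (R.low e) = (Finset.univ.filter fun f => R.up f = R.low e).card - 1)
include hDi hD

/-- The total upper weight of the edges below a non-fixed vertex. -/
theorem sum_upWeight_ge {e : E} (hv : ι.vert (R.low e) ≠ R.low e) (d : ℝ) :
    (R.mass D e ≤ 0 → 3 / 5 ≤ ∑ f with R.up f = R.low e, upWeight d (R.mass D f)) ∧
    (R.mass D e ≤ d → 2 / 5 ≤ ∑ f with R.up f = R.low e, upWeight d (R.mass D f)) ∧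
    1 / 5 ≤ ∑ f with R.up f = R.low e, upWeight d (R.mass D f) := by
  classical
  have hmass := R.mass_eq H.connected hDi hv
  have hcard := H.hyperelliptic.three_le _ hv
  rw [R.ncard_ends H.connected hv] at hcard
  rw [hD e hv] at hmass
  set s := Finset.univ.filter fun f => R.up f = R.low e with hs
  have hn : (2 : ℝ) ≤ s.card := by
    have : 2 ≤ s.card := by omega
    exact_mod_cast this
  have hconst : ∀ x : ℝ, ∑ f ∈ s, x = s.card * x := fun x => by
    rw [Finset.sum_const, nsmul_eq_mul]
  -- One child of negative mass weighs 1/2 and there is at least one other, of weight at least 1/10;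
  -- together these give 3/5.
  have hneg : (∃ f ∈ s, R.mass D f < 0) → 3 / 5 ≤ ∑ f ∈ s, upWeight d (R.mass D f) := by
    rintro ⟨f, hf, hfneg⟩
    have h1 : ∑ g ∈ s, (if g = f then (2 / 5 : ℝ) else 0) = 2 / 5 := by
      rw [Finset.sum_ite_eq' s f, if_pos hf]
    have h2 : ∑ g ∈ s, ((1 / 10 : ℝ) + if g = f then (2 / 5 : ℝ) else 0) ≤
        ∑ f ∈ s, upWeight d (R.mass D f) := by
      refine Finset.sum_le_sum fun g _ => ?_
      split_ifs with hg
      · rw [hg, upWeight, if_pos hfneg]; norm_num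
      · have := upWeight_ge d (R.mass D g); linarith
    rw [Finset.sum_add_distrib, h1, hconst] at h2
    linarith
  -- With n children, M = 2(n - 1) plus the masses of the children, and n ≥ 2, so M ≤ 0 forces a
  -- child of negative mass.
  refine ⟨fun hM => hneg ?_, fun hM => ?_, ?_⟩
  · by_contra! hc
    have := Finset.sum_nonneg hc
    linarith
  · by_cases hex : ∃ f ∈ s, R.mass D f < 0
    · have := hneg hex
      linarith
    · push Not at hex
      have h2 : ∑ g ∈ s, (1 / 5 : ℝ) ≤ ∑ f ∈ s, upWeight d (R.mass D f) := by
        refine Finset.sum_le_sum fun g hg => ?_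
        -- If no child is negative, each child has mass at most M - 2(n - 1), which is less than d,
        -- and so has weight 1/5.
        have h3 := Finset.single_le_sum hex hg
        rw [upWeight, if_neg (not_lt.2 (hex g hg)), if_pos (by linarith)]
      rw [hconst] at h2
      linarith
  · have h2 := Finset.sum_le_sum fun g (_ : g ∈ s) => upWeight_ge d (R.mass D g)
    rw [hconst] at h2
    linarith

/-- Each summand dominates `upWeight` of the edge times the resistance at its upper end, minus the
children's total weight times the resistance at its lower end; these differences sum to zero by
`sum_up`. -/
theorem sum_length_mul_nonneg {d : ℝ} (hd : 0 < d) {z : E → ℝ}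
    (hz : ∀ e, z e = 1 / 6 ∧ (R.mass D e = 0 ∨ R.mass D e = d) ∨ z e = 0) :
    0 ≤ ∑ e, L e * ((1 - R.upShare L j e - R.lowShare L j e) ^ 2 / 3 +
        (R.upShare L j e - R.lowShare L j e) ^ 2 - z e) := by
  have hT := H.sum_up (F := fun v => ι.skew j v v) (fun v hv => H.skew_eq_zero hv v)
    (fun e => upWeight d (R.mass D e))
  have h0 : 0 = ∑ e, (upWeight d (R.mass D e) * ι.skew j (R.up e) (R.up e) -
      (∑ f with R.up f = R.low e, upWeight d (R.mass D f)) * ι.skew j (R.low e) (R.low e)) := by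
    rw [Finset.sum_sub_distrib, hT, sub_self]
  rw [h0]
  refine Finset.sum_le_sum fun e _ => ?_
  have ha := H.upShare_nonneg e
  have hb := H.lowShare_nonneg e
  have ht : 0 ≤ 1 - R.upShare L j e - R.lowShare L j e := by
    have := H.share_add_lt e
    linarith
  have hρ := H.skew_self_nonneg (R.low e)
  have key : ∀ C : ℝ, (ι.vert (R.low e) ≠ R.low e →
      C ≤ ∑ f with R.up f = R.low e, upWeight d (R.mass D f)) →
      C * ι.skew j (R.low e) (R.low e) ≤
      (∑ f with R.up f = R.low e, upWeight d (R.mass D f)) * ι.skew j (R.low e) (R.low e) :=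
    fun C hC => by
      by_cases hv : ι.vert (R.low e) = R.low e
      · rw [H.skew_eq_zero hv, mul_zero, mul_zero]
      · exact mul_le_mul_of_nonneg_right (hC hv) hρ
  have hz0 : z e ≤ 0 ∨ z e = 1 / 6 ∧ (R.mass D e = 0 ∨ R.mass D e = d) := by
    rcases hz e with h | h
    · exact Or.inr h
    · exact Or.inl h.le
  have hmono : ∀ {z' : ℝ}, z e ≤ z' → L e * ((1 - R.upShare L j e - R.lowShare L j e) ^ 2 / 3 +
      (R.upShare L j e - R.lowShare L j e) ^ 2 - z') ≤
      L e * ((1 - R.upShare L j e - R.lowShare L j e) ^ 2 / 3 +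
      (R.upShare L j e - R.lowShare L j e) ^ 2 - z e) := fun h =>
    mul_le_mul_of_nonneg_left (by linarith) (H.length_pos e).le
  have hz6 : z e ≤ 1 / 6 := by
    rcases hz0 with h | h
    · linarith
    · exact h.1.le
  -- Five ranges of the mass, one for each cubic; the value z = 1/6 is possible only at mass 0 or d.
  rcases lt_trichotomy (R.mass D e) 0 with hM | hM | hM
  · have h1 := H.local_bound (localForm_nonneg_of_neg ha hb ht)
    have h2 := key _ fun hv => (H.sum_upWeight_ge hDi hD hv d).1 hM.le
    have h3 := hmono (z' := 0) (hz0.resolve_right (by rintro ⟨_, h | h⟩ <;> linarith))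
    rw [upWeight, if_pos hM]
    linarith
  · have h1 := H.local_bound (localForm_nonneg_of_zero ha hb ht)
    have h2 := key _ fun hv => (H.sum_upWeight_ge hDi hD hv d).1 hM.le
    have h3 := hmono hz6
    rw [upWeight, if_neg hM.not_lt, if_pos (by linarith)]
    linarith
  rcases lt_trichotomy (R.mass D e) d with hMd | hMd | hMd
  · have h1 := H.local_bound (localForm_nonneg_of_between ha hb ht)
    have h2 := key _ fun hv => (H.sum_upWeight_ge hDi hD hv d).2.1 hMd.le
    have h3 := hmono (z' := 0) (hz0.resolve_right (by rintro ⟨_, h | h⟩ <;> linarith))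
    rw [upWeight, if_neg hM.not_gt, if_pos hMd]
    linarith
  · have h1 := H.local_bound (localForm_nonneg_of_deg ha hb ht)
    have h2 := key _ fun hv => (H.sum_upWeight_ge hDi hD hv d).2.1 hMd.le
    have h3 := hmono hz6
    rw [upWeight, if_neg hM.not_gt, if_neg hMd.not_lt]
    linarith
  · have h1 := H.local_bound (localForm_nonneg_of_deg_lt ha hb ht)
    have h2 := key _ fun hv => (H.sum_upWeight_ge hDi hD hv d).2.2
    have h3 := hmono (z' := 0) (hz0.resolve_right (by rintro ⟨_, h | h⟩ <;> linarith))
    rw [upWeight, if_neg hM.not_gt, if_neg hMd.not_gt]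
    linarith

end IsMetrized

end Rooting

end Involution

end MultiGraph

/-! ### From the edge inequality to sums over edge classes. -/

namespace MultiGraph

variable {V E : Type*} {G : MultiGraph V E} {L : E → ℝ}

namespace Involution

variable {ι : G.Involution}

/-- Every class of edges consists of two edges. -/
theorem sum_edgeClass [Fintype E] (hι : ∀ e, ι.edge e ≠ e) (F : ι.EdgeClass → ℝ) :
    ∑ e, F (ι.edgeClass e) = 2 * ∑ ē, F ē := by
  classical
  rw [← Finset.sum_fiberwise (s := Finset.univ) (g := ι.edgeClass), Finset.mul_sum]
  refine Finset.sum_congr rfl fun ē _ => ?_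
  obtain ⟨e, rfl⟩ : ∃ e, ι.edgeClass e = ē := Quotient.exists_rep ē
  have : (Finset.univ.filter fun f => ι.edgeClass f = ι.edgeClass e) = {e, ι.edge e} := by
    ext f
    simp [edgeClass_eq_iff]
  rw [this, Finset.sum_pair (hι e).symm, edgeClass_edge]
  ring

namespace Rooting.IsMetrized

variable [Fintype V] [Fintype E] {o : V} {R : ι.Rooting o} {j : V → V → ℝ} (H : R.IsMetrized L j)
include H

/-- The bound for the admissible constant, as a sum over all edges. -/
theorem admissibleConstant_le [DecidableEq V] {D : V → ℝ} (hDi : ∀ v, D (ι.vert v) = D v)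
    (hD : ∀ e, ι.vert (R.low e) ≠ R.low e →
      D (R.low e) = (Finset.univ.filter fun f => R.up f = R.low e).card - 1)
    (hdeg : divDeg D < -2 ∨ 0 ≤ divDeg D) : G.admissibleConstant L D ≤
      ∑ e, L e * ((if ι.w D (ι.edgeClass e) ≠ 0 then divDeg D / (divDeg D + 2) +
          ι.w D (ι.edgeClass e) * (divDeg D - ι.w D (ι.edgeClass e)) / (divDeg D + 2)
        else 5 / 6 * (divDeg D / (divDeg D + 2))) / 2) := by
  have hw := R.w_eq H.connected H.root H.hyperelliptic.three_le D
  set d := divDeg D with hd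
  have hd2 : d + 2 ≠ 0 := by rcases hdeg with h | h <;> linarith
  rw [H.admissibleConstant_eq hD hDi hd2, ← hd, Finset.sum_div]
  -- An edge with w ≠ 0 is allowed d/2, one with w = 0 only 5d/12 = (1 - 1/6)d/2, each class having
  -- two edges; z records this saving.
  set z : E → ℝ := fun e => if ι.w D (ι.edgeClass e) ≠ 0 then 0 else 1 / 6 with hz
  have hprod : ∀ e, ι.w D (ι.edgeClass e) * (d - ι.w D (ι.edgeClass e)) =
      R.mass D e * (d - R.mass D e) := fun e => by
    rw [hw]
    rcases min_choice (R.mass D e) (d - R.mass D e) with h | h <;> rw [h]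
    ring
  have hzw : ∀ e, ι.w D (ι.edgeClass e) = 0 → (R.mass D e = 0 ∨ R.mass D e = d) ∧ 0 ≤ d :=
    fun e he => by
      have h1 := hprod e
      rw [he, zero_mul] at h1
      rw [hw] at he
      have h2 := min_le_left (R.mass D e) (d - R.mass D e)
      have h3 := min_le_right (R.mass D e) (d - R.mass D e)
      refine ⟨?_, by linarith⟩
      rcases mul_eq_zero.1 h1.symm with h | h
      · exact Or.inl h
      · exact Or.inr (by linarith)
  have hS : 0 ≤ d / (d + 2) * ∑ e, L e * ((1 - R.upShare L j e - R.lowShare L j e) ^ 2 / 3 +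
        (R.upShare L j e - R.lowShare L j e) ^ 2 - z e) := by
    -- For d < -2 the smaller of M and d - M is negative, so w never vanishes and the summands are
    -- nonnegative one by one. For d = 0 the prefactor vanishes.
    rcases hdeg with h | h
    · refine mul_nonneg (div_nonneg_of_nonpos (by linarith) (by linarith))
        (Finset.sum_nonneg fun e _ => mul_nonneg (H.length_pos e).le ?_)
      have hze : z e = 0 := if_pos fun h0 => by have := (hzw e h0).2; linarith
      rw [hze, sub_zero]
      positivity
    rcases h.eq_or_lt with h0 | h0
    · rw [← h0]; simp
    · refine mul_nonneg (by positivity) (H.sum_length_mul_nonneg hDi hD h0 fun e => ?_)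
      by_cases he : ι.w D (ι.edgeClass e) = 0
      · exact Or.inl ⟨if_neg (not_not.2 he), (hzw e he).1⟩
      · exact Or.inr (if_pos he)
  rw [Finset.mul_sum] at hS
  have hrw : ∀ e, L e * ((if ι.w D (ι.edgeClass e) ≠ 0 then d / (d + 2) +
          ι.w D (ι.edgeClass e) * (d - ι.w D (ι.edgeClass e)) / (d + 2)
        else 5 / 6 * (d / (d + 2))) / 2) = L e * (R.mass D e * (d - R.mass D e) / 2 + d *
      (1 / 2 - (1 - R.upShare L j e - R.lowShare L j e) ^ 2 / 6 -
        (R.upShare L j e - R.lowShare L j e) ^ 2 / 2)) / (d + 2) +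
      d / (d + 2) * (L e * ((1 - R.upShare L j e - R.lowShare L j e) ^ 2 / 3 +
        (R.upShare L j e - R.lowShare L j e) ^ 2 - z e)) / 2 := fun e => by
    have h1 := hprod e
    by_cases he : ι.w D (ι.edgeClass e) = 0
    · have hze : z e = 1 / 6 := if_neg (not_not.2 he)
      rw [he, zero_mul] at h1
      rw [if_neg (not_not.2 he), hze, ← h1]
      field_simp
      ring
    · have hze : z e = 0 := if_pos he
      rw [if_pos he, hze, h1]
      field_simp
      ring
  rw [Finset.sum_congr rfl fun e _ => hrw e, Finset.sum_add_distrib, ← Finset.sum_div _ _ (2 : ℝ)]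
  linarith

end Rooting.IsMetrized

/-- The bound for the admissible constant of a hyperelliptic graph. -/
theorem IsHyperelliptic.admissibleConstant_le [Fintype V] [Fintype E] (hι : ι.IsHyperelliptic)
    {D : V → ℝ} (hD : ∀ v, ι.vert v ≠ v → D v = (ι.nu v : ℝ) - 2)
    (hdeg : divDeg D < -2 ∨ 0 ≤ divDeg D) {l : ι.EdgeClass → ℝ} (hl : ∀ ē, 0 < l ē) :
    G.admissibleConstant (fun e => l (ι.edgeClass e)) D ≤
      (∑ ē with ι.w D ē ≠ 0, (divDeg D / (divDeg D + 2) +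
        ι.w D ē * (divDeg D - ι.w D ē) / (divDeg D + 2)) * l ē) +
      ∑ ē with ι.w D ē = 0, 5 / 6 * (divDeg D / (divDeg D + 2)) * l ē := by
  classical
  obtain ⟨o, ho⟩ := exists_fixed hι
  obtain ⟨R⟩ := ι.exists_rooting hι.quotAcyclic o
  have hpos : ∀ e, 0 < l (ι.edgeClass e) := fun e => hl _
  obtain ⟨j, hj⟩ := hι.connected.exists_isGreen hpos o
  have H : R.IsMetrized (fun e => l (ι.edgeClass e)) j :=
    ⟨hι, ho, hpos, fun e => by rw [edgeClass_edge], hj⟩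
  have hD' : ∀ e, ι.vert (R.low e) ≠ R.low e →
      D (R.low e) = (Finset.univ.filter fun f => R.up f = R.low e).card - 1 := fun e hv => by
    rw [hD _ hv, R.nu_low hι.connected hv]
    push_cast
    ring
  -- Off the fixed vertices the coefficient is determined by the number of edges leaving downwards,
  -- which ι preserves; at fixed vertices invariance is automatic.
  have hDi : ∀ v, D (ι.vert v) = D v := fun v => by
    by_cases hv : ι.vert v = v
    · rw [hv]
    obtain ⟨e, rfl⟩ := H.exists_low_eq hv
    have h1 := hD' (ι.edge e)
    rw [R.low_edge hι.connected, R.card_up_vert hι.connected] at h1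
    rw [hD' e hv, h1 (Rooting.vert_ne_iff.2 hv)]
  refine (H.admissibleConstant_le hDi hD' hdeg).trans_eq ?_
  rw [sum_edgeClass hι.edge_ne fun ē => l ē * ((if ι.w D ē ≠ 0 then divDeg D / (divDeg D + 2) +
    ι.w D ē * (divDeg D - ι.w D ē) / (divDeg D + 2) else 5 / 6 * (divDeg D / (divDeg D + 2))) / 2),
    Finset.sum_filter, Finset.sum_filter, ← Finset.sum_add_distrib, Finset.mul_sum]
  refine Finset.sum_congr rfl fun ē _ => ?_
  by_cases h : ι.w D ē = 0
  · simp only [h, ne_eq, not_true_eq_false, if_true, if_false]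
    ring
  · simp only [h, ne_eq, not_false_eq_true, if_true, if_false]
    ring

end Involution

end MultiGraph

theorem corollary4p2 {V E : Type*} [Fintype V] [Fintype E]
    (G : MultiGraph V E) (ι : G.Involution) (hG : ι.IsHyperelliptic)
    (D : V → ℝ) (hD : ∀ v, ι.vert v ≠ v → D v = (ι.nu v : ℝ) - 2)
    (hdeg : MultiGraph.divDeg D < -2 ∨ 0 ≤ MultiGraph.divDeg D)
    (l : ι.EdgeClass → ℝ) (hl : ∀ ē, 0 < l ē) :
    let d : ℝ := MultiGraph.divDeg D
    let ε : ℝ := G.admissibleConstant (fun e => l (ι.edgeClass e)) D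
    (ε ≤ (∑ ē with ι.w D ē ≠ 0,
            (4 / 3 * (d / (d + 2)) + ι.w D ē * (d - ι.w D ē) / (d + 2)) * l ē)
          + ∑ ē with ι.w D ē = 0, 5 / 6 * (d / (d + 2)) * l ē) ∧
    ((∀ S, G.IsIrredComponent S → ι.size S < 5) →
      ε ≤ (∑ ē with ι.w D ē ≠ 0,
            (d / (d + 2) + ι.w D ē * (d - ι.w D ē) / (d + 2)) * l ē)
          + ∑ ē with ι.w D ē = 0, 5 / 6 * (d / (d + 2)) * l ē) := by
  intro d ε
  have h := hG.admissibleConstant_le hD hdeg hl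
  -- The sign of d/(d+2) allows the coefficient 1 to be enlarged to 4/3.
  have hκ : 0 ≤ d / (d + 2) := by
    rcases hdeg with h | h
    · exact div_nonneg_of_nonpos (by linarith) (by linarith)
    · exact div_nonneg h (by linarith)
  refine ⟨h.trans (add_le_add (Finset.sum_le_sum fun ē _ => ?_) le_rfl), fun _ => h⟩
  exact mul_le_mul_of_nonneg_right (by linarith) (hl ē).le
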